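/- Let $N(m,n)$ be the number of partitions of $n$ whose rank (largest part minus number of parts; the empty partition has rank $0$) equals $m$, and put $R(z,q)=\sum_{n\ge0}\sum_{m}N(m,n)z^mq^n$. Write $(a;p)_\infty=\prod_{n\ge0}(1-ap^n)$, $(a)_\infty=(a;q)_\infty$, $J_b=(q^b;q^b)_\infty$ and $J_{b,a}=(q^a;q^b)_\infty(q^{b-a};q^b)_\infty(q^b;q^b)_\infty$. For a power series $F(q)=\sum_n a(n)q^n$ let $U_{7,r}(F)=\sum_n a(7n+r)q^n$. Let $\zeta=\exp(2\pi i/7)$ and let $R_k(q)=U_{7,k}(R(\zeta,q))$ be the components of the $7$-dissection $R(\zeta,q)=\sum_{k=0}^{6}q^kR_k(q^7)$. Then the following hold as identities of power series in $q$ over $\mathbb{C}$. (a) (Sifted products) $$U_{7,4}\left((\zeta q)_\infty(\zeta^{-1}q)_\infty(q)_\infty R(\zeta,q)\right)=J_7^2,$$ $$U_{7,4}\left((1+\zeta)(\zeta^2q)_\infty(\zeta^{-2}q)_\infty(q)_\infty R(\zeta,q)\right)=2\zeta^4J_7^2,$$ $$U_{7,3}\left((1+\zeta)(\zeta^2q^2;q^2)_\infty(\zeta^{-2}q^2;q^2)_\infty(q^2;q^2)_\infty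 R(\zeta,q)\right)=2\zeta^4\,q\,\frac{J_{14}^3}{J_7}.$$ (b) (Linear equations) The triple $(X_1,X_3,X_4)=(R_1,R_3,R_4)$ satisfies $$-(\zeta^4+\zeta^3)J_{7,1}X_1+(\zeta^5+\zeta^4+\zeta^3+\zeta^2)J_{7,2}X_3+J_{7,3}X_4=J_7^2,$$ $$(\zeta^5+\zeta^4+\zeta^3)J_{7,1}X_1+\zeta^4J_{7,2}X_3+(\zeta+1)J_{7,3}X_4=2\zeta^4J_7^2,$$ $$\zeta^4J_{14,4}X_1+(\zeta+1)J_{14,6}X_3+(\zeta^5+\zeta^4+\zeta^3)\,q\,J_{14,2}X_4=2\zeta^4\,q\,\frac{J_{14}^3}{J_7}.$$ (c) (Solution) If power series $X_1,X_3,X_4\in\mathbb{C}[[q]]$ satisfy the three equations in (b), then $$X_1=\frac{J_7^2}{J_{7,1}},\qquad X_3=(\zeta^5+\zeta^2+1)\frac{J_7^2}{J_{7,2}},\qquad X_4=-(\zeta^5+\zeta^2)\frac{J_7^2}{J_{7,3}}.$$ (d) Consequently $$R_1=\frac{J_7^2}{J_{7,1}},\qquad R_3=(\zeta^5+\zeta^2+1)\frac{J_7^2}{J_{7,2}},\qquad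 R_4=-(\zeta^5+\zeta^2)\frac{J_7^2}{J_{7,3}}.$$ -/

import Mathlib

open scoped PowerSeries.WithPiTopology

noncomputable section

namespace RankDissection

/-- Dyson's rank of a partition: the largest part minus the number of parts
(the empty partition has rank `0`). -/
def rank {n : ℕ} (p : n.Partition) : ℤ :=
  (p.parts.sup : ℤ) - (Multiset.card p.parts : ℤ)

/-- `N(m, n)`: the number of partitions of `n` with rank `m`. -/
def rankCount (m : ℤ) (n : ℕ) : ℕ :=
  (Finset.univ.filter fun p : n.Partition => rank p = m).card

theorem abs_rank_le {n : ℕ} (p : n.Partition) : |rank p| ≤ n := by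
  have h1 : p.parts.sup ≤ n :=
    Multiset.sup_le.2 fun a ha => p.le_of_mem_parts ha
  have h2 : Multiset.card p.parts ≤ n := by
    have h := Multiset.card_nsmul_le_sum (s := p.parts) (a := 1)
      fun a ha => p.parts_pos ha
    simpa [p.parts_sum] using h
  unfold rank
  rw [abs_le]
  constructor <;> omega

/-- There are no partitions of `n` with rank outside `[-n, n]`. -/
theorem rankCount_eq_zero {m : ℤ} {n : ℕ} (h : (n : ℤ) < |m|) : rankCount m n = 0 := by
  unfold rankCount
  rw [Finset.card_eq_zero, Finset.filter_eq_empty_iff]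
  rintro p - rfl
  exact absurd (abs_rank_le p) (not_le.2 h)

/-- The rank generating function `R(z, q) = ∑ₙ ∑ₘ N(m, n) zᵐ qⁿ`, as a power series in `q`
for a fixed complex `z ≠ 0`. The inner sum runs over `-n ≤ m ≤ n`, outside of which
`N(m, n)` vanishes by `rankCount_eq_zero`. -/
def rankSeries (z : ℂ) : PowerSeries ℂ :=
  PowerSeries.mk fun n => ∑ m ∈ Finset.Icc (-(n : ℤ)) (n : ℤ), (rankCount m n : ℂ) * z ^ m

/-- The operator `U_{p,r}`: it sends `∑ a(n) qⁿ` to `∑ a(p n + r) qⁿ`. For `0 ≤ r < p` this is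
the component `F_r` of the `p`-dissection, see `dissection`. -/
def U (p r : ℕ) (F : PowerSeries ℂ) : PowerSeries ℂ :=
  PowerSeries.mk fun n => PowerSeries.coeff (p * n + r) F

/-- The `p`-dissection `F(q) = ∑_{0 ≤ r < p} q^r F_r(q^p)`, with `F_r = U_{p,r}(F)`. -/
theorem dissection (p : ℕ) (hp : p ≠ 0) (F : PowerSeries ℂ) :
    F = ∑ r ∈ Finset.range p, PowerSeries.X ^ r * PowerSeries.expand p hp (U p r F) := by
  ext n
  rw [map_sum, Finset.sum_eq_single (n % p)]
  · rw [PowerSeries.coeff_X_pow_mul', if_pos (Nat.mod_le n p), PowerSeries.coeff_expand,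
      if_pos (Nat.dvd_sub_mod n)]
    simp only [U, PowerSeries.coeff_mk]
    rw [Nat.mul_div_cancel' (Nat.dvd_sub_mod n), Nat.sub_add_cancel (Nat.mod_le n p)]
  · intro r hr hne
    rw [PowerSeries.coeff_X_pow_mul']
    split_ifs with h
    · rw [PowerSeries.coeff_expand, if_neg]
      intro hd
      apply hne
      have hmod : n ≡ r [MOD p] := ((Nat.modEq_iff_dvd' h).2 hd).symm
      have := Nat.mod_eq_of_lt (Finset.mem_range.1 hr)
      rw [← this]
      exact hmod.symm
    · rfl
  · intro h
    exact absurd (Finset.mem_range.2 (Nat.mod_lt n (Nat.pos_of_ne_zero hp))) h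

/-- The infinite `q`-Pochhammer symbol `(a; p)_∞ = ∏_{n ≥ 0} (1 - a pⁿ)`, for power series `a`
and `p`. The product converges coefficientwise when `p` has zero constant term,
see `multipliable_qPoch`. -/
def qPoch (a p : PowerSeries ℂ) : PowerSeries ℂ :=
  ∏' n : ℕ, (1 - a * p ^ n)

theorem multipliable_qPoch (a : PowerSeries ℂ) {p : PowerSeries ℂ}
    (hp : PowerSeries.constantCoeff p = 0) : Multipliable fun n : ℕ => 1 - a * p ^ n := by
  simp_rw [sub_eq_add_neg]
  apply PowerSeries.WithPiTopology.multipliable_one_add_of_tendsto_order_atTop_nhds_top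
  refine ENat.tendsto_nhds_top_iff_natCast_lt.mpr fun n =>
    Filter.eventually_atTop.mpr ⟨n + 1, fun m hm => ?_⟩
  rw [PowerSeries.order_neg]
  have h1 : (m : ℕ∞) ≤ (p ^ m).order := PowerSeries.le_order_pow_of_constantCoeff_eq_zero m hp
  have h2 : (p ^ m).order ≤ (a * p ^ m).order :=
    le_trans le_add_self (PowerSeries.le_order_mul a (p ^ m))
  exact lt_of_lt_of_le (by exact_mod_cast hm) (h1.trans h2)

theorem constantCoeff_qPoch {a p : PowerSeries ℂ} (ha : PowerSeries.constantCoeff a = 0)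
    (hp : PowerSeries.constantCoeff p = 0) : PowerSeries.constantCoeff (qPoch a p) = 1 := by
  unfold qPoch
  rw [(multipliable_qPoch a hp).map_tprod _
    (PowerSeries.WithPiTopology.continuous_constantCoeff ℂ)]
  simp [ha]

/-- `J_b = (q^b; q^b)_∞`. -/
def J (b : ℕ) : PowerSeries ℂ :=
  qPoch (PowerSeries.X ^ b) (PowerSeries.X ^ b)

/-- `J_{b,a} = j(q^a; q^b) = (q^a; q^b)_∞ (q^{b-a}; q^b)_∞ (q^b; q^b)_∞`, used for `0 < a < b`. -/
def Jt (b a : ℕ) : PowerSeries ℂ :=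
  qPoch (PowerSeries.X ^ a) (PowerSeries.X ^ b) *
    qPoch (PowerSeries.X ^ (b - a)) (PowerSeries.X ^ b) *
    qPoch (PowerSeries.X ^ b) (PowerSeries.X ^ b)

/-- `J_b` has constant term `1`, so it is invertible as a power series. -/
theorem constantCoeff_J {b : ℕ} (hb : 0 < b) : PowerSeries.constantCoeff (J b) = 1 :=
  constantCoeff_qPoch (by simp [hb.ne']) (by simp [hb.ne'])

/-- `J_{b,a}` has constant term `1`, so it is invertible as a power series. -/
theorem constantCoeff_Jt {b a : ℕ} (ha : 0 < a) (hab : a < b) :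
    PowerSeries.constantCoeff (Jt b a) = 1 := by
  have hb : b ≠ 0 := by omega
  have hba : b - a ≠ 0 := by omega
  unfold Jt
  rw [map_mul, map_mul, constantCoeff_qPoch, constantCoeff_qPoch, constantCoeff_qPoch] <;>
    simp [hb, hba, ha.ne']

end RankDissection

end

/-!
The sifted products are obtained coefficient by coefficient. Regard the rank generating function
`R(z, q)` as a power series in `q` over Laurent polynomials in `z`. Writing it as `∑ₙ (zq)ⁿ Eₙ`,
up to elementary corrections, with `Eₙ` the generating function of partitions with parts at most
`n`, one finds a functional equation under `z ↦ zq` (`isShift_rankBi`). Multiplied by a theta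
function vanishing at `z = 1`, the pole of `R(z, q) / (1 - z)` disappears, and the functional
equation becomes a recurrence for the coefficients of each of the three products `rankH`, `rankK`,
`rankL`: along an explicit orbit in the `(m, n)`-lattice the coefficient of `zᵐqⁿ` is constant (up
to sign for `rankK`), except for jumps at the exponents of a theta series (`bc_rankH`, `bc_rankK`,
`bc_rankL`). The coefficients are determined by these recurrences, because they vanish for
negative `n` or, for `rankK`, because of the symmetry of the rank.

A jump on an orbit means that a certain quadratic polynomial in `m` and `n` is a square. Since `3`
is not a square modulo `7`, the coefficients in the relevant residue class of `n` vanish unless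
`(m, n)` lies in an affine sublattice of index `7` in each coordinate; and seven steps of the
recurrence on this sublattice amount to one step of the original recurrence (`bc_rankH_seven`,
`bc_rankK_seven`, `bc_rankL_seven`). Hence the sifted product at a seventh root of unity `ζ` is,
up to a power of `ζ` and of `q`, the product at `z = 1` with `q` replaced by `q` to the seventh
power, and there it is a quotient of Euler products (`U_evalZ`). This gives the sifted products.

On the other hand the theta functions have a `7`-dissection at a seventh root of unity, by the
Jacobi triple product (`evalZ_thetaQuot_seven`); multiplying it with the dissection of `R(ζ, q)`
turns the sifted products into the linear equations for the components.

Two of these equations determine the unknowns up to one degree of freedom. That the third is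
consistent with the claimed solution is the theta function identity `theta_identity`. It follows
from comparing components in `J₁ ϑ(-1, -q) = 2 J₂²`, where the components of `J₁` are quotients of
theta functions, which in turn is read off from `J₁² J₇ = ∏_{a = 1}^{3} (ζᵃq)_∞ (ζ⁻ᵃq)_∞ (q)_∞`
(`exists_J_one_dissection_theta`). Finally the third equation forces the remaining degree of
freedom to vanish, because it enters with a factor with nonzero constant term
(`linear_system_unique`).
-/

noncomputable section

namespace RankDissection

open PowerSeries Finset

/-! ### Formal limits and infinite products of power series -/

section Limits

variable {S S' : Type*} [CommRing S] [CommRing S']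

/-- Formal convergence at a fixed rate: the `n`-th term of `u` agrees with `P` modulo `X ^ n`.
All limits below converge at this rate, and no topology on the coefficients is needed. -/
def IsLim (u : ℕ → S⟦X⟧) (P : S⟦X⟧) : Prop :=
  ∀ n, X ^ n ∣ u n - P

theorem eq_of_X_pow_dvd_sub {P Q : S⟦X⟧} (h : ∀ n, X ^ n ∣ P - Q) : P = Q := by
  ext n
  have := X_pow_dvd_iff.1 (h (n + 1)) n (Nat.lt_succ_self n)
  rwa [map_sub, sub_eq_zero] at this

theorem IsLim.unique {u : ℕ → S⟦X⟧} {P Q : S⟦X⟧} (hP : IsLim u P) (hQ : IsLim u Q) : P = Q :=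
  eq_of_X_pow_dvd_sub fun n => by simpa using dvd_sub (hQ n) (hP n)

theorem IsLim.comp {u : ℕ → S⟦X⟧} {P : S⟦X⟧} (h : IsLim u P) {f : ℕ → ℕ} (hf : ∀ n, n ≤ f n) :
    IsLim (fun n => u (f n)) P :=
  fun n => (pow_dvd_pow X (hf n)).trans (h (f n))

theorem IsLim.mul {u v : ℕ → S⟦X⟧} {P Q : S⟦X⟧} (hP : IsLim u P) (hQ : IsLim v Q) :
    IsLim (fun n => u n * v n) (P * Q) := fun n => by
  have : u n * v n - P * Q = (u n - P) * v n + P * (v n - Q) := by ring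
  rw [this]
  exact dvd_add ((hP n).mul_right _) ((hQ n).mul_left _)

theorem isLim_const (P : S⟦X⟧) : IsLim (fun _ => P) P := fun n => by simp

theorem IsLim.prod {ι : Type*} {s : Finset ι} {u : ι → ℕ → S⟦X⟧} {P : ι → S⟦X⟧}
    (h : ∀ i ∈ s, IsLim (u i) (P i)) : IsLim (fun n => ∏ i ∈ s, u i n) (∏ i ∈ s, P i) := by
  classical
  induction s using Finset.induction_on with
  | empty => simpa using isLim_const (1 : S⟦X⟧)
  | insert a s ha ih =>
    simp only [Finset.prod_insert ha]
    exact (h a (mem_insert_self a s)).mul (ih fun i hi => h i (mem_insert_of_mem hi))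

theorem X_pow_dvd_expand {k : ℕ} (hk : k ≠ 0) {n : ℕ} {f : S⟦X⟧} (h : X ^ n ∣ f) :
    X ^ n ∣ expand k hk f := by
  have h1 := map_dvd (expand k hk) h
  rw [map_pow, expand_X, ← pow_mul] at h1
  exact (pow_dvd_pow X (Nat.le_mul_of_pos_left n (Nat.pos_of_ne_zero hk))).trans h1

theorem IsLim.expand {u : ℕ → S⟦X⟧} {P : S⟦X⟧} (h : IsLim u P) {k : ℕ} (hk : k ≠ 0) :
    IsLim (fun n => PowerSeries.expand k hk (u n)) (PowerSeries.expand k hk P) := fun n => by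
  simpa using X_pow_dvd_expand hk (h n)

/-- The partial product `∏_{i < n} (1 - a pⁱ)`. -/
def pochFin (a p : S⟦X⟧) (n : ℕ) : S⟦X⟧ :=
  ∏ i ∈ range n, (1 - a * p ^ i)

/-- The formal infinite product `(a; p)_∞` over an arbitrary coefficient ring; it is the limit of
the partial products as soon as `X ∣ p`, see `isLim_pochFin`. -/
def poch (a p : S⟦X⟧) : S⟦X⟧ :=
  PowerSeries.mk fun n => coeff n (pochFin a p (n + 1))

theorem mul_pow_dvd_pochFin_sub (a p : S⟦X⟧) {n m : ℕ} (h : n ≤ m) :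
    a * p ^ n ∣ pochFin a p m - pochFin a p n := by
  induction m, h using Nat.le_induction with
  | base => simp
  | succ m hm ih =>
    have : pochFin a p (m + 1) - pochFin a p n =
        (pochFin a p m - pochFin a p n) - pochFin a p m * (a * p ^ m) := by
      simp only [pochFin, prod_range_succ]; ring
    rw [this]
    exact dvd_sub ih ((mul_dvd_mul_left a (pow_dvd_pow p hm)).mul_left _)

theorem X_pow_dvd_pochFin_sub (a : S⟦X⟧) {p : S⟦X⟧} (hp : X ∣ p) {n m : ℕ} (h : n ≤ m) :
    X ^ n ∣ pochFin a p m - pochFin a p n :=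
  (((pow_dvd_pow_of_dvd hp n).mul_left a)).trans (mul_pow_dvd_pochFin_sub a p h)

theorem isLim_pochFin (a : S⟦X⟧) {p : S⟦X⟧} (hp : X ∣ p) : IsLim (pochFin a p) (poch a p) := by
  intro n
  rw [X_pow_dvd_iff]
  intro m hm
  have := X_pow_dvd_iff.1 (X_pow_dvd_pochFin_sub a hp (Nat.succ_le_of_lt hm)) m (Nat.lt_succ_self m)
  simpa [poch] using this

theorem map_poch (φ : S →+* S') (a p : S⟦X⟧) :
    PowerSeries.map φ (poch a p) = poch (PowerSeries.map φ a) (PowerSeries.map φ p) := by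
  ext n
  simp only [poch, coeff_map, coeff_mk]
  rw [← coeff_map]
  simp [pochFin, map_prod]

theorem IsLim.congr {u v : ℕ → S⟦X⟧} {P : S⟦X⟧} (h : IsLim u P) (huv : ∀ n, u n = v n) :
    IsLim v P := fun n => huv n ▸ h n

theorem poch_eq_mul (a : S⟦X⟧) {p : S⟦X⟧} (hp : X ∣ p) :
    poch a p = (1 - a) * poch (a * p) p := by
  refine ((isLim_pochFin a hp).comp Nat.le_succ).unique
    (((isLim_const (1 - a)).mul (isLim_pochFin (a * p) hp)).congr fun n => ?_)
  simp only [pochFin, prod_range_succ', pow_zero, mul_one, pow_succ', mul_assoc]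
  ring

/-- Splitting the factors of `(a; p)_∞` by the residue of their index modulo `k`. -/
theorem poch_eq_prod (a : S⟦X⟧) {p : S⟦X⟧} (hp : X ∣ p) {k : ℕ} (hk : k ≠ 0) :
    poch a p = ∏ r ∈ range k, poch (a * p ^ r) (p ^ k) := by
  refine ((isLim_pochFin a hp).comp (fun n => Nat.le_mul_of_pos_left n
    (Nat.pos_of_ne_zero hk))).unique (IsLim.congr (IsLim.prod fun r _ =>
      isLim_pochFin (a * p ^ r) (hp.trans (dvd_pow_self p hk))) fun n => ?_)
  induction n with
  | zero => simp [pochFin]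
  | succ n ih =>
    have h1 : ∏ i ∈ range k, pochFin (a * p ^ i) (p ^ k) (n + 1) =
        (∏ i ∈ range k, pochFin (a * p ^ i) (p ^ k) n) *
          ∏ r ∈ range k, (1 - a * p ^ (k * n + r)) := by
      rw [← prod_mul_distrib]
      refine prod_congr rfl fun r _ => ?_
      simp only [pochFin, prod_range_succ]
      ring
    rw [h1, ih, pochFin, pochFin, Nat.mul_succ, prod_range_add]

theorem expand_poch {k : ℕ} (hk : k ≠ 0) (a : S⟦X⟧) {p : S⟦X⟧} (hp : X ∣ p) :
    expand k hk (poch a p) = poch (expand k hk a) (expand k hk p) := by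
  have hp' : X ∣ expand k hk p := by
    simpa using X_pow_dvd_expand hk (n := 1) (by simpa using hp)
  refine ((isLim_pochFin a hp).expand hk).unique
    ((isLim_pochFin _ hp').congr fun n => ?_)
  simp [pochFin, map_prod]

theorem constantCoeff_poch {a p : S⟦X⟧} (ha : constantCoeff a = 0) :
    constantCoeff (poch a p) = 1 := by
  rw [← coeff_zero_eq_constantCoeff_apply]
  simp [poch, pochFin, ha]

end Limits

/-- Over `ℂ` the topological product `qPoch` is the formal one. -/
theorem qPoch_eq_poch (a : ℂ⟦X⟧) {p : ℂ⟦X⟧} (hp : X ∣ p) : qPoch a p = poch a p := by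
  have h := (multipliable_qPoch a (X_dvd_iff.1 hp)).hasProd.tendsto_prod_nat
  rw [PowerSeries.WithPiTopology.tendsto_iff_coeff_tendsto] at h
  ext n
  refine tendsto_nhds_unique (h n) (tendsto_const_nhds.congr' ?_)
  filter_upwards [Filter.eventually_ge_atTop (n + 1)] with m hm
  have := X_pow_dvd_iff.1 (((isLim_pochFin a hp).comp (f := fun i => max i m)
    (fun i => le_max_left _ _)) (n + 1)) n (Nat.lt_succ_self n)
  simp only [max_eq_right hm] at this
  rw [map_sub, sub_eq_zero] at this
  exact this.symm

/-! ### The Jacobi triple product -/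

section TripleProduct

variable {S S' : Type*} [CommRing S] [CommRing S']

/-- The Gaussian binomial coefficient `[a + b choose a]` at `p`. -/
def gauss (p : S⟦X⟧) : ℕ → ℕ → S⟦X⟧
  | 0, _ => 1
  | _ + 1, 0 => 1
  | a + 1, b + 1 => gauss p a (b + 1) + p ^ (a + 1) * gauss p (a + 1) b

theorem gauss_zero_right (p : S⟦X⟧) (a : ℕ) : gauss p a 0 = 1 := by
  cases a <;> simp [gauss]

theorem gauss_mul (p : S⟦X⟧) (a b : ℕ) :
    gauss p a b * pochFin p p a * pochFin p p b = pochFin p p (a + b) := by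
  induction a generalizing b with
  | zero => simp [gauss, pochFin]
  | succ a iha =>
    induction b with
    | zero => simp [gauss, pochFin]
    | succ b ihb =>
      have h1 := iha (b + 1)
      have e : ∀ n, pochFin p p (n + 1) = pochFin p p n * (1 - p ^ (n + 1)) := fun n => by
        simp only [pochFin, prod_range_succ, pow_succ']
      rw [show a + 1 + (b + 1) = (a + b + 1) + 1 by ring, e (a + b + 1)]
      rw [show a + (b + 1) = a + b + 1 by ring] at h1
      rw [show a + 1 + b = a + b + 1 by ring] at ihb
      rw [gauss, add_mul, add_mul]
      have h2 : gauss p a (b + 1) * pochFin p p (a + 1) * pochFin p p (b + 1) =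
          pochFin p p (a + b + 1) * (1 - p ^ (a + 1)) := by
        rw [← h1, e a]; ring
      have h3 : gauss p (a + 1) b * pochFin p p (a + 1) * pochFin p p (b + 1) =
          pochFin p p (a + b + 1) * (1 - p ^ (b + 1)) := by
        rw [← ihb, e b]; ring
      rw [h2, mul_assoc (p ^ (a + 1)), mul_assoc (p ^ (a + 1)), h3]
      ring

theorem isUnit_pochFin {a p : S⟦X⟧} (ha : X ∣ a) (n : ℕ) : IsUnit (pochFin a p n) := by
  rw [isUnit_iff_constantCoeff]
  have : constantCoeff a = 0 := X_dvd_iff.1 ha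
  simp [pochFin, map_prod, this]

theorem gauss_symm {p : S⟦X⟧} (hp : X ∣ p) (a b : ℕ) : gauss p a b = gauss p b a := by
  have h1 := gauss_mul p a b
  have h2 := gauss_mul p b a
  rw [add_comm b a, ← h1, mul_assoc, mul_assoc, mul_comm (pochFin p p b)] at h2
  exact (((isUnit_pochFin hp a).mul (isUnit_pochFin hp b)).mul_right_cancel h2).symm

/-- The triangular number `k (k + 1) / 2` of an integer `k`. -/
def tri (k : ℤ) : ℕ := (k * (k + 1) / 2).toNat

theorem two_mul_tri (k : ℤ) : 2 * (tri k : ℤ) = k * (k + 1) := by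
  have h0 : 0 ≤ k * (k + 1) := by
    rcases le_or_gt 0 k with h | h <;> nlinarith
  rw [tri, Int.toNat_of_nonneg (by omega)]
  exact Int.mul_ediv_cancel' (Int.even_mul_succ_self k).two_dvd

/-- The general term of Ramanujan's theta series, with signs:
`(-1)ᵏ u^{k(k+1)/2} v^{k(k-1)/2}`. Both exponents are natural numbers. -/
def thetaTerm (u v : S⟦X⟧) (k : ℤ) : S⟦X⟧ :=
  ((k.negOnePow : ℤ) : S⟦X⟧) * u ^ tri k * v ^ tri (-k)

/-- The theta product `(u; uv)_∞ (v; uv)_∞ (uv; uv)_∞`. -/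
def theta (u v : S⟦X⟧) : S⟦X⟧ :=
  poch u (u * v) * poch v (u * v) * poch (u * v) (u * v)

theorem theta_symm (u v : S⟦X⟧) : theta u v = theta v u := by
  simp only [theta, mul_comm v u]; ring

theorem map_theta (φ : S →+* S') (u v : S⟦X⟧) :
    PowerSeries.map φ (theta u v) = theta (PowerSeries.map φ u) (PowerSeries.map φ v) := by
  simp [theta, map_poch]

theorem expand_theta {k : ℕ} (hk : k ≠ 0) {u v : S⟦X⟧} (h : X ∣ u * v) :
    expand k hk (theta u v) = theta (expand k hk u) (expand k hk v) := by
  simp [theta, expand_poch, h]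

/-- The partial sum over `-n ≤ k ≤ n` of the theta series. -/
def thetaFin (u v : S⟦X⟧) (n : ℕ) : S⟦X⟧ :=
  ∑ j ∈ range (2 * n + 1), thetaTerm u v ((j : ℤ) - n)

theorem thetaTerm_swap (u v : S⟦X⟧) (k : ℤ) : thetaTerm v u (-k) = thetaTerm u v k := by
  simp only [thetaTerm, neg_neg, Int.negOnePow_neg]; ring

theorem mul_thetaTerm (u v : S⟦X⟧) {n d : ℕ} {k : ℤ} (h : (d : ℤ) = n - k) :
    u * (u * v) ^ n * thetaTerm u v k = -((u * v) ^ d * thetaTerm u v (k + 1)) := by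
  have h1 : n + 1 + tri k = d + tri (k + 1) := by
    have := two_mul_tri k
    have := two_mul_tri (k + 1)
    zify; nlinarith
  have h2 : n + tri (-k) = d + tri (-(k + 1)) := by
    have := two_mul_tri (-k)
    have := two_mul_tri (-(k + 1))
    zify; nlinarith
  have h3 : u * (u * v) ^ n * thetaTerm u v k =
      ((k.negOnePow : ℤ) : S⟦X⟧) * u ^ (n + 1 + tri k) * v ^ (n + tri (-k)) := by
    simp only [thetaTerm]; ring
  rw [h3, h1, h2]
  simp only [thetaTerm, Int.negOnePow_succ, Units.val_neg, Int.cast_neg]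
  ring

/-- Multiplying by one more factor `1 - u pᵃ`; the sum is reorganised by the Pascal rule. -/
theorem sum_gauss_step (u v : S⟦X⟧) (a b : ℕ) :
    (∑ x ∈ antidiagonal (a + b), gauss (u * v) x.1 x.2 * thetaTerm u v ((x.2 : ℤ) - b)) *
        (1 - u * (u * v) ^ a) =
      ∑ x ∈ antidiagonal (a + 1 + b),
        gauss (u * v) x.1 x.2 * thetaTerm u v ((x.2 : ℤ) - b) := by
  set p := u * v with hp
  have key : ∀ x ∈ antidiagonal (a + 1 + b), gauss p x.1 x.2 * thetaTerm u v ((x.2 : ℤ) - b) =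
      (if x.1 = 0 then 0 else gauss p (x.1 - 1) x.2 * thetaTerm u v ((x.2 : ℤ) - b)) +
      (if x.2 = 0 then 0 else p ^ x.1 * gauss p x.1 (x.2 - 1) * thetaTerm u v ((x.2 : ℤ) - b)) := by
    rintro ⟨i, j⟩ hx
    rw [HasAntidiagonal.mem_antidiagonal] at hx
    rcases i with _ | i <;> rcases j with _ | j
    · simp at hx; omega
    · simp [gauss]
    · simp [gauss_zero_right]
    · simp [gauss]; ring
  rw [sum_congr rfl key, sum_add_distrib]
  rw [show a + 1 + b = a + b + 1 by ring]
  rw [Nat.sum_antidiagonal_succ, Nat.sum_antidiagonal_succ']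
  simp only [if_true, Nat.add_eq_zero_iff, one_ne_zero, and_false, if_false, Nat.add_sub_cancel,
    zero_add]
  rw [mul_sub, mul_one, sub_eq_add_neg, sum_mul, ← sum_neg_distrib]
  congr 1
  refine sum_congr rfl fun x hx => ?_
  rw [HasAntidiagonal.mem_antidiagonal] at hx
  have := mul_thetaTerm u v (n := a) (d := x.1) (k := (x.2 : ℤ) - b) (by omega)
  rw [← hp] at this
  push_cast
  rw [show ((x.2 : ℤ) + 1 - b) = (x.2 : ℤ) - b + 1 by ring]
  linear_combination (-gauss p x.1 x.2) * this

/-- MacMahon's finite form of the Jacobi triple product. -/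
theorem pochFin_mul_pochFin {u v : S⟦X⟧} (h : X ∣ u * v) (a b : ℕ) :
    pochFin u (u * v) a * pochFin v (u * v) b =
      ∑ x ∈ antidiagonal (a + b), gauss (u * v) x.1 x.2 * thetaTerm u v ((x.2 : ℤ) - b) := by
  induction a with
  | succ a ih =>
    rw [← sum_gauss_step, ← ih]
    simp only [pochFin, prod_range_succ]; ring
  | zero =>
    induction b with
    | zero => simp [pochFin, gauss, thetaTerm, tri]
    | succ b ih =>
      -- the symmetry `u ↔ v` turns a factor in `v` into a factor in `u`
      have hswap : ∀ c : ℕ, ∑ x ∈ antidiagonal (0 + c),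
            gauss (u * v) x.1 x.2 * thetaTerm u v ((x.2 : ℤ) - c) =
          ∑ x ∈ antidiagonal (c + 0),
            gauss (v * u) x.1 x.2 * thetaTerm v u ((x.2 : ℤ) - (0 : ℕ)) := by
        intro c
        rw [zero_add, add_zero, ← Nat.sum_antidiagonal_swap]
        refine sum_congr rfl fun x hx => ?_
        rw [HasAntidiagonal.mem_antidiagonal] at hx
        rw [Prod.fst_swap, Prod.snd_swap, gauss_symm h, mul_comm v u, ← thetaTerm_swap]
        congr 2
        push_cast [← hx]; ring
      rw [hswap, ← sum_gauss_step, ← hswap, ← ih, mul_comm v u]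
      simp only [pochFin, prod_range_succ]; ring

/-- The Gaussian binomials in the finite triple product tend to `1 / (p; p)_∞`, fast enough near
the middle. -/
theorem pow_dvd_gauss_mul_sub {p : S⟦X⟧} (hp : X ∣ p) {i j n : ℕ} (hij : i + j = 2 * n)
    (hin : i ≤ n) : p ^ (i + 1) ∣ gauss p i j * pochFin p p n - 1 := by
  have hd : ∀ {k l : ℕ}, i ≤ k → k ≤ l → p ^ (i + 1) ∣ pochFin p p l - pochFin p p k :=
    fun {k l} h1 h2 => by
      refine dvd_trans ?_ (mul_pow_dvd_pochFin_sub p p h2)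
      rw [← pow_succ']
      exact pow_dvd_pow p (by omega)
  have h1 := gauss_mul p i j
  have h2 : (gauss p i j * pochFin p p n - 1) * (pochFin p p i * pochFin p p j) =
      pochFin p p (2 * n) * (pochFin p p n - pochFin p p i) +
        pochFin p p i * (pochFin p p (2 * n) - pochFin p p j) := by
    rw [← hij, ← h1]; ring
  rw [← ((isUnit_pochFin hp i).mul (isUnit_pochFin hp j)).dvd_mul_right, h2]
  exact dvd_add ((hd le_rfl hin).mul_left _) ((hd (by omega) (by omega)).mul_left _)

/-- **Jacobi triple product**, as a formal limit. -/
theorem isLim_thetaFin {u v : S⟦X⟧} (h : X ∣ u * v) : IsLim (thetaFin u v) (theta u v) := by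
  intro n
  have hlim := (((isLim_pochFin u h).mul (isLim_pochFin v h)).mul
    (isLim_pochFin (u * v) h)) n
  suffices hs : X ^ n ∣ thetaFin u v n -
      pochFin u (u * v) n * pochFin v (u * v) n * pochFin (u * v) (u * v) n by
    simpa [theta] using dvd_add hs hlim
  rw [pochFin_mul_pochFin h, Nat.sum_antidiagonal_eq_sum_range_succ_mk, sum_mul, thetaFin,
    ← sum_range_reflect, ← two_mul, ← sum_sub_distrib]
  refine dvd_sum fun i hi => ?_
  have hi' : i ≤ 2 * n := Nat.lt_succ_iff.1 (mem_range.1 hi)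
  have e : (2 * n + 1 - 1 - i) = 2 * n - i := by omega
  simp only [e]
  set p := u * v with hp
  set j := 2 * n - i with hj
  have e2 : thetaTerm u v ((j : ℤ) - n) - gauss p i j * thetaTerm u v ((j : ℤ) - n) *
      pochFin p p n = -((gauss p i j * pochFin p p n - 1) * thetaTerm u v ((j : ℤ) - n)) := by
    ring
  rw [e2, dvd_neg]
  have h1 : p ^ (min i j + 1) ∣ gauss p i j * pochFin p p n - 1 := by
    rcases le_total i n with hin | hin
    · rw [min_eq_left (by omega)]
      exact pow_dvd_gauss_mul_sub h (by omega) hin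
    · rw [min_eq_right (by omega), gauss_symm h]
      exact pow_dvd_gauss_mul_sub h (by omega) (by omega)
  have h2 : p ^ (min (tri ((j : ℤ) - n)) (tri (-((j : ℤ) - n)))) ∣
      thetaTerm u v ((j : ℤ) - n) := by
    rw [thetaTerm, mul_assoc, hp, mul_pow]
    exact (mul_dvd_mul (pow_dvd_pow u (min_le_left _ _))
      (pow_dvd_pow v (min_le_right _ _))).mul_left _
  refine dvd_trans ?_ (mul_dvd_mul h1 h2)
  rw [← pow_add]
  refine (pow_dvd_pow X ?_).trans (pow_dvd_pow_of_dvd h _)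
  have t1 := two_mul_tri ((j : ℤ) - n)
  have t2 := two_mul_tri (-((j : ℤ) - n))
  -- with `k = |j - n|` this is `n ≤ (n - k) + 1 + k (k - 1) / 2`
  obtain ⟨k, hk⟩ : ∃ k : ℤ, k = (j : ℤ) - n := ⟨_, rfl⟩
  rw [← hk] at t1 t2 ⊢
  have h3 : (j : ℤ) = n + k := by omega
  have h4 : (i : ℤ) = n - k := by omega
  zify
  rcases le_total 0 k with h0 | h0
  · rw [min_eq_left (by omega), min_eq_right (by nlinarith)]
    rcases lt_or_ge k 2 with h5 | h5 <;> nlinarith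
  · rw [min_eq_right (by omega), min_eq_left (by nlinarith)]
    rcases lt_or_ge (-2) k with h5 | h5 <;> nlinarith

theorem thetaTerm_seven (u v : S⟦X⟧) (k : ℤ) {s : ℕ} (hs : s < 7) :
    thetaTerm u v (7 * k + (s - 3)) = thetaTerm u v ((s : ℤ) - 3) *
      thetaTerm (u ^ (7 * s + 7) * v ^ (7 * s)) (u ^ (42 - 7 * s) * v ^ (49 - 7 * s)) k := by
  have h1 : tri (7 * k + (s - 3)) =
      tri ((s : ℤ) - 3) + (7 * s + 7) * tri k + (42 - 7 * s) * tri (-k) := by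
    zify [show 7 * s ≤ 42 by omega]
    refine mul_left_cancel₀ (two_ne_zero (α := ℤ)) ?_
    linear_combination two_mul_tri (7 * k + (s - 3)) - two_mul_tri ((s : ℤ) - 3) -
      (7 * s + 7) * two_mul_tri k - (42 - 7 * s) * two_mul_tri (-k)
  have h2 : tri (-(7 * k + (s - 3))) =
      tri (-((s : ℤ) - 3)) + (7 * s) * tri k + (49 - 7 * s) * tri (-k) := by
    zify [show 7 * s ≤ 49 by omega]
    refine mul_left_cancel₀ (two_ne_zero (α := ℤ)) ?_
    linear_combination two_mul_tri (-(7 * k + (s - 3))) - two_mul_tri (-((s : ℤ) - 3)) -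
      7 * s * two_mul_tri k - (49 - 7 * s) * two_mul_tri (-k)
  have h3 : (7 * k + ((s : ℤ) - 3)).negOnePow = ((s : ℤ) - 3).negOnePow * k.negOnePow := by
    rw [add_comm, Int.negOnePow_add]
    congr 1
    rw [Int.negOnePow_eq_iff]
    exact ⟨3 * k, by ring⟩
  simp only [thetaTerm, h1, h2, h3, Units.val_mul, Int.cast_mul]
  ring

/-- The `7`-section of a theta series. -/
theorem theta_seven {u v : S⟦X⟧} (h : X ∣ u * v) :
    theta u v = ∑ s ∈ range 7, thetaTerm u v ((s : ℤ) - 3) *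
      theta (u ^ (7 * s + 7) * v ^ (7 * s)) (u ^ (42 - 7 * s) * v ^ (49 - 7 * s)) := by
  refine ((isLim_thetaFin h).comp (f := fun n => 7 * n + 3) (fun n => by omega)).unique
    fun n => ?_
  have hsum : thetaFin u v (7 * n + 3) = ∑ s ∈ range 7, thetaTerm u v ((s : ℤ) - 3) *
      thetaFin (u ^ (7 * s + 7) * v ^ (7 * s)) (u ^ (42 - 7 * s) * v ^ (49 - 7 * s)) n := by
    have hr : ∀ (f : ℕ → S⟦X⟧) (M : ℕ),
        ∑ i ∈ range (7 * M), f i = ∑ i ∈ range M, ∑ s ∈ range 7, f (7 * i + s) := by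
      intro f M
      induction M with
      | zero => simp
      | succ M ih => rw [Nat.mul_succ, sum_range_add, ih, sum_range_succ _ M]
    rw [thetaFin, show 2 * (7 * n + 3) + 1 = 7 * (2 * n + 1) by ring, hr, sum_comm]
    refine sum_congr rfl fun s hs => ?_
    rw [thetaFin, mul_sum]
    refine sum_congr rfl fun i _ => ?_
    rw [← thetaTerm_seven u v _ (mem_range.1 hs)]
    congr 1
    push_cast; ring
  simp only [hsum, ← sum_sub_distrib, ← mul_sub]
  refine dvd_sum fun s hs => (isLim_thetaFin ?_ n).mul_left _
  have hs' := mem_range.1 hs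
  refine h.trans ⟨u ^ 48 * v ^ 48, ?_⟩
  calc _ = u ^ (7 * s + 7 + (42 - 7 * s)) * v ^ (7 * s + (49 - 7 * s)) := by ring
    _ = u ^ 49 * v ^ 49 := by congr 2 <;> omega
    _ = _ := by ring

end TripleProduct

/-! ### Arrays of coefficients and the shift `z ↦ zq` -/

/-- Power series in `q = X` whose coefficients are Laurent polynomials in a second variable `z`. -/
abbrev BiSeries : Type := (LaurentPolynomial ℂ)⟦X⟧

/-- The power `zᵏ` of the second variable. -/
def zpw (k : ℤ) : BiSeries := PowerSeries.C (LaurentPolynomial.T k)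

theorem zpw_zero : zpw 0 = 1 := by simp [zpw]

theorem zpw_add (k l : ℤ) : zpw (k + l) = zpw k * zpw l := by
  rw [zpw, LaurentPolynomial.T_add, map_mul]; rfl

theorem zpw_pow (k : ℤ) (n : ℕ) : zpw k ^ n = zpw (n * k) := by
  simp [zpw, ← LaurentPolynomial.T_pow]

theorem zpw_mul_neg (k : ℤ) : zpw k * zpw (-k) = 1 := by
  rw [← zpw_add, add_neg_cancel, zpw_zero]

/-- The coefficient of `zᵐ qⁿ`, extended by zero to negative `n`. -/
def bc (F : BiSeries) (m n : ℤ) : ℂ :=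
  if 0 ≤ n then (coeff n.toNat F).coeff m else 0

theorem bc_natCast (F : BiSeries) (m : ℤ) (n : ℕ) : bc F m n = (coeff n F).coeff m := by
  simp [bc]

theorem bc_of_neg (F : BiSeries) (m : ℤ) {n : ℤ} (h : n < 0) : bc F m n = 0 := by
  simp [bc, not_le.2 h]

theorem bc_ext {F G : BiSeries} (h : ∀ m n, bc F m n = bc G m n) : F = G := by
  ext n m
  simpa [bc_natCast] using h m n

theorem bc_add (F G : BiSeries) (m n : ℤ) : bc (F + G) m n = bc F m n + bc G m n := by
  unfold bc; split_ifs <;> simp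

theorem bc_zero (m n : ℤ) : bc 0 m n = 0 := by
  unfold bc; split_ifs <;> simp

theorem bc_neg (F : BiSeries) (m n : ℤ) : bc (-F) m n = -bc F m n := by
  have := bc_add F (-F) m n
  rw [add_neg_cancel, bc_zero] at this
  linear_combination -this

theorem bc_sub (F G : BiSeries) (m n : ℤ) : bc (F - G) m n = bc F m n - bc G m n := by
  rw [sub_eq_add_neg, bc_add, bc_neg, sub_eq_add_neg]

theorem bc_X_mul (F : BiSeries) (m n : ℤ) : bc (X * F) m n = bc F m (n - 1) := by
  rcases lt_trichotomy n 0 with h | rfl | h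
  · rw [bc_of_neg _ _ h, bc_of_neg _ _ (by omega)]
  · simp [bc]
  · obtain ⟨k, rfl⟩ : ∃ k : ℕ, n = k + 1 := ⟨(n - 1).toNat, by omega⟩
    rw [add_sub_cancel_right, bc_natCast, ← Nat.cast_succ, bc_natCast, coeff_succ_X_mul]

theorem bc_X_pow_mul (F : BiSeries) (k : ℕ) (m n : ℤ) :
    bc (X ^ k * F) m n = bc F m (n - k) := by
  induction k generalizing n with
  | zero => simp
  | succ k ih => rw [pow_succ', mul_assoc, bc_X_mul, ih]; congr 1; push_cast; ring

theorem bc_zpw_mul (F : BiSeries) (k m n : ℤ) : bc (zpw k * F) m n = bc F (m - k) n := by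
  unfold bc zpw
  split_ifs
  · rw [coeff_C_mul, LaurentPolynomial.T]
    rw [AddMonoidAlgebra.coeff_single_mul_apply, one_mul, sub_eq_neg_add]
  · rfl

theorem bc_one (m n : ℤ) : bc 1 m n = if m = 0 ∧ n = 0 then 1 else 0 := by
  unfold bc
  rcases lt_trichotomy n 0 with h | rfl | h
  · simp [not_le.2 h, h.ne]
  · simp [← LaurentPolynomial.T_zero, eq_comm]
  · have h1 : n.toNat ≠ 0 := by omega
    simp [h.le, h.ne', coeff_one, h1]

theorem bc_X_pow (k : ℕ) (m n : ℤ) : bc (X ^ k) m n = bc 1 m (n - k) := by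
  rw [← bc_X_pow_mul, mul_one]

theorem bc_zpw (k m n : ℤ) : bc (zpw k) m n = bc 1 (m - k) n := by
  rw [← bc_zpw_mul, mul_one]

theorem bc_eq_zero_of_dvd {F : BiSeries} {k : ℕ} (h : X ^ k ∣ F) (m : ℤ) {n : ℤ} (hn : n < k) :
    bc F m n = 0 := by
  obtain ⟨G, rfl⟩ := h
  rw [bc_X_pow_mul, bc_of_neg _ _ (by omega)]

/-- Each coefficient of a power of `q` is a Laurent polynomial in `z`. -/
theorem exists_bc_bound (F : BiSeries) (n : ℤ) :
    ∃ s : Finset ℤ, ∀ i ≤ n, ∀ m, bc F m i ≠ 0 → m ∈ s := by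
  classical
  refine ⟨(Finset.range (n.toNat + 1)).biUnion fun i => (coeff i F).coeff.support, ?_⟩
  intro i hi m hm
  have h0 : 0 ≤ i := by
    by_contra h
    exact hm (bc_of_neg F m (by omega))
  rw [mem_biUnion]
  refine ⟨i.toNat, by simp; omega, ?_⟩
  rw [Finsupp.mem_support_iff]
  simpa [bc, h0] using hm

theorem exists_bc_eq_zero (F : BiSeries) (n : ℤ) :
    ∃ M : ℕ, ∀ m, (M : ℤ) < |m| → bc F m n = 0 := by
  obtain ⟨s, hs⟩ := exists_bc_bound F n
  refine ⟨∑ a ∈ s, a.natAbs, fun m hm => ?_⟩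
  by_contra h
  have h1 := Finset.single_le_sum (f := fun a : ℤ => a.natAbs) (fun _ _ => Nat.zero_le _)
    (hs n le_rfl m h)
  rw [Int.abs_eq_natAbs] at hm
  omega

theorem bc_mul (F G : BiSeries) (m n : ℤ) :
    bc (F * G) m n = ∑ᶠ x : ℤ × ℤ, bc F x.1 x.2 * bc G (m - x.1) (n - x.2) := by
  classical
  obtain ⟨s, hs⟩ := exists_bc_bound F n
  rw [finsum_eq_sum_of_support_subset (s := s ×ˢ Icc 0 n)]
  · rw [sum_product_right]
    rcases lt_or_ge n 0 with hn | hn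
    · rw [bc_of_neg _ _ hn, Icc_eq_empty (by omega), sum_empty]
    obtain ⟨n, rfl⟩ := Int.eq_ofNat_of_zero_le hn
    rw [bc_natCast, coeff_mul, AddMonoidAlgebra.coeff_sum, Finsupp.finsetSum_apply,
      Nat.sum_antidiagonal_eq_sum_range_succ_mk]
    refine sum_bij' (fun i _ => (i : ℤ)) (fun i _ => i.toNat) ?_ ?_ ?_ ?_ ?_
    · intro i hi; simp at hi ⊢; omega
    · intro i hi; simp at hi ⊢; omega
    · intro i hi; simp
    · intro i hi; simp at hi ⊢; omega
    · intro i hi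
      have hi' : i ≤ n := by simpa [Nat.lt_succ_iff] using hi
      simp only [← Nat.cast_sub hi', bc_natCast]
      rw [AddMonoidAlgebra.coeff_mul, Finsupp.sum_of_support_subset (s := s)]
      · refine sum_congr rfl fun a _ => ?_
        rw [Finsupp.sum, Finset.sum_eq_single (m - a)]
        · simp
        · intro b _ hb
          rw [if_neg (by omega)]
        · intro hb
          rw [Finsupp.notMem_support_iff] at hb
          simp [hb]
      · intro a ha
        exact hs i (by omega) a (by simpa [bc_natCast] using ha)
      · simp
  · rintro ⟨a, i⟩ hx
    simp only [Function.mem_support] at hx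
    have h1 := left_ne_zero_of_mul hx
    have h2 := right_ne_zero_of_mul hx
    have h3 : 0 ≤ i := by
      by_contra h
      exact h1 (bc_of_neg _ _ (by omega))
    have h4 : i ≤ n := by
      by_contra h
      exact h2 (bc_of_neg _ _ (by omega))
    simp only [coe_product, Set.mem_prod, mem_coe, mem_Icc]
    exact ⟨hs i h4 a h1, h3, h4⟩

/-- `IsShift F F'` says that `F'` arises from `F` by the substitution `z ↦ zq`. -/
def IsShift (F F' : BiSeries) : Prop :=
  ∀ m n, bc F' m (n + m) = bc F m n

namespace IsShift

variable {F F' G G' : BiSeries}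

theorem add (hF : IsShift F F') (hG : IsShift G G') : IsShift (F + G) (F' + G') := fun m n => by
  rw [bc_add, bc_add, hF, hG]

theorem neg (hF : IsShift F F') : IsShift (-F) (-F') := fun m n => by
  rw [bc_neg, bc_neg, hF]

theorem sub (hF : IsShift F F') (hG : IsShift G G') : IsShift (F - G) (F' - G') := fun m n => by
  rw [bc_sub, bc_sub, hF, hG]

theorem mul (hF : IsShift F F') (hG : IsShift G G') : IsShift (F * G) (F' * G') := fun m n => by
  rw [bc_mul, bc_mul]
  let e : ℤ × ℤ ≃ ℤ × ℤ :=
    ⟨fun x => (x.1, x.2 + x.1), fun x => (x.1, x.2 - x.1), fun x => by simp, fun x => by simp⟩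
  rw [← finsum_comp_equiv e]
  refine finsum_congr fun x => ?_
  simp only [e, Equiv.coe_fn_mk]
  rw [hF, show n + m - (x.2 + x.1) = (n - x.2) + (m - x.1) by ring, hG]

theorem one : IsShift 1 1 := fun m n => by
  rw [bc_one, bc_one]
  congr 1
  simp only [eq_iff_iff]
  omega

theorem qX : IsShift X X := fun m n => by
  rw [← mul_one (X : BiSeries), bc_X_mul, bc_X_mul, ← one m (n - 1)]
  congr 1; ring

theorem pow (hF : IsShift F F') (k : ℕ) : IsShift (F ^ k) (F' ^ k) := by
  induction k with
  | zero => simpa using one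
  | succ k ih => simpa only [pow_succ] using ih.mul hF

theorem sum {ι : Type*} {s : Finset ι} {f f' : ι → BiSeries}
    (h : ∀ i ∈ s, IsShift (f i) (f' i)) : IsShift (∑ i ∈ s, f i) (∑ i ∈ s, f' i) := by
  classical
  induction s using Finset.induction_on with
  | empty => intro m n; simp [bc_zero]
  | insert a s ha ih =>
    rw [Finset.sum_insert ha, Finset.sum_insert ha]
    exact (h a (mem_insert_self a s)).add (ih fun i hi => h i (mem_insert_of_mem hi))

theorem zpw_nat (k : ℕ) : IsShift (zpw k) (zpw k * X ^ k) := fun m n => by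
  rw [bc_zpw_mul, bc_X_pow, bc_zpw, ← one (m - k) n]
  congr 1; ring

theorem zpw_neg_nat (k : ℕ) : IsShift (zpw (-k) * X ^ k) (zpw (-k)) := fun m n => by
  rw [bc_zpw_mul, bc_X_pow, bc_zpw, ← one (m - -k) (n - k)]
  congr 1; ring

theorem of_isLim {f f' : ℕ → BiSeries} (h : ∀ n, IsShift (f n) (f' n)) (hF : IsLim f F)
    (hF' : IsLim f' F') : IsShift F F' := fun m n => by
  obtain ⟨N, hN⟩ : ∃ N : ℕ, n < N ∧ n + m < N :=
    ⟨(max n (n + m)).toNat + 1, by omega⟩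
  have h1 := bc_eq_zero_of_dvd (hF N) m hN.1
  have h2 := bc_eq_zero_of_dvd (hF' N) m hN.2
  rw [bc_sub, sub_eq_zero] at h1 h2
  rw [← h1, ← h2, h]

/-- A factor `1 - z` can be cancelled: the difference of the two sides is constant in `m`. -/
theorem of_one_sub_z_mul (h : IsShift ((1 - zpw 1) * F) ((1 - zpw 1 * X) * F')) :
    IsShift F F' := fun m n => by
  have hstep : ∀ m, bc F' m (n + m) - bc F m n = bc F' (m - 1) (n + (m - 1)) - bc F (m - 1) n := by
    intro m
    have := h m n
    rw [sub_mul, sub_mul, one_mul, one_mul, bc_sub, bc_sub, mul_assoc, bc_zpw_mul, bc_zpw_mul,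
      bc_X_mul] at this
    rw [show n + (m - 1) = n + m - 1 by ring]
    linear_combination this
  have hall : ∀ k : ℕ, bc F' m (n + m) - bc F m n =
      bc F' (m - k) (n + (m - k)) - bc F (m - k) n := by
    intro k
    induction k with
    | zero => simp
    | succ k ih => rw [ih, hstep]; congr 2 <;> push_cast <;> ring_nf
  obtain ⟨M, hM⟩ := exists_bc_eq_zero F n
  obtain ⟨k, hk⟩ : ∃ k : ℕ, k = M + m.natAbs + n.natAbs + 1 := ⟨_, rfl⟩
  have h1 : bc F' (m - k) (n + (m - k)) = 0 := bc_of_neg F' _ (by omega)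
  have h2 : bc F (m - k) n = 0 := hM _ (by rw [lt_abs]; omega)
  linear_combination hall k + h1 - h2

/-- A factor `1 - z / q` (multiplied by `q`) can be cancelled. -/
theorem of_q_sub_z_mul (h : IsShift ((X - zpw 1) * F) (X * (1 - zpw 1) * F')) :
    IsShift F F' := fun m n => by
  have hstep : ∀ m n, bc F' m (n + m) - bc F m n =
      bc F' (m + 1) ((n - 1) + (m + 1)) - bc F (m + 1) (n - 1) := by
    intro m n
    have := h (m + 1) n
    rw [sub_mul, mul_assoc, sub_mul, one_mul, mul_sub, bc_sub, bc_sub, bc_X_mul, bc_X_mul,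
      bc_X_mul, bc_zpw_mul, bc_zpw_mul, add_sub_cancel_right] at this
    rw [show n - 1 + (m + 1) = n + (m + 1) - 1 by ring]
    rw [show n + (m + 1) - 1 = n + m by ring] at this ⊢
    linear_combination -this
  have hall : ∀ k : ℕ, bc F' m (n + m) - bc F m n =
      bc F' (m + k) ((n - k) + (m + k)) - bc F (m + k) (n - k) := by
    intro k
    induction k with
    | zero => simp
    | succ k ih => rw [ih, hstep]; congr 2 <;> push_cast <;> ring_nf
  obtain ⟨M, hM⟩ := exists_bc_eq_zero F' (n + m)
  obtain ⟨k, hk⟩ : ∃ k : ℕ, k = M + m.natAbs + n.natAbs + 1 := ⟨_, rfl⟩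
  have h1 : bc F' (m + k) ((n - k) + (m + k)) = 0 := by
    rw [show n - k + (m + k) = n + m by ring]
    exact hM _ (by rw [lt_abs]; omega)
  have h2 : bc F (m + k) (n - k) = 0 := bc_of_neg F _ (by omega)
  linear_combination hall k + h1 - h2

end IsShift

/-! ### The rank generating function and its functional equation -/

/-- The rank generating function `R(z, q)`, as a series in `q` over Laurent polynomials in `z`. -/
def rankBi : BiSeries :=
  PowerSeries.mk fun n => ∑ p : n.Partition, LaurentPolynomial.T (rank p)

/-- The generating function of the partitions with all parts at most `N`, where `z⁻¹` marks the
number of parts. -/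
def boundedGen (N : ℕ) : BiSeries :=
  PowerSeries.mk fun n => ∑ p : n.Partition,
    if p.parts.sup ≤ N then LaurentPolynomial.T (-(Multiset.card p.parts : ℤ)) else 0

theorem boundedGen_eq_genFun (N : ℕ) : boundedGen N = Nat.Partition.genFun
    fun i c => if i ≤ N then (LaurentPolynomial.T (-(c : ℤ)) : LaurentPolynomial ℂ) else 0 := by
  ext1 n
  rw [boundedGen, coeff_mk, Nat.Partition.coeff_genFun]
  refine sum_congr rfl fun p _ => ?_
  rw [Finsupp.prod, Multiset.toFinsupp_support]
  split_ifs with h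
  · rw [Multiset.sup_le] at h
    have : ∀ i ∈ p.parts.toFinset, (if i ≤ N then
        (LaurentPolynomial.T (-((p.parts.toFinsupp i : ℕ) : ℤ)) : LaurentPolynomial ℂ) else 0) =
        LaurentPolynomial.T (-1) ^ (p.parts.count i) := by
      intro i hi
      rw [if_pos (h i (Multiset.mem_toFinset.1 hi)), Multiset.toFinsupp_apply,
        LaurentPolynomial.T_pow]
      congr 1; ring
    rw [prod_congr rfl this, prod_pow_eq_pow_sum, Multiset.toFinset_sum_count_eq,
      LaurentPolynomial.T_pow]
    congr 1; ring
  · rw [Multiset.sup_le] at h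
    push Not at h
    obtain ⟨i, hi, hiN⟩ := h
    rw [Finset.prod_eq_zero (Multiset.mem_toFinset.2 hi)]
    rw [if_neg (not_le.2 hiN)]

/-- Allowing parts equal to `N + 1` divides the generating function by `1 - z⁻¹q^{N+1}`. -/
theorem one_sub_mul_boundedGen_succ (N : ℕ) :
    (1 - zpw (-1) * X ^ (N + 1)) * boundedGen (N + 1) = boundedGen N := by
  let _ : TopologicalSpace (LaurentPolynomial ℂ) := ⊥
  have : DiscreteTopology (LaurentPolynomial ℂ) := ⟨rfl⟩
  -- the factor contributed by the parts equal to `i + 1`, all parts being at most `M`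
  let fac : ℕ → ℕ → BiSeries := fun M i => 1 + ∑' j,
    (if i + 1 ≤ M then (LaurentPolynomial.T (-((j + 1 : ℕ) : ℤ)) : LaurentPolynomial ℂ) else 0) •
      (X : BiSeries) ^ ((i + 1) * (j + 1))
  have hprod : ∀ M, boundedGen M = ∏ i ∈ range M, fac M i := by
    intro M
    rw [boundedGen_eq_genFun, Nat.Partition.genFun_eq_tprod]
    refine tprod_eq_prod fun i hi => ?_
    have : ¬ (i + 1 ≤ M) := by simpa using hi
    simp [this]
  have hcongr : ∀ i ∈ range N, fac (N + 1) i = fac N i := by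
    intro i hi
    have h1 : i + 1 ≤ N := by simpa using hi
    have h2 : i + 1 ≤ N + 1 := by omega
    simp only [fac, h1, h2, if_true]
  have hlast : (1 - zpw (-1) * X ^ (N + 1)) * fac (N + 1) N = 1 := by
    have h0 : constantCoeff (zpw (-1) * X ^ (N + 1)) = 0 := by simp
    have hs := PowerSeries.WithPiTopology.summable_pow_of_constantCoeff_eq_zero h0
    have := PowerSeries.WithPiTopology.one_sub_mul_tsum_pow_of_constantCoeff_eq_zero h0
    rw [hs.tsum_eq_zero_add] at this
    refine Eq.trans (congrArg _ ?_) this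
    simp only [fac, le_refl, if_true, pow_zero]
    congr 1
    refine tsum_congr fun j => ?_
    rw [mul_pow, zpw_pow, ← pow_mul, smul_eq_C_mul, zpw]
    congr 3
    push_cast; ring
  rw [hprod, hprod, prod_range_succ, prod_congr rfl hcongr, mul_comm _ (fac (N + 1) N),
    ← mul_assoc, hlast, one_mul]

theorem sup_parts_le {n : ℕ} (p : n.Partition) : p.parts.sup ≤ n :=
  Multiset.sup_le.2 fun _ ha => p.le_of_mem_parts ha

theorem boundedGen_zero : boundedGen 0 = 1 := by
  rw [boundedGen_eq_genFun]
  let _ : TopologicalSpace (LaurentPolynomial ℂ) := ⊥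
  have : DiscreteTopology (LaurentPolynomial ℂ) := ⟨rfl⟩
  rw [Nat.Partition.genFun_eq_tprod]
  simp

theorem boundedGen_succ_sub (N : ℕ) : boundedGen (N + 1) - boundedGen N =
    zpw (-1) * X ^ (N + 1) * boundedGen (N + 1) := by
  rw [← one_sub_mul_boundedGen_succ N]; ring

/-- Sorting the partitions by their largest part. -/
theorem isLim_rankBi : IsLim
    (fun N => 1 + ∑ n ∈ range N, zpw (n + 1 : ℕ) * (boundedGen (n + 1) - boundedGen n)) rankBi := by
  intro N
  rw [X_pow_dvd_iff]
  intro j hj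
  rw [map_sub, sub_eq_zero, ← boundedGen_zero, map_add, map_sum]
  simp only [zpw, coeff_C_mul, map_sub]
  simp only [boundedGen, rankBi, coeff_mk, mul_sub, mul_sum, ← sum_sub_distrib]
  rw [sum_comm, ← sum_add_distrib]
  refine sum_congr rfl fun p _ => ?_
  obtain ⟨s, hs⟩ : ∃ s, s = p.parts.sup := ⟨_, rfl⟩
  have hsj : s ≤ j := hs ▸ sup_parts_le p
  rw [rank, ← hs, sub_eq_add_neg, LaurentPolynomial.T_add]
  rcases s with _ | s
  · simp [-LaurentPolynomial.T_mul]
  · rw [Finset.sum_eq_single s]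
    · simp [-LaurentPolynomial.T_mul]
    · intro n _ hn
      by_cases h : s + 1 ≤ n
      · rw [if_pos (by omega), if_pos h, sub_self]
      · rw [if_neg (by omega), if_neg h, sub_self]
    · intro h
      simp at h; omega

/-- The series `∑ₙ (zq)ⁿ Eₙ` with `Eₙ = boundedGen n`, see `isLim_fineSeries`. -/
def fineSeries : BiSeries := 1 + zpw 1 * (rankBi - 1)

/-- The series `∑ₙ (zq²)ⁿ Eₙ` with `Eₙ = boundedGen n`, see `isLim_fineSeries₂`. -/
def fineSeries₂ : BiSeries := zpw 1 * (1 - zpw 1 * X) * fineSeries - zpw 1 + 1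

theorem isLim_fineSeries :
    IsLim (fun N => ∑ n ∈ range (N + 1), (zpw 1 * X) ^ n * boundedGen n) fineSeries := by
  have h := isLim_rankBi
  intro N
  have e : (∑ n ∈ range (N + 1), (zpw 1 * X) ^ n * boundedGen n) - fineSeries =
      zpw 1 * ((1 + ∑ n ∈ range N, zpw (n + 1 : ℕ) * (boundedGen (n + 1) - boundedGen n)) -
        rankBi) := by
    rw [sum_range_succ', fineSeries, boundedGen_zero]
    have : ∀ n ∈ range N, (zpw 1 * X) ^ (n + 1) * boundedGen (n + 1) =
        zpw 1 * (zpw (n + 1 : ℕ) * (boundedGen (n + 1) - boundedGen n)) := by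
      intro n _
      have h1 := zpw_mul_neg 1
      rw [boundedGen_succ_sub, mul_pow, zpw_pow, mul_one]
      linear_combination (-(zpw (n + 1 : ℕ) * X ^ (n + 1) * boundedGen (n + 1))) * h1
    rw [sum_congr rfl this, ← mul_sum]
    ring
  simp only [e]
  exact (h N).mul_left _

theorem isLim_fineSeries₂ :
    IsLim (fun N => ∑ n ∈ range (N + 1), (zpw 1 * X ^ 2) ^ n * boundedGen n) fineSeries₂ := by
  intro N
  -- summation by parts
  have e : ∀ N, zpw 1 * (1 - zpw 1 * X) * (∑ n ∈ range (N + 1), (zpw 1 * X) ^ n * boundedGen n) -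
        zpw 1 + 1 + zpw 1 * ((zpw 1 * X) ^ (N + 1) * boundedGen N) =
      ∑ n ∈ range (N + 1), (zpw 1 * X ^ 2) ^ n * boundedGen n := by
    intro N
    induction N with
    | zero => simp [boundedGen_zero]; ring
    | succ N ih =>
      rw [sum_range_succ, sum_range_succ _ (N + 1), ← ih]
      have h1 := zpw_mul_neg 1
      have h2 := boundedGen_succ_sub N
      linear_combination (zpw 1 * (zpw 1 * X) ^ (N + 1)) * h2 +
        ((zpw 1 * X) ^ (N + 1) * X ^ (N + 1) * boundedGen (N + 1)) * h1
  simp only [← e, fineSeries₂]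
  have := ((isLim_fineSeries N).mul_left (zpw 1 * (1 - zpw 1 * X)))
  have h3 : X ^ N ∣ zpw 1 * ((zpw 1 * X) ^ (N + 1) * boundedGen N) :=
    ⟨zpw 1 * (zpw 1 ^ (N + 1) * X * boundedGen N), by ring⟩
  convert dvd_add this h3 using 1
  ring

/-- Dividing by `1 - q^{k+1}/z` turns into dividing by `1 - q^k/z`. -/
theorem IsShift.of_one_sub_mul {F F' : BiSeries} {k : ℕ} (hk : k ≠ 0)
    (h : IsShift ((1 - zpw (-1) * X ^ (k + 1)) * F) ((1 - zpw (-1) * X ^ k) * F')) :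
    IsShift F F' := fun m n => by
  have hstep : ∀ m n : ℤ, bc F' m (n + m) - bc F m n =
      bc F' (m + 1) ((n - (k + 1)) + (m + 1)) - bc F (m + 1) (n - (k + 1)) := by
    intro m n
    have := h m n
    rw [sub_mul, sub_mul, one_mul, one_mul, bc_sub, bc_sub, mul_assoc, mul_assoc, bc_zpw_mul,
      bc_zpw_mul, bc_X_pow_mul, bc_X_pow_mul, sub_neg_eq_add] at this
    rw [show n - (k + 1) + (m + 1) = n + m - k by ring]
    push_cast at this
    linear_combination this
  have hall : ∀ j : ℕ, bc F' m (n + m) - bc F m n =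
      bc F' (m + j) ((n - j * (k + 1)) + (m + j)) - bc F (m + j) (n - j * (k + 1)) := by
    intro j
    induction j with
    | zero => simp
    | succ j ih => rw [ih, hstep]; congr 2 <;> push_cast <;> ring_nf
  obtain ⟨j, hj⟩ : ∃ j : ℕ, j = m.natAbs + n.natAbs + 1 := ⟨_, rfl⟩
  have hk1 : (j : ℤ) ≤ j * k := by
    have : (1 : ℤ) ≤ k := by omega
    nlinarith
  have h1 : bc F' (m + j) ((n - j * (k + 1)) + (m + j)) = 0 := bc_of_neg _ _ (by
    rw [mul_add]; omega)
  have h2 : bc F (m + j) (n - j * (k + 1)) = 0 := bc_of_neg _ _ (by rw [mul_add]; omega)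
  linear_combination hall j + h1 - h2

/-- With `Eₙ(z) = ∏_{i ≤ n} (1 - z⁻¹qⁱ)⁻¹`, the substitution `z ↦ zq` turns
`(1 - z⁻¹q) Eₙ₊₁` into `Eₙ`. -/
theorem isShift_boundedGen (N : ℕ) :
    IsShift ((1 - zpw (-1) * X) * boundedGen (N + 1)) (boundedGen N) := by
  induction N with
  | zero =>
    have := one_sub_mul_boundedGen_succ 0
    rw [zero_add, pow_one] at this
    rw [zero_add, this, boundedGen_zero]
    exact IsShift.one
  | succ N ih =>
    refine IsShift.of_one_sub_mul (k := N + 1) (by omega) ?_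
    rw [one_sub_mul_boundedGen_succ N]
    convert ih using 1
    rw [← one_sub_mul_boundedGen_succ (N + 1)]; ring

theorem isShift_z : IsShift (zpw 1) (zpw 1 * X) := by
  simpa using IsShift.zpw_nat 1

theorem isShift_inv_z : IsShift (zpw (-1) * X) (zpw (-1)) := by
  simpa using IsShift.zpw_neg_nat 1

/-- Shifting `∑ₙ (zq)ⁿ Eₙ` gives essentially `∑ₙ (zq²)ⁿ Eₙ`. -/
theorem isShift_fineSeries : IsShift ((1 - zpw (-1) * X) * fineSeries)
    (1 - zpw (-1) + zpw 1 * X ^ 2 * fineSeries₂) := by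
  refine IsShift.of_isLim (f := fun N => (1 - zpw (-1) * X) *
      ∑ n ∈ range (N + 1 + 1), (zpw 1 * X) ^ n * boundedGen n)
    (f' := fun N => (1 - zpw (-1)) + zpw 1 * X ^ 2 *
      ∑ n ∈ range (N + 1), (zpw 1 * X ^ 2) ^ n * boundedGen n) (fun N => ?_)
    ((isLim_const _).mul (isLim_fineSeries.comp Nat.le_succ)) (fun N => ?_)
  · rw [sum_range_succ', boundedGen_zero]
    simp only [mul_add, mul_sum, pow_zero, mul_one]
    rw [add_comm]
    refine (IsShift.one.sub isShift_inv_z).add (IsShift.sum fun n _ => ?_)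
    have h1 : (1 - zpw (-1) * X) * ((zpw 1 * X) ^ (n + 1) * boundedGen (n + 1)) =
        (zpw 1 * X) ^ (n + 1) * ((1 - zpw (-1) * X) * boundedGen (n + 1)) := by ring
    have h2 : zpw 1 * X ^ 2 * ((zpw 1 * X ^ 2) ^ n * boundedGen n) =
        (zpw 1 * X * X) ^ (n + 1) * boundedGen n := by ring
    rw [h1, h2]
    exact ((isShift_z.mul IsShift.qX).pow _).mul (isShift_boundedGen n)
  · have := (isLim_fineSeries₂ N).mul_left (zpw 1 * X ^ 2)
    convert this using 1
    ring

/-- The functional equation of the rank generating function: with `G(z) = R(z, q) / (1 - z)` it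
reads `G(zq) = 1 - q z² - q z³ G(z)`. -/
theorem isShift_rankBi : IsShift ((X - zpw 1) * rankBi)
    (X * (1 - zpw 1 * X) * ((1 - zpw 1) * (1 - X * zpw 1 ^ 2) - X * zpw 1 ^ 3 * rankBi)) := by
  have h1 := zpw_mul_neg 1
  have e1 : (X - zpw 1) * rankBi =
      -zpw 1 + 1 + X - zpw (-1) * X - (1 - zpw (-1) * X) * fineSeries := by
    rw [fineSeries]
    linear_combination (X - X * rankBi) * h1
  have e2 : X * (1 - zpw 1 * X) * ((1 - zpw 1) * (1 - X * zpw 1 ^ 2) - X * zpw 1 ^ 3 * rankBi) =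
      -(zpw 1 * X) + 1 + X - zpw (-1) - (1 - zpw (-1) + zpw 1 * X ^ 2 * fineSeries₂) := by
    rw [fineSeries₂, fineSeries]
    ring
  rw [e1, e2]
  exact (((isShift_z.neg.add IsShift.one).add IsShift.qX).sub isShift_inv_z).sub
    isShift_fineSeries

/-! ### Specialising `z` -/

/-- The specialisation of `z` to a nonzero complex number. -/
def evalZ (w : ℂˣ) : BiSeries →+* ℂ⟦X⟧ :=
  PowerSeries.map (LaurentPolynomial.eval₂ (RingHom.id ℂ) w)

theorem evalZ_X (w : ℂˣ) : evalZ w X = X := by simp [evalZ]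

theorem evalZ_zpw (w : ℂˣ) (k : ℤ) : evalZ w (zpw k) = PowerSeries.C (((w ^ k : ℂˣ)) : ℂ) := by
  simp [evalZ, zpw]

theorem evalZ_poch (w : ℂˣ) (a p : BiSeries) :
    evalZ w (poch a p) = poch (evalZ w a) (evalZ w p) :=
  map_poch _ a p

theorem evalZ_theta (w : ℂˣ) (u v : BiSeries) :
    evalZ w (theta u v) = theta (evalZ w u) (evalZ w v) :=
  map_theta _ u v

theorem eval₂_eq_finsum (w : ℂˣ) (f : LaurentPolynomial ℂ) :
    LaurentPolynomial.eval₂ (RingHom.id ℂ) w f = ∑ᶠ m : ℤ, f.coeff m * ((w ^ m : ℂˣ) : ℂ) := by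
  have hfin : ∀ g : LaurentPolynomial ℂ,
      (Function.support fun m : ℤ => g.coeff m * ((w ^ m : ℂˣ) : ℂ)).Finite := fun g =>
    g.coeff.support.finite_toSet.subset fun m hm => by
      simpa using left_ne_zero_of_mul (Function.mem_support.1 hm)
  induction f using LaurentPolynomial.induction_on' with
  | add p q hp hq =>
    rw [map_add, hp, hq, ← finsum_add_distrib (hfin p) (hfin q)]
    refine finsum_congr fun m => ?_
    rw [AddMonoidAlgebra.coeff_add, Finsupp.add_apply, add_mul]
  | C_mul_T n a =>
    rw [LaurentPolynomial.eval₂_C_mul_T, finsum_eq_single _ n]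
    · simp [← LaurentPolynomial.single_eq_C_mul_T]
    · intro m hm
      simp [← LaurentPolynomial.single_eq_C_mul_T, hm.symm]

theorem coeff_evalZ (w : ℂˣ) (F : BiSeries) (n : ℕ) :
    coeff n (evalZ w F) = ∑ᶠ m : ℤ, bc F m n * ((w ^ m : ℂˣ) : ℂ) := by
  rw [evalZ, coeff_map, eval₂_eq_finsum]
  simp only [bc_natCast]

theorem evalZ_rankBi (w : ℂˣ) : evalZ w rankBi = rankSeries w := by
  ext n
  simp only [evalZ, rankBi, rankSeries, coeff_map, coeff_mk, map_sum, LaurentPolynomial.eval₂_T]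
  have hmaps : ∀ p ∈ (univ : Finset n.Partition), rank p ∈ Icc (-(n : ℤ)) n := fun p _ =>
    mem_Icc.2 (abs_le.1 (abs_rank_le p))
  rw [← sum_fiberwise_of_maps_to hmaps]
  refine sum_congr rfl fun m _ => ?_
  rw [rankCount, ← nsmul_eq_mul, ← sum_const]
  refine sum_congr rfl fun p hp => ?_
  rw [(mem_filter.1 hp).2]
  simp

theorem evalZ_boundedGen_mul (N : ℕ) :
    evalZ 1 (boundedGen N) * pochFin X X N = 1 := by
  induction N with
  | zero => simp [boundedGen_zero, pochFin]
  | succ N ih =>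
    have := congrArg (evalZ 1) (one_sub_mul_boundedGen_succ N)
    simp only [map_mul, map_sub, map_one, map_pow, evalZ_X, evalZ_zpw, one_zpow, Units.val_one,
      one_mul] at this
    rw [← ih, ← this, pochFin, prod_range_succ, ← pochFin]
    ring

/-- At `z = 1` the rank generating function is the partition generating function. -/
theorem evalZ_one_rankBi_mul : evalZ 1 rankBi * poch X X = 1 := by
  have h1 : IsLim (fun N => evalZ 1 (boundedGen N)) (evalZ 1 rankBi) := by
    intro N
    rw [X_pow_dvd_iff]
    intro j hj
    rw [map_sub, sub_eq_zero]
    simp only [evalZ, rankBi, boundedGen, coeff_map, coeff_mk, map_sum]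
    refine sum_congr rfl fun p _ => ?_
    rw [if_pos ((sup_parts_le p).trans hj.le)]
    simp
  exact ((h1.mul (isLim_pochFin X dvd_rfl)).congr evalZ_boundedGen_mul).unique (isLim_const 1)

/-! ### Theta multiples of the rank generating function -/

/-- The theta product with its factor `1 - zᵃ` removed,
`(zᵃ qᵉ; qᵉ)_∞ (z⁻ᵃ qᵉ; qᵉ)_∞ (qᵉ; qᵉ)_∞`. -/
def thetaQuot (a : ℤ) (e : ℕ) : BiSeries :=
  poch (zpw a * X ^ e) (X ^ e) * poch (zpw (-a) * X ^ e) (X ^ e) * poch (X ^ e) (X ^ e)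

/-- The theta function `∑ₖ (-1)ᵏ z^{ak} q^{e k(k-1)/2}`. -/
def thetaBi (a : ℤ) (e : ℕ) : BiSeries :=
  theta (zpw a) (zpw (-a) * X ^ e)

theorem zpw_mul_zpw_neg_mul (a : ℤ) (e : ℕ) : zpw a * (zpw (-a) * X ^ e) = X ^ e := by
  rw [← mul_assoc, zpw_mul_neg, one_mul]

theorem one_sub_mul_thetaQuot (a : ℤ) {e : ℕ} (he : e ≠ 0) :
    (1 - zpw a) * thetaQuot a e = thetaBi a e := by
  rw [thetaBi, theta, zpw_mul_zpw_neg_mul, thetaQuot, poch_eq_mul (zpw a) (dvd_pow_self X he)]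
  ring

theorem thetaTerm_zpw (a : ℤ) (e : ℕ) (k : ℤ) : thetaTerm (zpw a) (zpw (-a) * X ^ e) k =
    ((k.negOnePow : ℤ) : BiSeries) * (zpw (a * k) * X ^ (e * tri (-k))) := by
  have h : a * k = tri k * a + tri (-k) * -a := by
    refine mul_left_cancel₀ (two_ne_zero (α := ℤ)) ?_
    linear_combination (-a) * two_mul_tri k + a * two_mul_tri (-k)
  rw [thetaTerm, mul_pow, zpw_pow, zpw_pow, h, zpw_add, ← pow_mul]
  ring

theorem bc_intCast_mul (c : ℤ) (F : BiSeries) (m n : ℤ) :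
    bc ((c : BiSeries) * F) m n = c * bc F m n := by
  induction c using Int.induction_on with
  | zero => simp [bc_zero]
  | succ i ih => push_cast at ih ⊢; rw [add_mul, bc_add, ih, one_mul]; ring
  | pred i ih => push_cast at ih ⊢; rw [sub_mul, bc_sub, ih, one_mul]; ring

theorem bc_sum {ι : Type*} (s : Finset ι) (f : ι → BiSeries) (m n : ℤ) :
    bc (∑ i ∈ s, f i) m n = ∑ i ∈ s, bc (f i) m n := by
  classical
  induction s using Finset.induction_on with
  | empty => simp [bc_zero]
  | insert a s ha ih => rw [sum_insert ha, sum_insert ha, bc_add, ih]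

theorem bc_thetaTerm_zpw (a : ℤ) (e : ℕ) (k m n : ℤ) :
    bc (thetaTerm (zpw a) (zpw (-a) * X ^ e) k) m n =
      if m = a * k ∧ 2 * n = e * (k * (k - 1)) then ((k.negOnePow : ℤ) : ℂ) else 0 := by
  have h2 : 2 * ((e * tri (-k) : ℕ) : ℤ) = e * (k * (k - 1)) := by
    push_cast; linear_combination (e : ℤ) * two_mul_tri (-k)
  rw [thetaTerm_zpw, bc_intCast_mul, bc_zpw_mul, bc_X_pow, bc_one, mul_ite, mul_one, mul_zero]
  refine if_congr ?_ rfl rfl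
  rw [← h2]
  omega

theorem bc_thetaBi_eq (a : ℤ) {e : ℕ} (he : e ≠ 0) (m n : ℤ) {N : ℕ} (hN : n < N) :
    bc (thetaBi a e) m n = ∑ j ∈ range (2 * N + 1),
      if m = a * ((j : ℤ) - N) ∧ 2 * n = e * (((j : ℤ) - N) * ((j : ℤ) - N - 1)) then
        ((((j : ℤ) - N).negOnePow : ℤ) : ℂ) else 0 := by
  have hX : X ∣ zpw a * (zpw (-a) * X ^ e) := by
    rw [zpw_mul_zpw_neg_mul]; exact dvd_pow_self X he
  have h := bc_eq_zero_of_dvd (isLim_thetaFin hX N) m hN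
  rw [bc_sub, sub_eq_zero] at h
  rw [thetaBi, ← h, thetaFin, bc_sum]
  exact sum_congr rfl fun j _ => bc_thetaTerm_zpw a e _ m n

theorem bc_thetaBi_mul {a : ℤ} (ha : a ≠ 0) {e : ℕ} (he : e ≠ 0) (k n : ℤ) :
    bc (thetaBi a e) (a * k) n =
      if 2 * n = e * (k * (k - 1)) then ((k.negOnePow : ℤ) : ℂ) else 0 := by
  obtain ⟨N, hN⟩ : ∃ N : ℕ, N = n.natAbs + k.natAbs + 1 := ⟨_, rfl⟩
  rw [bc_thetaBi_eq a he (a * k) n (N := N) (by omega), Finset.sum_eq_single (k + N).toNat]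
  · have : (((k + N).toNat : ℕ) : ℤ) - N = k := by omega
    simp only [this, true_and]
  · intro j _ hj
    rw [if_neg]
    rintro ⟨h1, _⟩
    have := mul_left_cancel₀ ha h1
    omega
  · intro h
    simp at h; omega

theorem bc_thetaBi_of_not_dvd {a : ℤ} {e : ℕ} (he : e ≠ 0) {m : ℤ} (hm : ¬ a ∣ m) (n : ℤ) :
    bc (thetaBi a e) m n = 0 := by
  rw [bc_thetaBi_eq a he m n (N := n.natAbs + 1) (by omega)]
  refine sum_eq_zero fun j _ => if_neg ?_
  rintro ⟨h, _⟩
  exact hm ⟨_, h⟩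

/-- `ϑ(zᵉq^e; qᵉ) = -z^{-e} ϑ(zᵉ; qᵉ)`. -/
theorem isShift_thetaBi_self {e : ℕ} (he : e ≠ 0) :
    IsShift (1 * thetaBi e e) (-zpw (-e) * thetaBi e e) := fun m n => by
  rw [one_mul, neg_mul, bc_neg, bc_zpw_mul, sub_neg_eq_add]
  have he' : (e : ℤ) ≠ 0 := by exact_mod_cast he
  by_cases hm : (e : ℤ) ∣ m
  · obtain ⟨k, rfl⟩ := hm
    rw [show (e : ℤ) * k + e = e * (k + 1) by ring, bc_thetaBi_mul he' he, bc_thetaBi_mul he' he,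
      Int.negOnePow_succ]
    have : 2 * (n + e * k) = e * ((k + 1) * (k + 1 - 1)) ↔ 2 * n = e * (k * (k - 1)) := by
      constructor <;> intro h <;> linear_combination h
    simp only [this]
    split_ifs <;> simp
  · rw [bc_thetaBi_of_not_dvd he hm, bc_thetaBi_of_not_dvd he, neg_zero]
    simpa using hm

/-- `ϑ(z²q²; q) = z⁻⁴ q⁻¹ ϑ(z²; q)`. -/
theorem isShift_thetaBi_two_one :
    IsShift (X * thetaBi 2 1) (zpw (-4) * thetaBi 2 1) := fun m n => by
  rw [bc_X_mul, bc_zpw_mul, sub_neg_eq_add]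
  by_cases hm : (2 : ℤ) ∣ m
  · obtain ⟨k, rfl⟩ := hm
    rw [show (2 : ℤ) * k + 4 = 2 * (k + 2) by ring, bc_thetaBi_mul two_ne_zero one_ne_zero,
      bc_thetaBi_mul two_ne_zero one_ne_zero]
    have : 2 * (n + 2 * k) = (1 : ℕ) * ((k + 2) * (k + 2 - 1)) ↔
        2 * (n - 1) = (1 : ℕ) * (k * (k - 1)) := by
      constructor <;> intro h <;> push_cast at h ⊢ <;> linear_combination h
    have h2 : (k + 2).negOnePow = k.negOnePow := by
      rw [Int.negOnePow_eq_iff]; exact ⟨1, by ring⟩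
    simp only [this, h2]
  · rw [bc_thetaBi_of_not_dvd one_ne_zero hm, bc_thetaBi_of_not_dvd one_ne_zero]
    omega

/-- The functional equation of a theta multiple of the rank generating function. The poles of
`R(z, q) / (1 - z)` are cancelled by the zeros of the theta function. -/
theorem isShift_mul_rankBi {Q θ P M : BiSeries} (hQ : (1 - zpw 1) * Q = θ)
    (hθ : IsShift (P * θ) (M * θ)) :
    IsShift (P * (Q * rankBi))
      (M * ((1 - X * zpw 1 ^ 2) * θ - X * zpw 1 ^ 3 * (Q * rankBi))) := by
  refine IsShift.of_one_sub_z_mul (IsShift.of_q_sub_z_mul ?_)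
  have h := hθ.mul isShift_rankBi
  have e1 : (X - zpw 1) * ((1 - zpw 1) * (P * (Q * rankBi))) =
      P * θ * ((X - zpw 1) * rankBi) := by rw [← hQ]; ring
  rw [e1]
  convert h using 1
  rw [← hQ]; ring

/-- `(zq)_∞ (z⁻¹q)_∞ (q)_∞ R(z, q)`. -/
def rankH : BiSeries := thetaQuot 1 1 * rankBi

/-- `(1 + z) (z²q)_∞ (z⁻²q)_∞ (q)_∞ R(z, q)`. -/
def rankK : BiSeries := (1 + zpw 1) * thetaQuot 2 1 * rankBi

/-- `(1 + z) (z²q²; q²)_∞ (z⁻²q²; q²)_∞ (q²; q²)_∞ R(z, q)`. -/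
def rankL : BiSeries := (1 + zpw 1) * thetaQuot 2 2 * rankBi

theorem one_sub_mul_one_add_mul_thetaQuot {e : ℕ} (he : e ≠ 0) :
    (1 - zpw 1) * ((1 + zpw 1) * thetaQuot 2 e) = thetaBi 2 e := by
  rw [← one_sub_mul_thetaQuot 2 he, show (2 : ℤ) = 1 + 1 by norm_num, zpw_add]
  ring

/-- Moving along `(m - 2, n + m - 1) ↦ (m, n)`, the coefficients of `rankH` are constant up to
jumps at the exponents of a theta series. -/
theorem bc_rankH (m n : ℤ) : bc rankH m n = bc rankH (m - 2) (n + m - 1) +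
    ((m.negOnePow : ℤ) : ℂ) * ((if 2 * n = m * (m - 1) then 1 else 0) -
      (if 2 * n = (m - 1) * (m - 4) then 1 else 0)) := by
  have hθ : IsShift (1 * thetaBi 1 1) (-zpw (-1) * thetaBi 1 1) :=
    isShift_thetaBi_self one_ne_zero
  have h := isShift_mul_rankBi (one_sub_mul_thetaQuot 1 one_ne_zero) hθ m n
  rw [one_mul, ← rankH] at h
  have e1 : -zpw (-1) * ((1 - X * zpw 1 ^ 2) * thetaBi 1 1 - X * zpw 1 ^ 3 * rankH) =
      -(zpw (-1) * thetaBi 1 1) + zpw 1 * (X * thetaBi 1 1) + zpw 2 * (X * rankH) := by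
    have h1 := zpw_mul_neg 1
    rw [show (2 : ℤ) = 1 + 1 by norm_num, zpw_add]
    linear_combination (X * zpw 1 * thetaBi 1 1 + X * zpw 1 ^ 2 * rankH) * h1
  have e2 : ∀ m n : ℤ, bc (thetaBi 1 1) m n =
      if 2 * n = m * (m - 1) then ((m.negOnePow : ℤ) : ℂ) else 0 := fun m n => by
    simpa using bc_thetaBi_mul (one_ne_zero (α := ℤ)) one_ne_zero m n
  have i1 : 2 * (n + m) = (m - -1) * (m - -1 - 1) ↔ 2 * n = m * (m - 1) := by
    constructor <;> intro h <;> linear_combination h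
  have i2 : 2 * (n + m - 1) = (m - 1) * (m - 1 - 1) ↔ 2 * n = (m - 1) * (m - 4) := by
    constructor <;> intro h <;> linear_combination h
  rw [← h, e1, bc_add, bc_add, bc_neg, bc_zpw_mul, bc_zpw_mul, bc_zpw_mul, bc_X_mul, bc_X_mul,
    e2, e2]
  simp only [i1, i2]
  simp only [sub_neg_eq_add, Int.negOnePow_succ, Int.negOnePow_sub, Int.negOnePow_one]
  split_ifs <;> (push_cast; ring)

theorem isShift_rankK : IsShift (X * rankK) (zpw (-4) * thetaBi 2 1 -
    zpw (-2) * (X * thetaBi 2 1) - zpw (-1) * (X * rankK)) := by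
  have h := isShift_mul_rankBi (one_sub_mul_one_add_mul_thetaQuot one_ne_zero)
    isShift_thetaBi_two_one
  rw [← rankK] at h
  convert h using 1
  have h2 : zpw (-4) * zpw 1 ^ 2 = zpw (-2) := by rw [zpw_pow, ← zpw_add]; rfl
  have h3 : zpw (-4) * zpw 1 ^ 3 = zpw (-1) := by rw [zpw_pow, ← zpw_add]; rfl
  linear_combination (X * thetaBi 2 1) * h2 + (X * rankK) * h3

theorem bc_rankK_aux (m n : ℤ) : bc rankK (m + 1) (n + m) = -bc rankK m n +
    (bc (thetaBi 2 1) (m + 4) (n + m + 1) - bc (thetaBi 2 1) (m + 2) (n + m)) := by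
  have h := isShift_rankK m (n + 1)
  rw [bc_X_mul, bc_sub, bc_sub, bc_zpw_mul, bc_zpw_mul, bc_zpw_mul, bc_X_mul,
    bc_X_mul, add_sub_cancel_right, show n + 1 + m - 1 = n + m by ring,
    show n + 1 + m = n + m + 1 by ring] at h
  simp only [sub_neg_eq_add] at h
  linear_combination -h

theorem bc_rankK_odd (k n : ℤ) :
    bc rankK (2 * k + 2) (n + 2 * k + 1) = -bc rankK (2 * k + 1) n := by
  have h := bc_rankK_aux (2 * k + 1) n
  rw [bc_thetaBi_of_not_dvd one_ne_zero (by omega), bc_thetaBi_of_not_dvd one_ne_zero (by omega),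
    sub_zero, add_zero] at h
  rw [← h]
  congr 1 <;> ring

theorem bc_rankK_even (k n : ℤ) : bc rankK (2 * k + 1) (n + 2 * k) = -bc rankK (2 * k) n +
    ((k.negOnePow : ℤ) : ℂ) * ((if 2 * n = k * (k - 1) then 1 else 0) +
      (if 2 * n = k * (k - 3) then 1 else 0)) := by
  rw [bc_rankK_aux, show 2 * k + 4 = 2 * (k + 2) by ring, show 2 * k + 2 = 2 * (k + 1) by ring,
    bc_thetaBi_mul two_ne_zero one_ne_zero, bc_thetaBi_mul two_ne_zero one_ne_zero]
  have i1 : 2 * (n + 2 * k + 1) = (1 : ℕ) * ((k + 2) * (k + 2 - 1)) ↔ 2 * n = k * (k - 1) := by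
    push_cast; constructor <;> intro h <;> linear_combination h
  have i2 : 2 * (n + 2 * k) = (1 : ℕ) * ((k + 1) * (k + 1 - 1)) ↔ 2 * n = k * (k - 3) := by
    push_cast; constructor <;> intro h <;> linear_combination h
  have h2 : (k + 2).negOnePow = k.negOnePow := by
    rw [Int.negOnePow_eq_iff]; exact ⟨1, by ring⟩
  simp only [i1, i2, h2, Int.negOnePow_succ]
  split_ifs <;> (push_cast; ring)

theorem bc_rankL_aux (m n : ℤ) : bc rankL m n = bc rankL (m - 1) (n + m - 1) +
    (bc (thetaBi 2 2) m (n + m - 1) - bc (thetaBi 2 2) (m + 2) (n + m)) := by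
  have hθ : IsShift (1 * thetaBi 2 2) (-zpw (-2) * thetaBi 2 2) :=
    isShift_thetaBi_self two_ne_zero
  have h := isShift_mul_rankBi (one_sub_mul_one_add_mul_thetaQuot two_ne_zero) hθ m n
  rw [one_mul, ← rankL] at h
  have e1 : -zpw (-2) * ((1 - X * zpw 1 ^ 2) * thetaBi 2 2 - X * zpw 1 ^ 3 * rankL) =
      -(zpw (-2) * thetaBi 2 2) + X * thetaBi 2 2 + zpw 1 * (X * rankL) := by
    have h2 : zpw (-2) * zpw 1 ^ 2 = 1 := by rw [zpw_pow, ← zpw_add, ← zpw_zero]; rfl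
    linear_combination (X * thetaBi 2 2 + X * zpw 1 * rankL) * h2
  rw [← h, e1, bc_add, bc_add, bc_neg, bc_zpw_mul, bc_zpw_mul, bc_X_mul, bc_X_mul,
    sub_neg_eq_add]
  ring

theorem bc_rankL_odd (k n : ℤ) : bc rankL (2 * k + 1) n = bc rankL (2 * k) (n + 2 * k) := by
  rw [bc_rankL_aux, bc_thetaBi_of_not_dvd two_ne_zero (by omega),
    bc_thetaBi_of_not_dvd two_ne_zero (by omega), sub_zero, add_zero]
  congr 1 <;> ring

theorem bc_rankL_even (k n : ℤ) : bc rankL (2 * k) n = bc rankL (2 * k - 1) (n + 2 * k - 1) +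
    ((k.negOnePow : ℤ) : ℂ) * ((if n = k * (k - 1) then 1 else 0) +
      (if n = k * (k - 3) + 1 then 1 else 0)) := by
  rw [bc_rankL_aux, show 2 * k + 2 = 2 * (k + 1) by ring,
    bc_thetaBi_mul two_ne_zero two_ne_zero, bc_thetaBi_mul two_ne_zero two_ne_zero]
  have i1 : 2 * (n + 2 * k - 1) = (2 : ℕ) * (k * (k - 1)) ↔ n = k * (k - 3) + 1 := by
    push_cast
    constructor <;> intro h
    · refine mul_left_cancel₀ (two_ne_zero (α := ℤ)) ?_; linear_combination h
    · linear_combination 2 * h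
  have i2 : 2 * (n + 2 * k) = (2 : ℕ) * ((k + 1) * (k + 1 - 1)) ↔ n = k * (k - 1) := by
    push_cast
    constructor <;> intro h
    · refine mul_left_cancel₀ (two_ne_zero (α := ℤ)) ?_; linear_combination h
    · linear_combination 2 * h
  simp only [i1, i2, Int.negOnePow_succ]
  split_ifs <;> (push_cast; ring)

/-! ### Propagation along orbits -/

/-- The step `(m, n) ↦ (m - 2, n + m - 1)` preserves `4n + m²`, and `n` becomes negative when it is
iterated backwards; so an array that is constant on an orbit and vanishes for negative `n` vanishes
on the orbit. -/
theorem eq_zero_of_orbit_two {d : ℤ → ℤ → ℂ} {N : ℤ} (h0 : ∀ m n, n < 0 → d m n = 0)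
    (h : ∀ m n, 4 * n + m ^ 2 = N → d m n = d (m - 2) (n + m - 1)) {m n : ℤ}
    (hN : 4 * n + m ^ 2 = N) : d m n = 0 := by
  have hall : ∀ k : ℕ, d m n = d (m + 2 * k) (n - k * m - k ^ 2) := by
    intro k
    induction k with
    | zero => simp
    | succ k ih =>
      rw [ih, h (m + 2 * (k + 1 : ℕ)) _ (by rw [← hN]; push_cast; ring)]
      congr 1 <;> push_cast <;> ring
  obtain ⟨k, hk⟩ : ∃ k : ℕ, k = m.natAbs + n.natAbs + 1 := ⟨_, rfl⟩
  rw [hall k]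
  refine h0 _ _ ?_
  have h1 : (1 : ℤ) ≤ k := by omega
  have h2 : n + 1 ≤ k + m := by omega
  have h3 : 1 ≤ k + m := by omega
  nlinarith [mul_nonneg (sub_nonneg.2 h1) (sub_nonneg.2 h3)]

/-- The analogue for the step `(m, n) ↦ (m - 1, n + m - 1)`, which preserves `2n + m(m - 1)`. -/
theorem eq_zero_of_orbit_one {d : ℤ → ℤ → ℂ} {N : ℤ} (h0 : ∀ m n, n < 0 → d m n = 0)
    (h : ∀ m n, 2 * n + m * (m - 1) = N → d m n = d (m - 1) (n + m - 1)) {m n : ℤ}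
    (hN : 2 * n + m * (m - 1) = N) : d m n = 0 := by
  have hall : ∀ k : ℕ, ∃ n', 2 * n' + (m + k) * (m + k - 1) = N ∧ d m n = d (m + k) n' := by
    intro k
    induction k with
    | zero => exact ⟨n, by simpa using hN, by simp⟩
    | succ k ih =>
      obtain ⟨n', h1, h2⟩ := ih
      have h3 : 2 * (n' - (m + k)) + (m + (k + 1 : ℕ)) * (m + (k + 1 : ℕ) - 1) = N := by
        push_cast; linear_combination h1
      refine ⟨n' - (m + k), h3, ?_⟩
      rw [h2, h _ _ h3]
      congr 1 <;> push_cast <;> ring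
  obtain ⟨k, hk⟩ : ∃ k : ℕ, k = 2 * m.natAbs + N.natAbs + 2 := ⟨_, rfl⟩
  obtain ⟨n', h1, h2⟩ := hall k
  rw [h2]
  refine h0 _ _ ?_
  have h3 : N + 1 ≤ m + k - 1 := by omega
  have h4 : (1 : ℤ) ≤ m + k - 1 := by omega
  nlinarith

/-- The step `(m, n) ↦ (m + 1, n + m)` preserves `2n - m(m - 1)`, and `n` is bounded below on its
orbits. In place of vanishing at infinity, the symmetry `m ↦ 1 - m` says that the entries at `m = 0`
and `m = 1` are equal as well as opposite. -/
theorem eq_zero_of_orbit_symm {d : ℤ → ℤ → ℂ} {N : ℤ} (hs : ∀ m n, d (1 - m) n = d m n)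
    (h : ∀ m n, 2 * n - m * (m - 1) = N → d (m + 1) (n + m) = -d m n) {m n : ℤ}
    (hN : 2 * n - m * (m - 1) = N) : d m n = 0 := by
  induction m using Int.induction_on generalizing n with
  | zero =>
    have h1 := h 0 n hN
    have h2 := hs 0 n
    rw [zero_add, add_zero] at h1
    rw [sub_zero] at h2
    linear_combination (1 / 2 : ℂ) * (h1 - h2)
  | succ m ih =>
    have h1 : 2 * (n - m) - (m : ℤ) * (m - 1) = N := by linear_combination hN
    have h2 := h m (n - m) h1
    rw [sub_add_cancel, ih h1, neg_zero] at h2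
    exact h2
  | pred m ih =>
    have h1 : 2 * (n + (-(m : ℤ) - 1)) - (-(m : ℤ)) * (-(m : ℤ) - 1) = N := by
      linear_combination hN
    have h2 := h _ _ hN
    rw [sub_add_cancel, ih h1] at h2
    linear_combination h2

/-! ### Symmetry of the rank -/

theorem bc_rankH_neg (m n : ℤ) : bc rankH (-m) n = bc rankH m n := by
  rw [← sub_eq_zero]
  refine eq_zero_of_orbit_two (d := fun m n => bc rankH (-m) n - bc rankH m n)
    (N := 4 * n + m ^ 2) (fun m n hn => by simp [bc_of_neg _ _ hn]) (fun m n _ => ?_) rfl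
  have h1 := bc_rankH m n
  have h2 := bc_rankH (-(m - 2)) (n + m - 1)
  rw [show -(m - 2) - 2 = -m by ring, show n + m - 1 + -(m - 2) - 1 = n by ring] at h2
  have i1 : 2 * (n + m - 1) = -(m - 2) * (-(m - 2) - 1) ↔ 2 * n = (m - 1) * (m - 4) := by
    constructor <;> intro h <;> linear_combination h
  have i2 : 2 * (n + m - 1) = (-(m - 2) - 1) * (-(m - 2) - 4) ↔ 2 * n = m * (m - 1) := by
    constructor <;> intro h <;> linear_combination h
  have i3 : (-(m - 2)).negOnePow = m.negOnePow := by
    rw [Int.negOnePow_neg, Int.negOnePow_eq_iff]; exact ⟨-1, by ring⟩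
  simp only [i1, i2, i3] at h2
  rw [h1, h2]
  ring

/-- The substitution `z ↦ z⁻¹`. -/
def invertZ : BiSeries →+* BiSeries :=
  PowerSeries.map (LaurentPolynomial.invert (R := ℂ)).toRingEquiv.toRingHom

theorem bc_invertZ (F : BiSeries) (m n : ℤ) : bc (invertZ F) m n = bc F (-m) n := by
  unfold bc invertZ
  split_ifs
  · rw [coeff_map]
    exact LaurentPolynomial.invert_apply _ m
  · rfl

theorem invertZ_zpw (k : ℤ) : invertZ (zpw k) = zpw (-k) := by
  simp [invertZ, zpw]

theorem invertZ_thetaQuot (a : ℤ) (e : ℕ) : invertZ (thetaQuot a e) = thetaQuot a e := by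
  have hX : invertZ X = X := by simp [invertZ]
  have hp : ∀ a p : BiSeries, invertZ (poch a p) = poch (invertZ a) (invertZ p) :=
    fun a p => map_poch _ a p
  simp only [thetaQuot, map_mul, hp, invertZ_zpw, map_pow, hX, neg_neg]
  ring

theorem isUnit_thetaQuot (a : ℤ) {e : ℕ} (he : e ≠ 0) : IsUnit (thetaQuot a e) := by
  rw [isUnit_iff_constantCoeff, thetaQuot, map_mul, map_mul, constantCoeff_poch,
    constantCoeff_poch, constantCoeff_poch] <;> simp [he]

/-- The symmetry `N(m, n) = N(-m, n)`, read off from the symmetry of `rankH`. -/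
theorem invertZ_rankBi : invertZ rankBi = rankBi := by
  have h : invertZ rankH = rankH := bc_ext fun m n => by rw [bc_invertZ, bc_rankH_neg]
  rw [rankH, map_mul, invertZ_thetaQuot] at h
  exact (isUnit_thetaQuot 1 one_ne_zero).mul_left_cancel h

theorem bc_rankK_symm (m n : ℤ) : bc rankK (1 - m) n = bc rankK m n := by
  have h : invertZ rankK = zpw (-1) * rankK := by
    rw [rankK, map_mul, map_mul, invertZ_rankBi, invertZ_thetaQuot, map_add, map_one, invertZ_zpw]
    linear_combination (-(thetaQuot 2 1 * rankBi)) * zpw_mul_neg 1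
  have := bc_invertZ rankK (m - 1) n
  rw [h, bc_zpw_mul, sub_neg_eq_add, sub_add_cancel, neg_sub] at this
  exact this.symm

/-! ### The sieve modulo `7` -/

/-- `3` is not a square modulo `7`. -/
theorem seven_dvd_of_sq_modEq {x y : ℤ} {c : ℤ} (h : x ^ 2 = 3 * y ^ 2 + 7 * c) : 7 ∣ y := by
  have h1 : (x : ZMod 7) ^ 2 = 3 * (y : ZMod 7) ^ 2 := by
    have := congrArg (Int.cast : ℤ → ZMod 7) h
    push_cast at this
    rw [this, show (7 : ZMod 7) = 0 from rfl, zero_mul, add_zero]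
  have h2 : ∀ a b : ZMod 7, a ^ 2 = 3 * b ^ 2 → b = 0 := by decide
  exact (ZMod.intCast_zmod_eq_zero_iff_dvd y 7).1 (h2 _ _ h1)

theorem seven_dvd_of_sq_eq {x c : ℤ} (h : x ^ 2 = 7 * c) : 7 ∣ c := by
  have h7 : Prime (7 : ℤ) := by norm_num
  obtain ⟨y, rfl⟩ := h7.dvd_of_dvd_pow (Dvd.intro c h.symm)
  exact ⟨y ^ 2, by linarith⟩

/-- A jump of the recurrence on the orbit of `(m, n)` would exhibit `3 (4n + m²) + 1` as a square;
likewise for `rankK` and `rankL` below. -/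
theorem bc_rankH_eq_zero {m n : ℤ} (h : ∀ x : ℤ, x ^ 2 ≠ 3 * (4 * n + m ^ 2) + 1) :
    bc rankH m n = 0 := by
  refine eq_zero_of_orbit_two (d := bc rankH) (N := 4 * n + m ^ 2) (fun m n => bc_of_neg _ _)
    (fun m' n' hN => ?_) rfl
  rw [bc_rankH m' n', if_neg, if_neg]
  · ring
  · intro h1
    exact h (3 * m' - 5) (by linear_combination 3 * hN - 6 * h1)
  · intro h1
    exact h (3 * m' - 1) (by linear_combination 3 * hN - 6 * h1)

theorem bc_rankK_eq_zero {m n : ℤ} (h : ∀ x : ℤ, x ^ 2 ≠ 1 - 12 * (2 * n - m * (m - 1))) :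
    bc rankK m n = 0 := by
  refine eq_zero_of_orbit_symm (d := bc rankK) (N := 2 * n - m * (m - 1)) bc_rankK_symm
    (fun m' n' hN => ?_) rfl
  rcases Int.even_or_odd' m' with ⟨k, rfl | rfl⟩
  · rw [bc_rankK_even, if_neg, if_neg]
    · ring
    · intro h1
      exact h (6 * k + 1) (by linear_combination (-12) * hN + 12 * h1)
    · intro h1
      exact h (6 * k - 1) (by linear_combination (-12) * hN + 12 * h1)
  · rw [← bc_rankK_odd]
    congr 1 <;> ring

theorem bc_rankL_eq_zero {m n : ℤ} (h : ∀ x : ℤ, x ^ 2 ≠ 6 * (2 * n + m * (m - 1)) + 4) :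
    bc rankL m n = 0 := by
  refine eq_zero_of_orbit_one (d := bc rankL) (N := 2 * n + m * (m - 1)) (fun m n => bc_of_neg _ _)
    (fun m' n' hN => ?_) rfl
  rcases Int.even_or_odd' m' with ⟨k, rfl | rfl⟩
  · rw [bc_rankL_even, if_neg, if_neg]
    · ring
    · intro h1
      exact h (6 * k - 4) (by linear_combination 6 * hN - 12 * h1)
    · intro h1
      exact h (6 * k - 2) (by linear_combination 6 * hN - 12 * h1)
  · rw [bc_rankL_odd]
    congr 1 <;> ring

/-- Of the seven places where the recurrence may jump, congruences modulo `7` leave only one. -/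
theorem sum_range_seven_ite {p : ℕ → Prop} [DecidablePred p] {i : ℕ} (hi : i < 7)
    (hp : ∀ j < 7, p j → j = i) (f : ℕ → ℂ) :
    (∑ j ∈ range 7, if p j then f j else 0) = if p i then f i else 0 := by
  refine Finset.sum_eq_single i (fun j hj hji => if_neg fun h => hji (hp j (mem_range.1 hj) h))
    (fun h => absurd (mem_range.2 hi) h)

/-- Seven steps of the recurrence for `rankH` on the sublattice `(7m, 49n + 4)` amount to one step
of the same recurrence. -/
theorem bc_rankH_seven (m n : ℤ) : bc rankH (7 * m) (49 * n + 4) = bc rankH m n := by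
  have hall : ∀ (M L : ℤ) (k : ℕ), bc rankH M L = bc rankH (M - 2 * k) (L + k * M - k ^ 2) +
      ((M.negOnePow : ℤ) : ℂ) * ((∑ j ∈ range k,
          if 2 * (L + j * M - j ^ 2) = (M - 2 * j) * (M - 2 * j - 1) then 1 else 0) -
        ∑ j ∈ range k,
          if 2 * (L + j * M - j ^ 2) = (M - 2 * j - 1) * (M - 2 * j - 4) then 1 else 0) := by
    intro M L k
    induction k with
    | zero => simp
    | succ k ih =>
      have hsign : (M - 2 * k).negOnePow = M.negOnePow := by
        rw [Int.negOnePow_eq_iff]; exact ⟨-k, by ring⟩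
      rw [ih, bc_rankH (M - 2 * k), sum_range_succ, sum_range_succ, hsign,
        show M - 2 * (k + 1 : ℕ) = M - 2 * k - 2 by push_cast; ring,
        show L + (k + 1 : ℕ) * M - (k + 1 : ℕ) ^ 2 = L + k * M - k ^ 2 + (M - 2 * k) - 1 by
          push_cast; ring]
      ring
  rw [← sub_eq_zero]
  refine eq_zero_of_orbit_two (d := fun m n => bc rankH (7 * m) (49 * n + 4) - bc rankH m n)
    (N := 4 * n + m ^ 2) (fun m n hn => ?_) (fun m n _ => ?_) rfl
  · rw [bc_of_neg _ _ hn, bc_of_neg _ _ (by omega), sub_zero]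
  have h1 := hall (7 * m) (49 * n + 4) 7
  rw [sum_range_seven_ite (i := 1) (by norm_num), sum_range_seven_ite (i := 5) (by norm_num)] at h1
  · have i1 : 2 * (49 * n + 4 + (1 : ℕ) * (7 * m) - (1 : ℕ) ^ 2) =
        (7 * m - 2 * (1 : ℕ)) * (7 * m - 2 * (1 : ℕ) - 1) ↔ 2 * n = m * (m - 1) := by
      push_cast
      constructor <;> intro h
      · refine mul_left_cancel₀ (show (49 : ℤ) ≠ 0 by norm_num) ?_; linear_combination h
      · linear_combination 49 * h
    have i2 : 2 * (49 * n + 4 + (5 : ℕ) * (7 * m) - (5 : ℕ) ^ 2) =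
        (7 * m - 2 * (5 : ℕ) - 1) * (7 * m - 2 * (5 : ℕ) - 4) ↔
          2 * n = (m - 1) * (m - 4) := by
      push_cast
      constructor <;> intro h
      · refine mul_left_cancel₀ (show (49 : ℤ) ≠ 0 by norm_num) ?_; linear_combination h
      · linear_combination 49 * h
    have i3 : (7 * m).negOnePow = m.negOnePow := by
      rw [Int.negOnePow_eq_iff]; exact ⟨3 * m, by ring⟩
    simp only [i1, i2, i3] at h1
    rw [h1, bc_rankH m n, show 7 * m - 2 * (7 : ℕ) = 7 * (m - 2) by push_cast; ring,
      show 49 * n + 4 + (7 : ℕ) * (7 * m) - (7 : ℕ) ^ 2 = 49 * (n + m - 1) + 4 by push_cast; ring]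
    ring
  · intro j hj h
    have : 7 * (14 * n + 6 * j * m - 7 * m ^ 2 + 5 * m) = 6 * (j : ℤ) ^ 2 + 10 * j - 4 := by
      linear_combination h
    interval_cases j <;> omega
  · intro j hj h
    have : 7 * (14 * n + 6 * j * m - 7 * m ^ 2 + m) = 6 * (j : ℤ) ^ 2 + 2 * j - 8 := by
      linear_combination h
    interval_cases j <;> omega

/-- The sign `(-1)^{m/2}` for even `m`, and `0` for odd `m`. -/
def halfSign (m : ℤ) : ℂ :=
  if 2 ∣ m then (((m / 2).negOnePow : ℤ) : ℂ) else 0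

theorem halfSign_two_mul (k : ℤ) : halfSign (2 * k) = ((k.negOnePow : ℤ) : ℂ) := by
  simp [halfSign]

theorem halfSign_two_mul_add_one (k : ℤ) : halfSign (2 * k + 1) = 0 :=
  if_neg (by omega)

theorem halfSign_eq (m k l : ℤ) (h : k = m + 4 * l) : halfSign k = halfSign m := by
  subst h
  rcases Int.even_or_odd' m with ⟨a, rfl | rfl⟩
  · rw [show 2 * a + 4 * l = 2 * (a + 2 * l) by ring, halfSign_two_mul, halfSign_two_mul]
    congr 2
    rw [Int.negOnePow_eq_iff]; exact ⟨l, by ring⟩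
  · rw [show 2 * a + 1 + 4 * l = 2 * (a + 2 * l) + 1 by ring, halfSign_two_mul_add_one,
      halfSign_two_mul_add_one]

theorem halfSign_add_two (m : ℤ) : halfSign (m + 2) = -halfSign m := by
  rcases Int.even_or_odd' m with ⟨a, rfl | rfl⟩
  · rw [show 2 * a + 2 = 2 * (a + 1) by ring, halfSign_two_mul, halfSign_two_mul,
      Int.negOnePow_succ]
    push_cast; ring
  · rw [show 2 * a + 1 + 2 = 2 * (a + 1) + 1 by ring, halfSign_two_mul_add_one,
      halfSign_two_mul_add_one, neg_zero]

theorem halfSign_seven_mul (m : ℤ) : halfSign (7 * m) = halfSign m := by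
  rcases Int.even_or_odd' m with ⟨a, rfl | rfl⟩
  · exact halfSign_eq _ _ (3 * a) (by ring)
  · rw [show 7 * (2 * a + 1) = 2 * (7 * a + 3) + 1 by ring, halfSign_two_mul_add_one,
      halfSign_two_mul_add_one]

/-- Moving along `(m, n) ↦ (m + 1, n + m)`, the coefficients of `rankK` alternate in sign up to
jumps at the exponents of a theta series. -/
theorem bc_rankK (m n : ℤ) : bc rankK (m + 1) (n + m) = -bc rankK m n +
    halfSign m * ((if 8 * n = m * (m - 2) then 1 else 0) +
      (if 8 * n = m * (m - 6) then 1 else 0)) := by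
  rcases Int.even_or_odd' m with ⟨k, rfl | rfl⟩
  · have i1 : 8 * n = 2 * k * (2 * k - 2) ↔ 2 * n = k * (k - 1) := by
      constructor <;> intro h
      · refine mul_left_cancel₀ (show (4 : ℤ) ≠ 0 by norm_num) ?_; linear_combination h
      · linear_combination 4 * h
    have i2 : 8 * n = 2 * k * (2 * k - 6) ↔ 2 * n = k * (k - 3) := by
      constructor <;> intro h
      · refine mul_left_cancel₀ (show (4 : ℤ) ≠ 0 by norm_num) ?_; linear_combination h
      · linear_combination 4 * h
    rw [bc_rankK_even, halfSign_two_mul]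
    simp only [i1, i2]
  · rw [halfSign_two_mul_add_one, zero_mul, add_zero, ← bc_rankK_odd]
    congr 1 <;> ring

/-- Moving along `(m - 1, n + m - 1) ↦ (m, n)`, the coefficients of `rankL` are constant up to
jumps at the exponents of a theta series. -/
theorem bc_rankL (m n : ℤ) : bc rankL m n = bc rankL (m - 1) (n + m - 1) +
    halfSign m * ((if 4 * n = m * (m - 2) then 1 else 0) +
      (if 4 * n = m * (m - 6) + 4 then 1 else 0)) := by
  rcases Int.even_or_odd' m with ⟨k, rfl | rfl⟩
  · have i1 : 4 * n = 2 * k * (2 * k - 2) ↔ n = k * (k - 1) := by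
      constructor <;> intro h
      · refine mul_left_cancel₀ (show (4 : ℤ) ≠ 0 by norm_num) ?_; linear_combination h
      · linear_combination 4 * h
    have i2 : 4 * n = 2 * k * (2 * k - 6) + 4 ↔ n = k * (k - 3) + 1 := by
      constructor <;> intro h
      · refine mul_left_cancel₀ (show (4 : ℤ) ≠ 0 by norm_num) ?_; linear_combination h
      · linear_combination 4 * h
    rw [bc_rankL_even, halfSign_two_mul]
    simp only [i1, i2]
  · rw [halfSign_two_mul_add_one, zero_mul, add_zero, bc_rankL_odd]
    congr 1 <;> ring

theorem two_mul_cast_choose_two (k : ℕ) : 2 * ((k.choose 2 : ℕ) : ℤ) = k * (k - 1) := by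
  induction k with
  | zero => simp
  | succ k ih =>
    rw [Nat.choose_succ_succ' k 1, Nat.choose_one_right]
    push_cast; linear_combination ih

/-- Seven steps of the recurrence for `rankK` on the sublattice `(7m - 3, 49n + 4)` amount to one
step of the same recurrence. -/
theorem bc_rankK_seven (m n : ℤ) : bc rankK (7 * m - 3) (49 * n + 4) = bc rankK m n := by
  have hall : ∀ (M L : ℤ) (k : ℕ), bc rankK (M + k) (L + k * M + k.choose 2) =
      (-1) ^ k * (bc rankK M L -
        ((∑ j ∈ range k, if 4 * (2 * L + 2 * j * M + j * (j - 1)) = (M + j) * (M + j - 2) then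
          (-1) ^ j * halfSign (M + j) else 0) +
        ∑ j ∈ range k, if 4 * (2 * L + 2 * j * M + j * (j - 1)) = (M + j) * (M + j - 6) then
          (-1) ^ j * halfSign (M + j) else 0)) := by
    intro M L k
    induction k with
    | zero => simp
    | succ k ih =>
      have h := bc_rankK (M + k) (L + k * M + k.choose 2)
      have e1 : M + (k + 1 : ℕ) = M + k + 1 := by push_cast; ring
      have e2 : L + (k + 1 : ℕ) * M + (k + 1).choose 2 = L + k * M + k.choose 2 + (M + k) := by
        rw [Nat.choose_succ_succ' k 1, Nat.choose_one_right]; push_cast; ring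
      have e3 : 8 * (L + k * M + k.choose 2) = 4 * (2 * L + 2 * k * M + k * (k - 1)) := by
        rw [← two_mul_cast_choose_two]; ring
      have e4 : ((-1) ^ k * (-1) ^ k : ℂ) = 1 := by rw [← mul_pow]; simp
      rw [e1, e2, h, ih, sum_range_succ, sum_range_succ, e3]
      split_ifs
      · linear_combination (-2 * halfSign (M + k)) * e4
      · linear_combination (-halfSign (M + k)) * e4
      · linear_combination (-halfSign (M + k)) * e4
      · ring
  rw [← sub_eq_zero]
  refine eq_zero_of_orbit_symm
    (d := fun m n => bc rankK (7 * m - 3) (49 * n + 4) - bc rankK m n)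
    (N := 2 * n - m * (m - 1)) (fun m n => ?_) (fun m n _ => ?_) rfl
  · rw [bc_rankK_symm m, show 7 * (1 - m) - 3 = 1 - (7 * m - 3) by ring, bc_rankK_symm]
  have h1 := hall (7 * m - 3) (49 * n + 4) 7
  rw [sum_range_seven_ite (i := 1) (by norm_num), sum_range_seven_ite (i := 5) (by norm_num)] at h1
  · have i1 : 4 * (2 * (49 * n + 4) + 2 * (1 : ℕ) * (7 * m - 3) + (1 : ℕ) * ((1 : ℕ) - 1)) =
        (7 * m - 3 + (1 : ℕ)) * (7 * m - 3 + (1 : ℕ) - 2) ↔ 8 * n = m * (m - 2) := by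
      push_cast
      constructor <;> intro h
      · refine mul_left_cancel₀ (show (49 : ℤ) ≠ 0 by norm_num) ?_; linear_combination h
      · linear_combination 49 * h
    have i2 : 4 * (2 * (49 * n + 4) + 2 * (5 : ℕ) * (7 * m - 3) + (5 : ℕ) * ((5 : ℕ) - 1)) =
        (7 * m - 3 + (5 : ℕ)) * (7 * m - 3 + (5 : ℕ) - 6) ↔ 8 * n = m * (m - 6) := by
      push_cast
      constructor <;> intro h
      · refine mul_left_cancel₀ (show (49 : ℤ) ≠ 0 by norm_num) ?_; linear_combination h
      · linear_combination 49 * h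
    have s1 : halfSign (7 * m - 3 + (1 : ℕ)) = -halfSign m := by
      rw [halfSign_eq (7 * m + 2) _ (-1) (by push_cast; ring), halfSign_add_two,
        halfSign_seven_mul]
    have s2 : halfSign (7 * m - 3 + (5 : ℕ)) = -halfSign m := by
      rw [halfSign_eq (7 * m + 2) _ 0 (by push_cast; ring), halfSign_add_two, halfSign_seven_mul]
    simp only [i1, i2, s1, s2] at h1
    rw [bc_rankK m n, show 7 * (m + 1) - 3 = 7 * m - 3 + (7 : ℕ) by push_cast; ring,
      show 49 * (n + m) + 4 = 49 * n + 4 + (7 : ℕ) * (7 * m - 3) + (Nat.choose 7 2 : ℕ) by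
        rw [show Nat.choose 7 2 = 21 by decide]; push_cast; ring, h1]
    split_ifs <;> ring
  · intro j hj h
    have : 7 * (56 * n + 6 * j * m - 7 * m ^ 2 + 12 * m) = -3 * (j : ℤ) ^ 2 + 16 * j - 5 := by
      linear_combination h
    interval_cases j <;> omega
  · intro j hj h
    have : 7 * (56 * n + 6 * j * m - 7 * m ^ 2 + 8 * m) = -3 * (j : ℤ) ^ 2 + 20 * j - 17 := by
      linear_combination h
    interval_cases j <;> omega

/-- Seven steps of the recurrence for `rankL` on the sublattice `(7m - 3, 49n + 10)` amount to one
step of the same recurrence. -/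
theorem bc_rankL_seven (m n : ℤ) : bc rankL (7 * m - 3) (49 * n + 10) = bc rankL m n := by
  have hall : ∀ (M L : ℤ) (k : ℕ), bc rankL M L = bc rankL (M - k) (L + k * M - (k + 1).choose 2) +
      ((∑ j ∈ range k, if 2 * (2 * L + 2 * j * M - (j + 1) * j) = (M - j) * (M - j - 2) then
          halfSign (M - j) else 0) +
        ∑ j ∈ range k, if 2 * (2 * L + 2 * j * M - (j + 1) * j) = (M - j) * (M - j - 6) + 4 then
          halfSign (M - j) else 0) := by
    intro M L k
    induction k with
    | zero => simp
    | succ k ih =>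
      have e1 : M - (k + 1 : ℕ) = M - k - 1 := by push_cast; ring
      have e2 : L + (k + 1 : ℕ) * M - (k + 1 + 1).choose 2 =
          L + k * M - (k + 1).choose 2 + (M - k) - 1 := by
        rw [Nat.choose_succ_succ' (k + 1) 1, Nat.choose_one_right]; push_cast; ring
      have e3 : 4 * (L + k * M - (k + 1).choose 2) = 2 * (2 * L + 2 * k * M - (k + 1) * k) := by
        have := two_mul_cast_choose_two (k + 1)
        push_cast at this ⊢
        linear_combination (-2) * this
      rw [ih, bc_rankL (M - k), sum_range_succ, sum_range_succ, e1, e2, e3]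
      split_ifs <;> ring
  rw [← sub_eq_zero]
  refine eq_zero_of_orbit_one
    (d := fun m n => bc rankL (7 * m - 3) (49 * n + 10) - bc rankL m n)
    (N := 2 * n + m * (m - 1)) (fun m n hn => ?_) (fun m n _ => ?_) rfl
  · rw [bc_of_neg _ _ hn, bc_of_neg _ _ (by omega), sub_zero]
  have h1 := hall (7 * m - 3) (49 * n + 10) 7
  rw [sum_range_seven_ite (i := 1) (by norm_num), sum_range_seven_ite (i := 5) (by norm_num)] at h1
  · have i1 : 2 * (2 * (49 * n + 10) + 2 * (1 : ℕ) * (7 * m - 3) - ((1 : ℕ) + 1) * (1 : ℕ)) =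
        (7 * m - 3 - (1 : ℕ)) * (7 * m - 3 - (1 : ℕ) - 2) ↔ 4 * n = m * (m - 2) := by
      push_cast
      constructor <;> intro h
      · refine mul_left_cancel₀ (show (49 : ℤ) ≠ 0 by norm_num) ?_; linear_combination h
      · linear_combination 49 * h
    have i2 : 2 * (2 * (49 * n + 10) + 2 * (5 : ℕ) * (7 * m - 3) - ((5 : ℕ) + 1) * (5 : ℕ)) =
        (7 * m - 3 - (5 : ℕ)) * (7 * m - 3 - (5 : ℕ) - 6) + 4 ↔ 4 * n = m * (m - 6) + 4 := by
      push_cast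
      constructor <;> intro h
      · refine mul_left_cancel₀ (show (49 : ℤ) ≠ 0 by norm_num) ?_; linear_combination h
      · linear_combination 49 * h
    have s1 : halfSign (7 * m - 3 - (1 : ℕ)) = halfSign m := by
      rw [halfSign_eq (7 * m) _ (-1) (by push_cast; ring), halfSign_seven_mul]
    have s2 : halfSign (7 * m - 3 - (5 : ℕ)) = halfSign m := by
      rw [halfSign_eq (7 * m) _ (-2) (by push_cast; ring), halfSign_seven_mul]
    simp only [i1, i2, s1, s2] at h1
    rw [h1, bc_rankL m n, show 7 * m - 3 - (7 : ℕ) = 7 * (m - 1) - 3 by push_cast; ring,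
      show 49 * n + 10 + (7 : ℕ) * (7 * m - 3) - (Nat.choose (7 + 1) 2 : ℕ) =
          49 * (n + m - 1) + 10 by
        rw [show Nat.choose (7 + 1) 2 = 28 by decide]; push_cast; ring]
    split_ifs <;> ring
  · intro j hj h
    have : 7 * (28 * n + 6 * j * m - 7 * m ^ 2 + 12 * m) = 3 * (j : ℤ) ^ 2 + 26 * j - 9 := by
      linear_combination h
    interval_cases j <;> omega
  · intro j hj h
    have : 7 * (28 * n + 6 * j * m - 7 * m ^ 2 + 8 * m) = 3 * (j : ℤ) ^ 2 + 22 * j - 25 := by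
      linear_combination h
    interval_cases j <;> omega

/-! ### Vanishing off the sublattices -/

/-- For `n ≡ 4` modulo `7` the number `3 (4n + m²) + 1 ≡ 3m²` is not a square unless `7 ∣ m`; the
vanishing statements for `rankK` and `rankL` below rest on the same fact. -/
theorem bc_rankH_eq_zero_of_not_dvd {m : ℤ} (l : ℤ) (hm : ¬ 7 ∣ m) :
    bc rankH m (7 * l + 4) = 0 := by
  refine bc_rankH_eq_zero fun x hx => hm ?_
  exact seven_dvd_of_sq_modEq (x := x) (c := 12 * l + 7) (by linear_combination hx)

/-- On the sublattice, a jump forces a square divisible by `7`, hence by `49`. -/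
theorem bc_rankH_eq_zero_of_not_dvd' (m : ℤ) {l : ℤ} (hl : ¬ 7 ∣ l) :
    bc rankH (7 * m) (7 * l + 4) = 0 := by
  refine bc_rankH_eq_zero fun x hx => hl ?_
  have := seven_dvd_of_sq_eq (x := x) (c := 12 * l + 7 + 21 * m ^ 2) (by linear_combination hx)
  omega

theorem bc_rankK_eq_zero_of_not_dvd {m : ℤ} (l : ℤ) (hm : ¬ 7 ∣ m + 3) :
    bc rankK m (7 * l + 4) = 0 := by
  refine bc_rankK_eq_zero fun x hx => hm ?_
  have := seven_dvd_of_sq_modEq (x := x) (y := 2 * m - 1) (c := -24 * l - 14)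
    (by linear_combination hx)
  omega

theorem bc_rankK_eq_zero_of_not_dvd' (m : ℤ) {l : ℤ} (hl : ¬ 7 ∣ l) :
    bc rankK (7 * m - 3) (7 * l + 4) = 0 := by
  refine bc_rankK_eq_zero fun x hx => hl ?_
  have := seven_dvd_of_sq_eq (x := x) (c := -24 * l - 14 + 21 * (2 * m - 1) ^ 2)
    (by linear_combination hx)
  omega

theorem bc_rankL_eq_zero_of_not_dvd {m : ℤ} (l : ℤ) (hm : ¬ 7 ∣ m + 3) :
    bc rankL m (7 * l + 3) = 0 := by
  refine bc_rankL_eq_zero fun x hx => hm ?_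
  have := seven_dvd_of_sq_modEq (x := 3 * x) (y := 2 * m - 1)
    (c := 108 * l + 51 + 6 * m * (m - 1)) (by linear_combination 9 * hx)
  omega

theorem bc_rankL_eq_zero_of_not_dvd' (m : ℤ) {l : ℤ} (hl : ¬ 7 ∣ l - 1) :
    bc rankL (7 * m - 3) (7 * l + 3) = 0 := by
  refine bc_rankL_eq_zero fun x hx => hl ?_
  have := seven_dvd_of_sq_eq (x := x) (c := 12 * l + 16 + 42 * m ^ 2 - 42 * m)
    (by linear_combination hx)
  omega

/-- If the coefficients of `F` in the progression `r` modulo `7` live on a sublattice on which they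
replicate `F`, then sifting the specialisation of `F` to a seventh root of unity gives the
specialisation of `F` to `1`. -/
theorem U_evalZ {F : BiSeries} {r l₀ : ℕ} {m₀ : ℤ}
    (h1 : ∀ m l : ℤ, ¬ 7 ∣ m - m₀ → bc F m (7 * l + r) = 0)
    (h2 : ∀ m l : ℤ, ¬ 7 ∣ l - l₀ → bc F (7 * m + m₀) (7 * l + r) = 0)
    (h3 : ∀ m n : ℤ, bc F (7 * m + m₀) (7 * (7 * n + l₀) + r) = bc F m n)
    {w : ℂˣ} (hw : w ^ 7 = 1) :
    U 7 r (evalZ w F) =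
      C ((w ^ m₀ : ℂˣ) : ℂ) * (X ^ l₀ * expand 7 (by norm_num) (evalZ 1 F)) := by
  ext n
  have hinj : Function.Injective fun m : ℤ => 7 * m + m₀ := fun a b h => by
    simp only at h; omega
  have hL : coeff n (U 7 r (evalZ w F)) =
      ((w ^ m₀ : ℂˣ) : ℂ) * ∑ᶠ m : ℤ, bc F (7 * m + m₀) (7 * n + r) := by
    rw [U, coeff_mk, coeff_evalZ, mul_finsum]
    have hs : (Function.support fun m : ℤ =>
        bc F m ((7 * n + r : ℕ) : ℤ) * ((w ^ m : ℂˣ) : ℂ)) ⊆ Set.range fun m : ℤ => 7 * m + m₀ := by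
      intro m hm
      by_contra hne
      refine hm ?_
      simp only
      rw [Nat.cast_add, Nat.cast_mul, Nat.cast_ofNat, h1 m n, zero_mul]
      rintro ⟨k, hk⟩
      exact hne ⟨k, by simp only; omega⟩
    rw [← Set.indicator_eq_self.2 hs, ← finsum_mem_def, finsum_mem_range hinj]
    refine finsum_congr fun m => ?_
    rw [zpow_add, zpow_mul, show (w ^ (7 : ℤ)) = 1 from mod_cast hw, one_zpow, one_mul, mul_comm]
    push_cast; rfl
  rw [hL, coeff_C_mul]
  congr 1
  by_cases hn : (7 : ℤ) ∣ n - l₀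
  · obtain ⟨k, hk⟩ := hn
    have hk' : ∀ m, bc F (7 * m + m₀) (7 * n + r) = bc F m k := fun m => by
      rw [← h3 m k, ← hk, sub_add_cancel]
    simp only [hk', coeff_X_pow_mul']
    split_ifs with hl
    · rw [coeff_expand, if_pos (by omega), coeff_evalZ]
      refine finsum_congr fun m => ?_
      rw [one_zpow, Units.val_one, mul_one]
      congr 1; omega
    · have : ∀ m, bc F m k = 0 := fun m => bc_of_neg _ _ (by omega)
      simp [this]
  · simp only [h2 _ _ hn, finsum_zero, coeff_X_pow_mul']
    split_ifs with hl
    · rw [coeff_expand, if_neg (by omega)]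
    · rfl

theorem U_rankH {w : ℂˣ} (hw : w ^ 7 = 1) :
    U 7 4 (evalZ w rankH) = expand 7 (by norm_num) (evalZ 1 rankH) := by
  rw [U_evalZ (m₀ := 0) (l₀ := 0) (fun m l hm => bc_rankH_eq_zero_of_not_dvd l (by simpa using hm))
    (fun m l hl => by rw [add_zero]; exact bc_rankH_eq_zero_of_not_dvd' m (by simpa using hl))
    (fun m n => by refine Eq.trans ?_ (bc_rankH_seven m n); congr 1 <;> push_cast <;> ring) hw]
  simp

theorem U_rankK {w : ℂˣ} (hw : w ^ 7 = 1) :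
    U 7 4 (evalZ w rankK) = C ((w : ℂ) ^ 4) * expand 7 (by norm_num) (evalZ 1 rankK) := by
  rw [U_evalZ (m₀ := -3) (l₀ := 0)
    (fun m l hm => bc_rankK_eq_zero_of_not_dvd l (by simpa using hm))
    (fun m l hl => bc_rankK_eq_zero_of_not_dvd' m (by simpa using hl))
    (fun m n => by refine Eq.trans ?_ (bc_rankK_seven m n); congr 1; push_cast; ring) hw,
    show w ^ (-3 : ℤ) = w ^ 4 by
      rw [zpow_neg, _root_.inv_eq_iff_mul_eq_one]; exact (pow_add w 3 4).symm.trans hw]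
  simp

theorem U_rankL {w : ℂˣ} (hw : w ^ 7 = 1) :
    U 7 3 (evalZ w rankL) = C ((w : ℂ) ^ 4) * (X * expand 7 (by norm_num) (evalZ 1 rankL)) := by
  rw [U_evalZ (m₀ := -3) (l₀ := 1)
    (fun m l hm => bc_rankL_eq_zero_of_not_dvd l (by simpa using hm))
    (fun m l hl => bc_rankL_eq_zero_of_not_dvd' m (by simpa using hl))
    (fun m n => by refine Eq.trans ?_ (bc_rankL_seven m n); congr 1; push_cast; ring) hw,
    show w ^ (-3 : ℤ) = w ^ 4 by
      rw [zpow_neg, _root_.inv_eq_iff_mul_eq_one]; exact (pow_add w 3 4).symm.trans hw]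
  simp

/-! ### The values at `z = 1` -/

theorem J_eq_poch {b : ℕ} (hb : b ≠ 0) : J b = poch (X ^ b) (X ^ b) :=
  qPoch_eq_poch _ (dvd_pow_self X hb)

theorem J_ne_zero {b : ℕ} (hb : 0 < b) : J b ≠ 0 := fun h => by
  simpa [h] using constantCoeff_J hb

theorem expand_J {k b : ℕ} (hk : k ≠ 0) (hb : b ≠ 0) : expand k hk (J b) = J (k * b) := by
  rw [J_eq_poch hb, J_eq_poch (mul_ne_zero hk hb), expand_poch hk _ (dvd_pow_self X hb)]
  simp [pow_mul]

theorem evalZ_thetaQuot (w : ℂˣ) (a : ℤ) (e : ℕ) : evalZ w (thetaQuot a e) =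
    poch (C ((w ^ a : ℂˣ) : ℂ) * X ^ e) (X ^ e) * poch (C ((w ^ (-a) : ℂˣ) : ℂ) * X ^ e) (X ^ e) *
      poch (X ^ e) (X ^ e) := by
  simp only [thetaQuot, map_mul, evalZ_poch, evalZ_zpw, map_pow, evalZ_X]

theorem evalZ_one_thetaQuot (a : ℤ) {e : ℕ} (he : e ≠ 0) : evalZ 1 (thetaQuot a e) = J e ^ 3 := by
  rw [evalZ_thetaQuot, J_eq_poch he]
  simp only [one_zpow, Units.val_one, map_one, one_mul]
  ring

theorem evalZ_one_rankBi_mul_J : evalZ 1 rankBi * J 1 = 1 := by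
  rw [J_eq_poch one_ne_zero, pow_one, evalZ_one_rankBi_mul]

theorem evalZ_one_one_add_zpw : evalZ 1 (1 + zpw 1) = 2 := by
  rw [map_add, map_one, evalZ_zpw]; simp; norm_num

theorem evalZ_one_rankH : evalZ 1 rankH = J 1 ^ 2 := by
  rw [rankH, map_mul, evalZ_one_thetaQuot 1 one_ne_zero]
  linear_combination J 1 ^ 2 * evalZ_one_rankBi_mul_J

theorem evalZ_one_rankK : evalZ 1 rankK = 2 * J 1 ^ 2 := by
  rw [rankK, map_mul, map_mul, evalZ_one_thetaQuot 2 one_ne_zero, evalZ_one_one_add_zpw]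
  linear_combination 2 * J 1 ^ 2 * evalZ_one_rankBi_mul_J

theorem evalZ_one_rankL : evalZ 1 rankL = 2 * (J 2 ^ 3 * (J 1)⁻¹) := by
  rw [rankL, map_mul, map_mul, evalZ_one_thetaQuot 2 two_ne_zero, evalZ_one_one_add_zpw,
    show (J 1)⁻¹ = evalZ 1 rankBi from
      (PowerSeries.inv_eq_iff_mul_eq_one (by simp [constantCoeff_J])).2 evalZ_one_rankBi_mul_J]
  ring

theorem expand_inv {k : ℕ} (hk : k ≠ 0) {f : ℂ⟦X⟧} (hf : constantCoeff f ≠ 0) :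
    expand k hk f⁻¹ = (expand k hk f)⁻¹ := by
  symm
  rw [PowerSeries.inv_eq_iff_mul_eq_one, ← map_mul, PowerSeries.inv_mul_cancel _ hf, map_one]
  rwa [constantCoeff_expand]

/-! ### Components of a dissection -/

theorem coeff_U (p r n : ℕ) (F : ℂ⟦X⟧) : coeff n (U p r F) = coeff (p * n + r) F := by
  simp [U]

theorem U_C_mul (p r : ℕ) (c : ℂ) (F : ℂ⟦X⟧) : U p r (C c * F) = C c * U p r F := by
  ext n; simp [coeff_U]

theorem U_X_pow_mul {p r j s : ℕ} (h : r = j + s) (F : ℂ⟦X⟧) : U p r (X ^ j * F) = U p s F := by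
  ext n
  rw [coeff_U, coeff_U, h, show p * n + (j + s) = p * n + s + j by ring, coeff_X_pow_mul]

/-- The case of a carry in the sum of the residues. -/
theorem U_X_pow_mul_of_lt {p r j s : ℕ} (h : r + p = j + s) (hr : r < j) (F : ℂ⟦X⟧) :
    U p r (X ^ j * F) = X * U p s F := by
  ext n
  rw [coeff_U]
  cases n with
  | zero => rw [coeff_zero_X_mul, coeff_X_pow_mul', if_neg (by omega)]
  | succ n =>
    rw [coeff_succ_X_mul, coeff_U, show p * (n + 1) + r = p * n + s + j by
      rw [mul_add, mul_one, add_assoc, add_comm p, h]; ring, coeff_X_pow_mul]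

theorem U_sum {p : ℕ} (hp : p ≠ 0) (f : ℕ → ℂ⟦X⟧) {r : ℕ} (hr : r < p) :
    U p r (∑ s ∈ range p, X ^ s * expand p hp (f s)) = f r := by
  ext n
  rw [coeff_U, map_sum, Finset.sum_eq_single r]
  · rw [coeff_X_pow_mul, coeff_expand_mul]
  · intro s hs hsr
    rw [coeff_X_pow_mul']
    split_ifs with h
    · rw [coeff_expand, if_neg]
      intro hd
      have h1 : s ≡ p * n + r [MOD p] := (Nat.modEq_iff_dvd' h).2 hd
      have h2 : p * n + r ≡ r [MOD p] := by simp [Nat.ModEq]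
      exact hsr ((h1.trans h2).eq_of_lt_of_lt (mem_range.1 hs) hr)
    · rfl
  · intro h; exact absurd (mem_range.2 hr) h

theorem U_expand_mul {p : ℕ} (hp : p ≠ 0) {r : ℕ} (hr : r < p) (f F : ℂ⟦X⟧) :
    U p r (expand p hp f * F) = f * U p r F := by
  conv_lhs => rw [dissection p hp F, mul_sum]
  rw [← U_sum hp (fun s => f * U p s F) hr]
  congr 1
  refine sum_congr rfl fun s _ => ?_
  rw [map_mul]; ring

/-- The `7`-dissection of a product formula, compared componentwise. -/
theorem components_unique {f g : ℕ → ℂ⟦X⟧}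
    (h : ∑ s ∈ range 7, X ^ s * expand 7 (by norm_num) (f s) =
      ∑ s ∈ range 7, X ^ s * expand 7 (by norm_num) (g s)) {r : ℕ} (hr : r < 7) : f r = g r := by
  rw [← U_sum (by norm_num) f hr, h, U_sum (by norm_num) g hr]

/-! ### Dissections of theta functions -/

theorem Jt_eq_theta {b a : ℕ} (hb : b ≠ 0) (hab : a ≤ b) :
    Jt b a = theta (X ^ a) (X ^ (b - a)) := by
  have hX : (X : ℂ⟦X⟧) ∣ X ^ b := dvd_pow_self X hb
  rw [Jt, theta, ← pow_add, Nat.add_sub_cancel' hab, qPoch_eq_poch _ hX, qPoch_eq_poch _ hX,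
    qPoch_eq_poch _ hX]

theorem Jt_symm {b a : ℕ} (hb : b ≠ 0) (hab : a ≤ b) : Jt b (b - a) = Jt b a := by
  rw [Jt_eq_theta hb (Nat.sub_le b a), Jt_eq_theta hb hab, Nat.sub_sub_self hab, theta_symm]

theorem theta_one_left {S : Type*} [CommRing S] {v : S⟦X⟧} (hv : X ∣ v) : theta 1 v = 0 := by
  rw [theta, poch_eq_mul 1 (by simpa using hv)]; ring

theorem expand_theta_X_pow {k : ℕ} (hk : k ≠ 0) {a b : ℕ} (h : a + b ≠ 0) :
    theta (X ^ (k * a) : ℂ⟦X⟧) (X ^ (k * b)) = expand k hk (theta (X ^ a) (X ^ b)) := by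
  rw [expand_theta hk (by rw [← pow_add]; exact dvd_pow_self X h)]
  simp [pow_mul]

theorem sum_thetaTerm_seven {S : Type*} [CommRing S] (u v : S⟦X⟧) (f : ℕ → S⟦X⟧) :
    ∑ s ∈ range 7, thetaTerm u v ((s : ℤ) - 3) * f s =
      -(u ^ 3 * v ^ 6 * f 0) + u * v ^ 3 * f 1 - v * f 2 + f 3 - u * f 4 + u ^ 3 * v * f 5 -
        u ^ 6 * v ^ 3 * f 6 := by
  simp only [sum_range_succ, sum_range_zero, thetaTerm]
  norm_num [tri, Int.negOnePow_odd, Int.negOnePow_even, show Odd (3 : ℤ) by decide,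
    show Int.toNat 3 = 3 from rfl, show Int.toNat 6 = 6 from rfl]
  ring

/-- The `7`-dissection of `(wq; q)_∞ (w⁻¹q; q)_∞ (q; q)_∞`, with `qᵉ` for `q`, at a nontrivial
seventh root of unity `w`. -/
theorem evalZ_thetaQuot_seven {w : ℂˣ} (hw : w ^ 7 = 1) (hw1 : w ≠ 1) {e : ℕ} (he : e ≠ 0) :
    evalZ w (thetaQuot 1 e) = expand 7 (by norm_num) (Jt (7 * e) (3 * e)) -
      C ((w : ℂ) ^ 6 + 1 + w) * (X ^ e * expand 7 (by norm_num) (Jt (7 * e) (2 * e))) -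
      C ((w : ℂ) ^ 3 + w ^ 4) * (X ^ (3 * e) * expand 7 (by norm_num) (Jt (7 * e) e)) := by
  obtain ⟨z, hz⟩ : ∃ z : ℂ⟦X⟧, z = C (w : ℂ) := ⟨_, rfl⟩
  have hz7 : z ^ 7 = 1 := by
    rw [hz, ← map_pow, ← Units.val_pow_eq_pow_val, hw]; simp
  have hz1 : 1 - z ≠ 0 := by
    rw [hz, ← map_one C, ← map_sub, Ne, map_eq_zero_iff C C_injective, sub_eq_zero]
    exact fun h => hw1 (Units.ext h.symm)
  have hzinv : C ((w⁻¹ : ℂˣ) : ℂ) = z ^ 6 := by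
    rw [hz, ← map_pow, ← Units.val_pow_eq_pow_val]
    congr 2
    rw [_root_.inv_eq_iff_mul_eq_one, ← pow_succ', hw]
  have hθ : (1 - z) * evalZ w (thetaQuot 1 e) = theta z (z ^ 6 * X ^ e) := by
    have := congrArg (evalZ w) (one_sub_mul_thetaQuot 1 he)
    rw [map_mul, map_sub, map_one, evalZ_zpw, zpow_one, thetaBi, evalZ_theta, map_mul, evalZ_zpw,
      evalZ_zpw, map_pow, evalZ_X, zpow_neg_one, hzinv, zpow_one, ← hz] at this
    exact this
  have hX : X ∣ z * (z ^ 6 * X ^ e) := by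
    rw [← mul_assoc, ← pow_succ', hz7, one_mul]; exact dvd_pow_self X he
  have ht : ∀ s ≤ 7, theta (z ^ (7 * s + 7) * (z ^ 6 * X ^ e) ^ (7 * s))
      (z ^ (42 - 7 * s) * (z ^ 6 * X ^ e) ^ (49 - 7 * s)) =
        expand 7 (by norm_num) (theta (X ^ (e * s)) (X ^ (e * (7 - s)))) := by
    intro s hs
    rw [← expand_theta_X_pow _ (by rw [← mul_add, Nat.add_sub_cancel' hs]; positivity)]
    have h7 : ∀ k, z ^ (7 * k) = 1 := fun k => by rw [pow_mul, hz7, one_pow]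
    have hk : ∀ k, (z ^ 6 * X ^ e) ^ (7 * k) = X ^ (7 * (e * k)) := fun k => by
      rw [mul_pow, pow_right_comm, h7, one_pow, one_mul, ← pow_mul]; congr 1; ring
    rw [show 7 * s + 7 = 7 * (s + 1) by ring, show 42 - 7 * s = 7 * (6 - s) by omega,
      show 49 - 7 * s = 7 * (7 - s) by omega, h7, h7, hk, hk, one_mul, one_mul]
  have hsum := theta_seven hX
  rw [sum_congr rfl fun s hs => by rw [ht s (by simp at hs; omega)], sum_thetaTerm_seven] at hsum
  refine mul_left_cancel₀ hz1 ?_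
  have hJ : ∀ s ≤ 7, theta (X ^ (e * s)) (X ^ (e * (7 - s))) = Jt (7 * e) (e * s) := fun s hs => by
    rw [Jt_eq_theta (by positivity) (by nlinarith), Nat.mul_sub, mul_comm e 7]
  have hJ' : ∀ s ≤ 7, Jt (7 * e) (e * (7 - s)) = Jt (7 * e) (e * s) := fun s hs => by
    rw [← Jt_symm (by positivity) (show e * s ≤ 7 * e by nlinarith), Nat.mul_sub, mul_comm e 7]
  have h0 : theta (X ^ (e * 0) : ℂ⟦X⟧) (X ^ (e * (7 - 0))) = 0 := by
    rw [mul_zero, pow_zero, theta_one_left (dvd_pow_self X (by positivity))]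
  have h4 := hJ' 3 (by norm_num)
  have h5 := hJ' 2 (by norm_num)
  have h6 := hJ' 1 (by norm_num)
  norm_num only at h4 h5 h6
  rw [hθ, hsum, h0, hJ 1 (by norm_num), hJ 2 (by norm_num), hJ 3 (by norm_num),
    hJ 4 (by norm_num), hJ 5 (by norm_num), hJ 6 (by norm_num), h4, h5, h6, mul_comm e 3,
    mul_comm e 2, mul_one]
  simp only [map_add, map_pow, map_one, map_zero, ← hz, pow_mul']
  linear_combination ((z ^ 2 - 1) * X ^ e * expand 7 (by norm_num) (Jt (7 * e) (2 * e)) +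
    (z ^ 5 * (z ^ 7 + 1) - z ^ 3 * (z ^ 14 + z ^ 7 + 1)) * X ^ (e * 3) *
      expand 7 (by norm_num) (Jt (7 * e) e)) * hz7

/-! ### Products of theta functions -/

theorem theta_X_X_sq : theta X (X ^ 2) = J 1 := by
  have hX : (X : ℂ⟦X⟧) ∣ X := dvd_rfl
  rw [J_eq_poch one_ne_zero, pow_one, poch_eq_prod X hX (k := 3) (by norm_num), theta]
  simp only [prod_range_succ, prod_range_zero, one_mul, pow_zero, mul_one]
  ring_nf

theorem J_seven : J 7 = expand 7 (by norm_num) (J 1) := by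
  rw [expand_J (by norm_num) (by norm_num)]

theorem constantCoeff_theta_X_pow {a b : ℕ} (ha : a ≠ 0) (hb : b ≠ 0) :
    constantCoeff (theta (X ^ a : ℂ⟦X⟧) (X ^ b)) = 1 := by
  simp [theta, constantCoeff_poch, ha, hb]

/-- The `7`-dissection of the Euler product. -/
theorem exists_J_one_dissection : ∃ x₀ x₁ x₅ : ℂ⟦X⟧, constantCoeff x₀ = 1 ∧
    J 1 = expand 7 (by norm_num) x₀ + X * expand 7 (by norm_num) x₁ -
      X ^ 2 * expand 7 (by norm_num) (J 7) + X ^ 5 * expand 7 (by norm_num) x₅ := by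
  have hX : (X : ℂ⟦X⟧) ∣ X * X ^ 2 := dvd_mul_right X _
  have ht : ∀ s < 7, theta (X ^ (7 * s + 7) * (X ^ 2) ^ (7 * s))
      (X ^ (42 - 7 * s) * (X ^ 2) ^ (49 - 7 * s)) =
        expand 7 (by norm_num) (theta (X ^ (3 * s + 1) : ℂ⟦X⟧) (X ^ (20 - 3 * s))) := by
    intro s hs
    rw [← expand_theta_X_pow _ (by omega), ← pow_mul, ← pow_mul, ← pow_add, ← pow_add]
    congr 2 <;> omega
  have hsum := theta_seven hX
  rw [sum_congr rfl fun s hs => by rw [ht s (mem_range.1 hs)], sum_thetaTerm_seven,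
    theta_X_X_sq] at hsum
  have h7 : J 7 = theta (X ^ (3 * 2 + 1)) (X ^ (20 - 3 * 2)) := by
    rw [J_seven, ← theta_X_X_sq, expand_theta _ hX]
    simp [← pow_mul]
  rw [← h7] at hsum
  refine ⟨theta (X ^ 10) (X ^ 11) + X * theta (X ^ 4) (X ^ 17),
    -theta (X ^ 13) (X ^ 8) - X ^ 2 * theta X (X ^ 20),
    theta (X ^ 16) (X ^ 5) - X * theta (X ^ 19) (X ^ 2), ?_, ?_⟩
  · simp [constantCoeff_theta_X_pow]
  · rw [hsum]
    simp only [map_add, map_sub, map_mul, map_neg, map_pow, expand_X]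
    norm_num
    ring

theorem poch_mul_poch_neg (a : ℂ⟦X⟧) {p : ℂ⟦X⟧} (hp : X ∣ p) :
    poch a p * poch (-a) p = poch (a ^ 2) (p ^ 2) := by
  refine (((isLim_pochFin a hp).mul (isLim_pochFin (-a) hp)).congr fun n => ?_).unique
    (isLim_pochFin _ (dvd_pow hp two_ne_zero))
  rw [pochFin, pochFin, pochFin, ← prod_mul_distrib]
  exact prod_congr rfl fun i _ => by ring

theorem prod_one_sub_root {R : Type*} [CommRing R] {z : R}
    (hz : 1 + z + z ^ 2 + z ^ 3 + z ^ 4 + z ^ 5 + z ^ 6 = 0) (y : R) :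
    1 * (1 - z ^ 0 * y) * (1 - z ^ 1 * y) * (1 - z ^ 2 * y) * (1 - z ^ 3 * y) * (1 - z ^ 4 * y) *
      (1 - z ^ 5 * y) * (1 - z ^ 6 * y) = 1 - y ^ 7 := by
  grind

/-- `∏_{j mod 7} (ζʲq; q)_∞ = (q⁷; q⁷)_∞`. -/
theorem prod_poch_root {z : ℂ⟦X⟧} (hz : 1 + z + z ^ 2 + z ^ 3 + z ^ 4 + z ^ 5 + z ^ 6 = 0) :
    ∏ j ∈ range 7, poch (z ^ j * X) X = J 7 := by
  rw [J_eq_poch (by norm_num)]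
  refine (IsLim.congr (IsLim.prod fun j _ => isLim_pochFin (z ^ j * X) dvd_rfl) fun n => ?_).unique
    (isLim_pochFin _ (dvd_pow_self X (by norm_num)))
  simp only [pochFin]
  rw [prod_comm]
  refine prod_congr rfl fun i _ => ?_
  simp only [prod_range_succ, prod_range_zero, mul_assoc _ X]
  rw [pow_right_comm, ← mul_pow]
  exact prod_one_sub_root hz (X * X ^ i)

/-- `J_{14,2a} J₇² = J_{7,a} J̄_{7,a} J₁₄`, with `J̄_{7,a} = ϑ(-q^a, -q^{7-a})`. -/
theorem Jt_mul_theta_neg {a : ℕ} (ha : a ≤ 7) :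
    Jt 7 a * theta (-X ^ a) (-X ^ (7 - a)) * J 14 = Jt 14 (2 * a) * J 7 ^ 2 := by
  have hX : (X : ℂ⟦X⟧) ∣ X ^ 7 := dvd_pow_self X (by norm_num)
  have h1 := poch_mul_poch_neg (X ^ a) hX
  have h2 := poch_mul_poch_neg (X ^ (7 - a)) hX
  rw [Jt_eq_theta (by norm_num) ha, Jt_eq_theta (by norm_num) (by omega), theta, theta, theta,
    ← pow_add, ← pow_add, neg_mul_neg, ← pow_add, Nat.add_sub_cancel' ha,
    Nat.add_sub_cancel' (by omega), J_eq_poch (by norm_num), J_eq_poch (by norm_num),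
    show (X : ℂ⟦X⟧) ^ 14 = (X ^ 7) ^ 2 by ring, show (X : ℂ⟦X⟧) ^ (2 * a) = (X ^ a) ^ 2 by ring,
    show (X : ℂ⟦X⟧) ^ (14 - 2 * a) = (X ^ (7 - a)) ^ 2 by rw [← pow_mul]; congr 1; omega,
    ← h1, ← h2]
  ring

/-- `J₁ ϑ(-1, -q) = 2 J₂²`. -/
theorem J_one_mul_theta_neg : J 1 * theta (-1) (-X) = 2 * J 2 ^ 2 := by
  have hX : (X : ℂ⟦X⟧) ∣ X := dvd_rfl
  have h1 := poch_mul_poch_neg X hX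
  rw [theta, show (-1 : ℂ⟦X⟧) * -X = X by ring, poch_eq_mul (-1) hX, neg_one_mul,
    J_eq_poch one_ne_zero, J_eq_poch two_ne_zero, pow_one, ← h1]
  ring

/-- The `7`-dissection of `ϑ(-1, -q)`. -/
theorem theta_neg_dissection : theta (-1) (-X) =
    2 * expand 7 (by norm_num) (theta (-X ^ 3) (-X ^ 4) : ℂ⟦X⟧) +
      2 * X * expand 7 (by norm_num) (theta (-X ^ 2) (-X ^ 5)) +
      2 * X ^ 3 * expand 7 (by norm_num) (theta (-X ^ 1) (-X ^ 6)) +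
      X ^ 6 * expand 7 (by norm_num) (expand 7 (by norm_num) (theta (-1) (-X))) := by
  have hX : (X : ℂ⟦X⟧) ∣ -1 * -X := by simp
  have ht : ∀ s < 7, theta ((-1) ^ (7 * s + 7) * (-X) ^ (7 * s))
      ((-1) ^ (42 - 7 * s) * (-X) ^ (49 - 7 * s)) =
        expand 7 (by norm_num) (theta (-X ^ s : ℂ⟦X⟧) (-X ^ (7 - s))) := by
    intro s hs
    rw [expand_theta _ (by rw [neg_mul_neg, ← pow_add]; exact dvd_pow_self X (by omega))]
    simp only [map_neg, map_pow, expand_X]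
    rw [neg_pow X, neg_pow X, ← mul_assoc, ← mul_assoc, ← pow_add, ← pow_add, ← pow_mul, ← pow_mul,
      Odd.neg_one_pow (by rw [Nat.odd_iff]; omega), Odd.neg_one_pow (by rw [Nat.odd_iff]; omega),
      neg_one_mul, neg_one_mul, show 49 - 7 * s = 7 * (7 - s) by omega]
  have hsum := theta_seven hX
  rw [sum_congr rfl fun s hs => by rw [ht s (mem_range.1 hs)], sum_thetaTerm_seven] at hsum
  have h0 : theta (-X ^ 0 : ℂ⟦X⟧) (-X ^ (7 - 0)) = expand 7 (by norm_num) (theta (-1) (-X)) := by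
    rw [expand_theta _ hX]; simp
  refine hsum.trans ?_
  rw [h0, theta_symm (-X ^ 4), theta_symm (-X ^ 5), theta_symm (-X ^ 6)]
  norm_num only
  ring

theorem two_ne_zero_series : (2 : ℂ⟦X⟧) ≠ 0 := fun h => by
  have := congrArg constantCoeff h
  rw [map_ofNat, map_zero] at this
  exact two_ne_zero this

theorem dissection_seven_ext {a₀ a₁ a₂ a₃ a₄ a₅ a₆ b₀ b₁ b₂ b₃ b₄ b₅ b₆ : ℂ⟦X⟧}
    (h : expand 7 (by norm_num) a₀ + X * expand 7 (by norm_num) a₁ +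
        X ^ 2 * expand 7 (by norm_num) a₂ + X ^ 3 * expand 7 (by norm_num) a₃ +
        X ^ 4 * expand 7 (by norm_num) a₄ + X ^ 5 * expand 7 (by norm_num) a₅ +
        X ^ 6 * expand 7 (by norm_num) a₆ =
      expand 7 (by norm_num) b₀ + X * expand 7 (by norm_num) b₁ +
        X ^ 2 * expand 7 (by norm_num) b₂ + X ^ 3 * expand 7 (by norm_num) b₃ +
        X ^ 4 * expand 7 (by norm_num) b₄ + X ^ 5 * expand 7 (by norm_num) b₅ +
        X ^ 6 * expand 7 (by norm_num) b₆) :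
    a₀ = b₀ ∧ a₁ = b₁ ∧ a₂ = b₂ ∧ a₃ = b₃ ∧ a₄ = b₄ ∧ a₅ = b₅ ∧ a₆ = b₆ := by
  have key := @components_unique (fun s => [a₀, a₁, a₂, a₃, a₄, a₅, a₆].getD s 0)
    (fun s => [b₀, b₁, b₂, b₃, b₄, b₅, b₆].getD s 0) (by
      simpa only [sum_range_succ, sum_range_zero, List.getD_cons_zero, List.getD_cons_succ,
        zero_add, pow_zero, one_mul, pow_one] using h)
  exact ⟨@key 0 (by norm_num), @key 1 (by norm_num), @key 2 (by norm_num), @key 3 (by norm_num),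
    @key 4 (by norm_num), @key 5 (by norm_num), @key 6 (by norm_num)⟩

/-- The product of the dissections of `(zᵃq)_∞ (z⁻ᵃq)_∞ (q)_∞` for `a = 1, 2, 3`, with `x = q`. -/
theorem prod_theta_root {R : Type*} [CommRing R] {z : R}
    (hz : 1 + z + z ^ 2 + z ^ 3 + z ^ 4 + z ^ 5 + z ^ 6 = 0) (x A B C : R) :
    (A - (z ^ 6 + 1 + z) * (x * B) - (z ^ 3 + z ^ 4) * (x ^ 3 * C)) *
        (A - ((z ^ 2) ^ 6 + 1 + z ^ 2) * (x * B) - ((z ^ 2) ^ 3 + (z ^ 2) ^ 4) * (x ^ 3 * C)) *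
        (A - ((z ^ 3) ^ 6 + 1 + z ^ 3) * (x * B) - ((z ^ 3) ^ 3 + (z ^ 3) ^ 4) * (x ^ 3 * C)) =
      A ^ 3 - 2 * x * (A ^ 2 * B) - x ^ 2 * (A * B ^ 2) + x ^ 3 * (B ^ 3 + A ^ 2 * C) +
        x ^ 4 * (A * B * C) + 2 * x ^ 5 * (B ^ 2 * C) - 2 * x ^ 6 * (A * C ^ 2) -
        x ^ 7 * (B * C ^ 2) - x ^ 9 * C ^ 3 := by
  grind

/-- The `7`-dissection of `J₁² J₇`, written as `∏_{a = 1}^{3} (ζᵃq)_∞ (ζ⁻ᵃq)_∞ (q)_∞`. -/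
theorem J_one_sq_mul_J_seven {ζ : ℂ}
    (hζ : 1 + ζ + ζ ^ 2 + ζ ^ 3 + ζ ^ 4 + ζ ^ 5 + ζ ^ 6 = 0) {A B C : ℂ⟦X⟧}
    (hA : A = expand 7 (by norm_num) (Jt 7 3)) (hB : B = expand 7 (by norm_num) (Jt 7 2))
    (hC : C = expand 7 (by norm_num) (Jt 7 1)) :
    J 1 ^ 2 * J 7 = A ^ 3 - 2 * X * (A ^ 2 * B) - X ^ 2 * (A * B ^ 2) +
      X ^ 3 * (B ^ 3 + A ^ 2 * C) + X ^ 4 * (A * B * C) + 2 * X ^ 5 * (B ^ 2 * C) -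
      2 * X ^ 6 * (A * C ^ 2) - X ^ 7 * (B * C ^ 2) - X ^ 9 * C ^ 3 := by
  have hζ7 : ζ ^ 7 = 1 := by linear_combination (ζ - 1) * hζ
  have hζ0 : ζ ≠ 0 := by rintro rfl; norm_num at hζ7
  have hζ1 : ζ ≠ 1 := by rintro rfl; norm_num at hζ
  obtain ⟨w, rfl⟩ : ∃ w : ℂˣ, (w : ℂ) = ζ := ⟨Units.mk0 ζ hζ0, rfl⟩
  have hw7 : w ^ 7 = 1 := Units.ext (by simpa using hζ7)
  have hw1 : w ≠ 1 := fun h => hζ1 (by rw [h]; rfl)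
  have hw2 : w ^ 2 ≠ 1 := fun h => hw1 (by
    rw [← hw7, show w ^ 7 = w * (w ^ 2) ^ 3 by rw [← pow_mul, ← pow_succ'], h, one_pow, mul_one])
  have hw3 : w ^ 3 ≠ 1 := fun h => hw1 (by
    rw [← hw7, show w ^ 7 = w * (w ^ 3) ^ 2 by rw [← pow_mul, ← pow_succ'], h, one_pow, mul_one])
  obtain ⟨z, hz⟩ : ∃ z : ℂ⟦X⟧, z = PowerSeries.C (w : ℂ) := ⟨_, rfl⟩
  have hz0 : 1 + z + z ^ 2 + z ^ 3 + z ^ 4 + z ^ 5 + z ^ 6 = 0 := by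
    rw [hz, ← map_zero PowerSeries.C, ← hζ]
    simp only [map_add, map_pow, map_one]
  have hp : ∀ k ≤ 7, evalZ (w ^ k) (thetaQuot 1 1) =
      poch (z ^ k * X) X * poch (z ^ (7 - k) * X) X * J 1 := fun k hk => by
    have h2 : (w ^ k)⁻¹ = w ^ (7 - k) := by
      rw [_root_.inv_eq_iff_mul_eq_one, ← pow_add, Nat.add_sub_cancel' hk, hw7]
    rw [evalZ_thetaQuot, J_eq_poch one_ne_zero, zpow_neg, zpow_one, h2, hz]
    simp only [Units.val_pow_eq_pow_val, map_pow, pow_one]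
  have hd : ∀ k, w ^ k ≠ 1 → evalZ (w ^ k) (thetaQuot 1 1) =
      A - ((z ^ k) ^ 6 + 1 + z ^ k) * (X * B) - ((z ^ k) ^ 3 + (z ^ k) ^ 4) * (X ^ 3 * C) :=
    fun k hk => by
    rw [evalZ_thetaQuot_seven (by rw [← pow_mul, mul_comm, pow_mul, hw7, one_pow]) hk one_ne_zero,
      hA, hB, hC, hz]
    simp only [Units.val_pow_eq_pow_val, map_pow, map_add, map_one, mul_one, pow_one]
  have h1 := prod_theta_root hz0 X A B C
  have e1 := hd 1 (by simpa using hw1)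
  rw [pow_one, pow_one] at e1
  rw [← h1, ← e1, ← hd 2 hw2, ← hd 3 hw3]
  have p1 := hp 1 (by norm_num)
  rw [pow_one w] at p1
  have hr := prod_poch_root hz0
  have h0 : poch (z ^ 0 * X) X = J 1 := by
    rw [J_eq_poch one_ne_zero, pow_zero, one_mul, pow_one]
  simp only [prod_range_succ, prod_range_zero, h0, one_mul] at hr
  rw [p1, hp 2 (by norm_num), hp 3 (by norm_num)]
  norm_num only
  -- both sides are `J 1 ^ 3` times the six nontrivial factors of `hr`
  rw [← hr]
  ring

/-- The components of the Euler product are quotients of theta functions. -/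
theorem exists_J_one_dissection_theta : ∃ x₀ x₁ x₅ : ℂ⟦X⟧,
    J 1 = expand 7 (by norm_num) x₀ + X * expand 7 (by norm_num) x₁ -
      X ^ 2 * expand 7 (by norm_num) (J 7) + X ^ 5 * expand 7 (by norm_num) x₅ ∧
    x₀ * Jt 7 1 = Jt 7 2 * J 7 ∧ x₁ * Jt 7 2 = -(Jt 7 3 * J 7) ∧
    x₅ * Jt 7 3 = Jt 7 1 * J 7 := by
  obtain ⟨x₀, x₁, x₅, hc, hx⟩ := exists_J_one_dissection
  have hζ : ∃ ζ : ℂ, 1 + ζ + ζ ^ 2 + ζ ^ 3 + ζ ^ 4 + ζ ^ 5 + ζ ^ 6 = 0 := by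
    have h := (Complex.isPrimitiveRoot_exp 7 (by norm_num)).geom_sum_eq_zero (by norm_num)
    exact ⟨_, by simpa only [sum_range_succ, sum_range_zero, zero_add, pow_zero, pow_one] using h⟩
  obtain ⟨ζ, hζ⟩ := hζ
  have h := J_one_sq_mul_J_seven hζ rfl rfl rfl
  obtain ⟨A, hA⟩ : ∃ A, A = Jt 7 3 := ⟨_, rfl⟩
  obtain ⟨B, hB⟩ : ∃ B, B = Jt 7 2 := ⟨_, rfl⟩
  obtain ⟨C, hC⟩ : ∃ C, C = Jt 7 1 := ⟨_, rfl⟩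
  have hA1 : constantCoeff A = 1 := hA ▸ constantCoeff_Jt (by norm_num) (by norm_num)
  have hB1 : constantCoeff B = 1 := hB ▸ constantCoeff_Jt (by norm_num) (by norm_num)
  have hC1 : constantCoeff C = 1 := hC ▸ constantCoeff_Jt (by norm_num) (by norm_num)
  have hne : ∀ {f : ℂ⟦X⟧}, constantCoeff f = 1 → f ≠ 0 := fun hf h0 => by simp [h0] at hf
  have hJ1 : constantCoeff (J 1) = 1 := constantCoeff_J (by norm_num)
  have hJ7 : constantCoeff (J 7) = 1 := constantCoeff_J (by norm_num)
  rw [← hA, ← hB, ← hC] at h ⊢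
  refine ⟨x₀, x₁, x₅, hx, ?_⟩
  have hcomp := @dissection_seven_ext
    (J 1 * (x₀ ^ 2 - 2 * X * (J 7 * x₅))) (J 1 * (2 * (x₀ * x₁)))
    (J 1 * (x₁ ^ 2 - 2 * (x₀ * J 7))) (J 1 * (X * x₅ ^ 2 - 2 * (x₁ * J 7)))
    (J 1 * J 7 ^ 2) (J 1 * (2 * (x₀ * x₅))) (J 1 * (2 * (x₁ * x₅)))
    (A ^ 3 - X * (B * C ^ 2)) (-2 * (A ^ 2 * B)) (-(A * B ^ 2) - X * C ^ 3) (B ^ 3 + A ^ 2 * C)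
    (A * B * C) (2 * (B ^ 2 * C)) (-2 * (A * C ^ 2)) (by
      simp only [map_mul, map_sub, map_add, map_neg, map_pow, map_ofNat, expand_X, ← J_seven] at h ⊢
      rw [hx] at h
      linear_combination h)
  obtain ⟨-, h01, -, -, hABC, h05, h15⟩ := hcomp
  replace h01 : J 1 * (x₀ * x₁) = -(A ^ 2 * B) :=
    mul_left_cancel₀ two_ne_zero_series (by linear_combination h01)
  replace h05 : J 1 * (x₀ * x₅) = B ^ 2 * C :=
    mul_left_cancel₀ two_ne_zero_series (by linear_combination h05)
  replace h15 : J 1 * (x₁ * x₅) = -(A * C ^ 2) :=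
    mul_left_cancel₀ two_ne_zero_series (by linear_combination h15)
  have hB0 : x₀ * C = B * J 7 := by
    have hsq : (x₀ * C) ^ 2 = (B * J 7) ^ 2 := by
      refine mul_left_cancel₀ (mul_ne_zero (hne hJ1) (mul_ne_zero (hne hA1) (hne hC1))) ?_
      linear_combination C * (x₀ ^ 2 * J 1 * h15 - x₀ * x₅ * J 1 * h01 + A ^ 2 * B * h05) -
        A * B ^ 2 * C * hABC
    rcases sq_eq_sq_iff_eq_or_eq_neg.1 hsq with h | h
    · exact h
    · -- the sign is fixed by the constant terms
      have := congrArg constantCoeff h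
      norm_num [hc, hC1, hB1, hJ7] at this
  have hx1 : x₁ * B = -(A * J 7) := by
    refine mul_left_cancel₀ (mul_ne_zero (hne hJ7) (hne hJ1)) ?_
    linear_combination (-J 1 * x₁) * hB0 + C * h01 + A * hABC
  have hx5 : x₅ * A = C * J 7 := by
    refine mul_left_cancel₀ (mul_ne_zero (mul_ne_zero (hne hJ7) (hne hJ1)) (hne hB1)) ?_
    linear_combination (-J 1 * x₅ * A) * hB0 + A * C * h05 - B * C * hABC
  exact ⟨hB0, hx1, hx5⟩

/-- The identity between theta functions that reconciles the three linear equations: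
`J_{14,4} / J_{7,1} - J_{14,6} / J_{7,2} + q J_{14,2} / J_{7,3} = 2 q J₁₄³ / J₇³`. -/
theorem theta_identity : Jt 14 4 * (Jt 7 1)⁻¹ - Jt 14 6 * (Jt 7 2)⁻¹ + X * Jt 14 2 * (Jt 7 3)⁻¹ =
    2 * X * J 14 ^ 3 * (J 7)⁻¹ ^ 3 := by
  obtain ⟨x₀, x₁, x₅, hx, hC, hB, hA⟩ := exists_J_one_dissection_theta
  have h14 : J 14 = expand 7 (by norm_num) (J 2) := by
    rw [expand_J (by norm_num) (by norm_num)]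
  have hJ2 : J 2 = expand 7 (by norm_num) (expand 2 (by norm_num) x₀) +
      X ^ 2 * expand 7 (by norm_num) (expand 2 (by norm_num) x₁) -
      X ^ 4 * expand 7 (by norm_num) (J 14) +
      X ^ 10 * expand 7 (by norm_num) (expand 2 (by norm_num) x₅) := by
    have hcomm : ∀ f : ℂ⟦X⟧, expand 2 (by norm_num) (expand 7 (by norm_num) f) =
        expand 7 (by norm_num) (expand 2 (by norm_num) f) := fun f => by
      rw [← expand_mul, ← expand_mul]
    have h := congrArg (expand 2 (by norm_num)) hx
    simp only [map_add, map_sub, map_mul, map_pow, expand_X, hcomm] at h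
    rw [expand_J (by norm_num) (by norm_num), expand_J (by norm_num) (by norm_num)] at h
    norm_num only at h
    rw [h]; ring
  obtain ⟨y₀, hy₀⟩ : ∃ y, y = expand 2 (by norm_num) x₀ := ⟨_, rfl⟩
  obtain ⟨y₁, hy₁⟩ : ∃ y, y = expand 2 (by norm_num) x₁ := ⟨_, rfl⟩
  obtain ⟨y₅, hy₅⟩ : ∃ y, y = expand 2 (by norm_num) x₅ := ⟨_, rfl⟩
  rw [← hy₀, ← hy₁, ← hy₅] at hJ2
  obtain ⟨a₀, ha₀⟩ : ∃ a : ℂ⟦X⟧, a = expand 7 (by norm_num) (theta (-1) (-X)) := ⟨_, rfl⟩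
  obtain ⟨a₁, ha₁⟩ : ∃ a : ℂ⟦X⟧, a = theta (-X ^ 1) (-X ^ 6) := ⟨_, rfl⟩
  obtain ⟨a₂, ha₂⟩ : ∃ a : ℂ⟦X⟧, a = theta (-X ^ 2) (-X ^ 5) := ⟨_, rfl⟩
  obtain ⟨a₃, ha₃⟩ : ∃ a : ℂ⟦X⟧, a = theta (-X ^ 3) (-X ^ 4) := ⟨_, rfl⟩
  have hcomp := @dissection_seven_ext (2 * (x₀ * a₃) + X * (x₁ * a₀))
    (2 * (x₀ * a₂) + 2 * (x₁ * a₃) - X * (J 7 * a₀) + 2 * X * (x₅ * a₁))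
    (2 * (x₁ * a₂) - 2 * (J 7 * a₃)) (2 * (x₀ * a₁) - 2 * (J 7 * a₂))
    (2 * (x₁ * a₁) + X * (x₅ * a₀)) (2 * (x₅ * a₃) - 2 * (J 7 * a₁)) (x₀ * a₀ + 2 * (x₅ * a₂))
    (2 * (y₀ ^ 2 - 2 * X ^ 2 * (J 14 * y₅))) (2 * (X * J 14 ^ 2)) (2 * (2 * (y₀ * y₁)))
    (2 * (2 * X * (y₀ * y₅))) (2 * (y₁ ^ 2 - 2 * (y₀ * J 14))) (2 * (2 * X * (y₁ * y₅)))
    (2 * (-2 * (y₁ * J 14) + X ^ 2 * y₅ ^ 2)) (by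
      have h := J_one_mul_theta_neg
      rw [theta_neg_dissection, ← ha₀, ← ha₁, ← ha₂, ← ha₃, hx, hJ2] at h
      simp only [map_mul, map_sub, map_add, map_neg, map_pow, map_ofNat, expand_X] at h ⊢
      linear_combination h)
  have h1 := hcomp.2.1
  have h0 : J 7 * a₀ = 2 * J 14 ^ 2 := by
    rw [ha₀, J_seven, ← map_mul, J_one_mul_theta_neg, map_mul, map_pow, ← h14, map_ofNat]
  have hsum : x₀ * a₂ + x₁ * a₃ + X * (x₅ * a₁) = 2 * X * J 14 ^ 2 :=
    mul_left_cancel₀ two_ne_zero_series (by linear_combination h1 + X * h0)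
  have m1 := Jt_mul_theta_neg (a := 1) (by norm_num)
  have m2 := Jt_mul_theta_neg (a := 2) (by norm_num)
  have m3 := Jt_mul_theta_neg (a := 3) (by norm_num)
  norm_num only at m1 m2 m3
  rw [← ha₂] at m2
  rw [← ha₃] at m3
  rw [← ha₁] at m1
  have i7 : J 7 * (J 7)⁻¹ = 1 := PowerSeries.mul_inv_cancel _ (by simp [constantCoeff_J])
  have iA : Jt 7 3 * (Jt 7 3)⁻¹ = 1 := PowerSeries.mul_inv_cancel _ (by simp [constantCoeff_Jt])
  have iB : Jt 7 2 * (Jt 7 2)⁻¹ = 1 := PowerSeries.mul_inv_cancel _ (by simp [constantCoeff_Jt])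
  have iC : Jt 7 1 * (Jt 7 1)⁻¹ = 1 := PowerSeries.mul_inv_cancel _ (by simp [constantCoeff_Jt])
  have hJ : J 7 ^ 3 ≠ 0 := pow_ne_zero 3 (J_ne_zero (by norm_num))
  refine mul_left_cancel₀ hJ ?_
  linear_combination J 7 * (-(Jt 7 1)⁻¹ * m2 + (Jt 7 2)⁻¹ * m3 - X * (Jt 7 3)⁻¹ * m1) -
    J 14 * (a₂ * (Jt 7 1)⁻¹ * hC + a₃ * (Jt 7 2)⁻¹ * hB + X * a₁ * (Jt 7 3)⁻¹ * hA) +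
    J 14 * (a₂ * x₀ * iC + a₃ * x₁ * iB + X * a₁ * x₅ * iA) + J 14 * hsum -
    2 * X * J 14 ^ 3 * ((J 7 * (J 7)⁻¹) ^ 2 + J 7 * (J 7)⁻¹ + 1) * i7

/-! ### Sifting products with the rank generating function -/

theorem U_sub (p r : ℕ) (F G : ℂ⟦X⟧) : U p r (F - G) = U p r F - U p r G := by
  ext n; simp [coeff_U]

theorem U_four_mul (a b c F : ℂ⟦X⟧) (β γ : ℂ) :
    U 7 4 ((expand 7 (by norm_num) a - C β * (X * expand 7 (by norm_num) b) -
      C γ * (X ^ 3 * expand 7 (by norm_num) c)) * F) =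
        a * U 7 4 F - C β * (b * U 7 3 F) - C γ * (c * U 7 1 F) := by
  rw [sub_mul, sub_mul, U_sub, U_sub, ← pow_one X, ← pow_mul, mul_assoc, mul_assoc, mul_assoc,
    mul_assoc, U_C_mul, U_C_mul, U_X_pow_mul (s := 3) (by norm_num),
    U_X_pow_mul (s := 1) (by norm_num), U_expand_mul _ (by norm_num), U_expand_mul _ (by norm_num),
    U_expand_mul _ (by norm_num)]

theorem U_three_mul (a b c F : ℂ⟦X⟧) (β γ : ℂ) :
    U 7 3 ((expand 7 (by norm_num) a - C β * (X ^ 2 * expand 7 (by norm_num) b) -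
      C γ * (X ^ 6 * expand 7 (by norm_num) c)) * F) =
        a * U 7 3 F - C β * (b * U 7 1 F) - C γ * (X * (c * U 7 4 F)) := by
  rw [sub_mul, sub_mul, U_sub, U_sub, mul_assoc, mul_assoc, mul_assoc,
    mul_assoc, U_C_mul, U_C_mul, U_X_pow_mul (s := 1) (by norm_num),
    U_X_pow_mul_of_lt (s := 4) (by norm_num) (by norm_num), U_expand_mul _ (by norm_num),
    U_expand_mul _ (by norm_num), U_expand_mul _ (by norm_num)]

/-- The two ways of sifting `(zq)_∞ (z⁻¹q)_∞ (q)_∞ R(z, q)`. -/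
theorem linear_equation_one {w : ℂˣ} (hw : w ^ 7 = 1) (hw1 : w ≠ 1) :
    Jt 7 3 * U 7 4 (rankSeries w) - C ((w : ℂ) ^ 6 + 1 + w) * (Jt 7 2 * U 7 3 (rankSeries w)) -
      C ((w : ℂ) ^ 3 + w ^ 4) * (Jt 7 1 * U 7 1 (rankSeries w)) = J 7 ^ 2 := by
  have h := U_rankH hw
  rw [evalZ_one_rankH, map_pow, ← J_seven, rankH, map_mul, evalZ_rankBi,
    evalZ_thetaQuot_seven hw hw1 one_ne_zero] at h
  simp only [pow_one, mul_one] at h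
  rwa [U_four_mul] at h

theorem evalZ_thetaQuot_two (w : ℂˣ) (e : ℕ) :
    evalZ w (thetaQuot 2 e) = evalZ (w ^ 2) (thetaQuot 1 e) := by
  rw [evalZ_thetaQuot, evalZ_thetaQuot, ← zpow_natCast w 2, ← zpow_mul, ← zpow_mul]
  norm_num

theorem evalZ_one_add_zpw (w : ℂˣ) : evalZ w (1 + zpw 1) = C (1 + (w : ℂ)) := by
  rw [map_add, map_one, evalZ_zpw, zpow_one, map_add, map_one]

/-- The two ways of sifting `(1 + z) (z²q)_∞ (z⁻²q)_∞ (q)_∞ R(z, q)`. -/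
theorem linear_equation_two {w : ℂˣ} (hw : w ^ 7 = 1) (hw1 : w ≠ 1) :
    C (1 + (w : ℂ)) * (Jt 7 3 * U 7 4 (rankSeries w) -
      C (((w : ℂ) ^ 2) ^ 6 + 1 + (w : ℂ) ^ 2) * (Jt 7 2 * U 7 3 (rankSeries w)) -
      C (((w : ℂ) ^ 2) ^ 3 + ((w : ℂ) ^ 2) ^ 4) * (Jt 7 1 * U 7 1 (rankSeries w))) =
        C ((w : ℂ) ^ 4) * (2 * J 7 ^ 2) := by
  have hw2 : w ^ 2 ≠ 1 := fun h => hw1 (by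
    rw [← hw, show w ^ 7 = w * (w ^ 2) ^ 3 by rw [← pow_mul, ← pow_succ'], h, one_pow, mul_one])
  have h := U_rankK hw
  rw [evalZ_one_rankK, map_mul (expand _ _), map_pow (expand _ _), map_ofNat, ← J_seven, rankK,
    map_mul, map_mul, evalZ_rankBi, evalZ_thetaQuot_two, evalZ_one_add_zpw, mul_assoc, U_C_mul,
    evalZ_thetaQuot_seven (by rw [← pow_mul, mul_comm, pow_mul, hw, one_pow]) hw2 one_ne_zero] at h
  simp only [pow_one, mul_one, Units.val_pow_eq_pow_val] at h
  rwa [U_four_mul] at h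

theorem expand_evalZ_one_rankL : expand 7 (by norm_num) (evalZ 1 rankL) =
    2 * (J 14 ^ 3 * (J 7)⁻¹) := by
  rw [evalZ_one_rankL, map_mul, map_mul, map_pow, map_ofNat,
    expand_inv _ (by simp [constantCoeff_J]), expand_J (by norm_num) (by norm_num),
    expand_J (by norm_num) (by norm_num)]

/-- The two ways of sifting `(1 + z) (z²q²; q²)_∞ (z⁻²q²; q²)_∞ (q²; q²)_∞ R(z, q)`. -/
theorem linear_equation_three {w : ℂˣ} (hw : w ^ 7 = 1) (hw1 : w ≠ 1) :
    C (1 + (w : ℂ)) * (Jt 14 6 * U 7 3 (rankSeries w) -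
      C (((w : ℂ) ^ 2) ^ 6 + 1 + (w : ℂ) ^ 2) * (Jt 14 4 * U 7 1 (rankSeries w)) -
      C (((w : ℂ) ^ 2) ^ 3 + ((w : ℂ) ^ 2) ^ 4) * (X * (Jt 14 2 * U 7 4 (rankSeries w)))) =
        C ((w : ℂ) ^ 4) * (X * (2 * (J 14 ^ 3 * (J 7)⁻¹))) := by
  have hw2 : w ^ 2 ≠ 1 := fun h => hw1 (by
    rw [← hw, show w ^ 7 = w * (w ^ 2) ^ 3 by rw [← pow_mul, ← pow_succ'], h, one_pow, mul_one])
  have h := U_rankL hw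
  rw [expand_evalZ_one_rankL, rankL, map_mul, map_mul,
    evalZ_rankBi, evalZ_thetaQuot_two, evalZ_one_add_zpw, mul_assoc, U_C_mul,
    evalZ_thetaQuot_seven (by rw [← pow_mul, mul_comm, pow_mul, hw, one_pow]) hw2 two_ne_zero] at h
  norm_num only [Units.val_pow_eq_pow_val] at h
  rwa [U_three_mul] at h

/-! ### Solving the linear system -/

/-- The first two equations leave one degree of freedom, which the third removes: its defect is
the defect of the first unknown times a power series with nonzero constant term. -/
theorem linear_system_unique {ζ : ℂ} (hζ : 1 + ζ + ζ ^ 2 + ζ ^ 3 + ζ ^ 4 + ζ ^ 5 + ζ ^ 6 = 0)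
    {z : ℂ⟦X⟧} (hzζ : z = C ζ) {A₁ A₃ A₄ : ℂ⟦X⟧}
    (h1 : -(z ^ 4 + z ^ 3) * (Jt 7 1 * A₁) + (z ^ 5 + z ^ 4 + z ^ 3 + z ^ 2) * (Jt 7 2 * A₃) +
      Jt 7 3 * A₄ = J 7 ^ 2)
    (h2 : (z ^ 5 + z ^ 4 + z ^ 3) * (Jt 7 1 * A₁) + z ^ 4 * (Jt 7 2 * A₃) +
      (z + 1) * (Jt 7 3 * A₄) = 2 * z ^ 4 * J 7 ^ 2)
    (h3 : z ^ 4 * (Jt 14 4 * A₁) + (z + 1) * (Jt 14 6 * A₃) +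
      (z ^ 5 + z ^ 4 + z ^ 3) * (X * Jt 14 2 * A₄) =
        2 * z ^ 4 * (X * (J 14 ^ 3 * (J 7)⁻¹))) :
    A₁ = J 7 ^ 2 * (Jt 7 1)⁻¹ ∧ A₃ = (z ^ 5 + z ^ 2 + 1) * (J 7 ^ 2 * (Jt 7 2)⁻¹) ∧
      A₄ = -(z ^ 5 + z ^ 2) * (J 7 ^ 2 * (Jt 7 3)⁻¹) := by
  have hz : 1 + z + z ^ 2 + z ^ 3 + z ^ 4 + z ^ 5 + z ^ 6 = 0 := by
    rw [hzζ, ← map_zero C, ← hζ]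
    simp only [map_add, map_pow, map_one]
  have hid := theta_identity
  have i7 : J 7 * (J 7)⁻¹ = 1 := PowerSeries.mul_inv_cancel _ (by simp [constantCoeff_J])
  have i3 : Jt 7 3 * (Jt 7 3)⁻¹ = 1 := PowerSeries.mul_inv_cancel _ (by simp [constantCoeff_Jt])
  have i2 : Jt 7 2 * (Jt 7 2)⁻¹ = 1 := PowerSeries.mul_inv_cancel _ (by simp [constantCoeff_Jt])
  have i1 : Jt 7 1 * (Jt 7 1)⁻¹ = 1 := PowerSeries.mul_inv_cancel _ (by simp [constantCoeff_Jt])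
  obtain ⟨D₁, hD₁⟩ : ∃ D, D = Jt 7 1 * A₁ - J 7 ^ 2 := ⟨_, rfl⟩
  obtain ⟨D₃, hD₃⟩ : ∃ D, D = Jt 7 2 * A₃ - (z ^ 5 + z ^ 2 + 1) * J 7 ^ 2 := ⟨_, rfl⟩
  obtain ⟨D₄, hD₄⟩ : ∃ D, D = Jt 7 3 * A₄ + (z ^ 5 + z ^ 2) * J 7 ^ 2 := ⟨_, rfl⟩
  have e1 : -(z ^ 4 + z ^ 3) * D₁ + (z ^ 5 + z ^ 4 + z ^ 3 + z ^ 2) * D₃ + D₄ = 0 := by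
    linear_combination h1 - J 7 ^ 2 * (z ^ 4 + z - 1) * hz - (z ^ 4 + z ^ 3) * hD₁ +
      (z ^ 5 + z ^ 4 + z ^ 3 + z ^ 2) * hD₃ + hD₄
  have e2 : (z ^ 5 + z ^ 4 + z ^ 3) * D₁ + z ^ 4 * D₃ + (z + 1) * D₄ = 0 := by
    linear_combination h2 - J 7 ^ 2 * (z ^ 3 - z ^ 2) * hz + (z ^ 5 + z ^ 4 + z ^ 3) * hD₁ +
      z ^ 4 * hD₃ + (z + 1) * hD₄
  have h7 : (7 : ℂ⟦X⟧) ≠ 0 := fun h => by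
    have := congrArg constantCoeff h
    rw [map_ofNat, map_zero] at this
    norm_num at this
  have f3 : D₃ = -(z ^ 3 + z ^ 4) * D₁ := by
    refine mul_left_cancel₀ h7 ?_
    -- the first factor is `7` times the inverse of the coefficient of `D₃` after eliminating `D₄`
    linear_combination (-z - 3 * z ^ 2 + z ^ 3 - 3 * z ^ 4 - z ^ 5) * (e2 - (z + 1) * e1) -
      ((z ^ 5 + 4 * z ^ 4 + z ^ 3 + 7 * z - 7) * D₃ - (2 * z ^ 4 + 7 * z ^ 3) * D₁) * hz
  have f4 : D₄ = (z ^ 6 + z + 1) * D₁ := by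
    linear_combination e1 - (z ^ 5 + z ^ 4 + z ^ 3 + z ^ 2) * f3 +
      (z ^ 3 + z ^ 2 - 1) * D₁ * hz
  have f1 : (z ^ 4 * (Jt 14 4 * (Jt 7 1)⁻¹) - (z + 1) * (z ^ 3 + z ^ 4) * (Jt 14 6 * (Jt 7 2)⁻¹) +
      X * ((z ^ 5 + z ^ 4 + z ^ 3) * (z ^ 6 + z + 1) * (Jt 14 2 * (Jt 7 3)⁻¹))) * D₁ = 0 := by
    linear_combination h3 + z ^ 4 * Jt 14 4 * A₁ * i1 + (z + 1) * Jt 14 6 * A₃ * i2 +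
      (z ^ 5 + z ^ 4 + z ^ 3) * X * Jt 14 2 * A₄ * i3 - J 7 ^ 2 * z ^ 4 * hid -
      2 * z ^ 4 * X * J 14 ^ 3 * (J 7)⁻¹ * (J 7 * (J 7)⁻¹ + 1) * i7 -
      J 7 ^ 2 * (Jt 14 6 * (Jt 7 2)⁻¹ - z ^ 4 * X * Jt 14 2 * (Jt 7 3)⁻¹) * hz +
      z ^ 4 * Jt 14 4 * (Jt 7 1)⁻¹ * hD₁ +
      (z + 1) * Jt 14 6 * (Jt 7 2)⁻¹ * (hD₃ - f3) +
      (z ^ 5 + z ^ 4 + z ^ 3) * X * Jt 14 2 * (Jt 7 3)⁻¹ * (hD₄ - f4)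
  have hD : D₁ = 0 := by
    refine (mul_eq_zero.1 f1).resolve_left fun h0 => ?_
    have h := congrArg constantCoeff h0
    simp only [map_add, map_sub, map_mul, map_pow, map_one, map_zero, constantCoeff_X, zero_mul,
      add_zero, hzζ, constantCoeff_C] at h
    simp only [constantCoeff_inv,
      constantCoeff_Jt (show 0 < 1 by norm_num) (show 1 < 7 by norm_num),
      constantCoeff_Jt (show 0 < 2 by norm_num) (show 2 < 7 by norm_num),
      constantCoeff_Jt (show 0 < 4 by norm_num) (show 4 < 14 by norm_num),
      constantCoeff_Jt (show 0 < 6 by norm_num) (show 6 < 14 by norm_num), inv_one, mul_one] at h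
    have : (1 : ℂ) = 0 := by linear_combination (ζ + ζ ^ 5) * h - (-ζ ^ 4 + ζ - 1) * hζ
    exact one_ne_zero this
  rw [hD, mul_zero] at f3 f4
  refine ⟨?_, ?_, ?_⟩
  · linear_combination (-A₁) * i1 + (Jt 7 1)⁻¹ * (hD - hD₁)
  · linear_combination (-A₃) * i2 + (Jt 7 2)⁻¹ * (f3 - hD₃)
  · linear_combination (-A₄) * i3 + (Jt 7 3)⁻¹ * (f4 - hD₄)

theorem evalZ_thetaQuot_eq_qPoch (w : ℂˣ) (a : ℕ) {e : ℕ} (he : e ≠ 0) :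
    evalZ w (thetaQuot a e) = qPoch ((w : ℂ) ^ a • X ^ e) (X ^ e) *
      qPoch (((w : ℂ) ^ a)⁻¹ • X ^ e) (X ^ e) * qPoch (X ^ e) (X ^ e) := by
  have hX : (X : ℂ⟦X⟧) ∣ X ^ e := dvd_pow_self X he
  rw [evalZ_thetaQuot, qPoch_eq_poch _ hX, qPoch_eq_poch _ hX, qPoch_eq_poch _ hX,
    smul_eq_C_mul, smul_eq_C_mul, zpow_neg, zpow_natCast, Units.val_inv_eq_inv_val,
    Units.val_pow_eq_pow_val]

theorem C_pow_four_mul (c : ℂ) (f : ℂ⟦X⟧) : C (c ^ 4) * (2 * f) = (2 * c ^ 4) • f := by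
  rw [smul_eq_C_mul, map_mul, map_ofNat]; ring

theorem U_product_one {w : ℂˣ} (hw : w ^ 7 = 1) :
    U 7 4 (qPoch ((w : ℂ) • X) X * qPoch ((w : ℂ)⁻¹ • X) X * qPoch X X * rankSeries w) =
      J 7 ^ 2 := by
  have h := U_rankH hw
  have ht := evalZ_thetaQuot_eq_qPoch w 1 one_ne_zero
  simp only [pow_one, Nat.cast_one] at ht
  rwa [evalZ_one_rankH, map_pow, ← J_seven, rankH, map_mul, evalZ_rankBi, ht] at h

theorem U_product_two {w : ℂˣ} (hw : w ^ 7 = 1) :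
    U 7 4 ((1 + (w : ℂ)) • (qPoch ((w : ℂ) ^ 2 • X) X * qPoch (((w : ℂ) ^ 2)⁻¹ • X) X *
      qPoch X X * rankSeries w)) = (2 * (w : ℂ) ^ 4) • J 7 ^ 2 := by
  have h := U_rankK hw
  have ht := evalZ_thetaQuot_eq_qPoch w 2 one_ne_zero
  simp only [pow_one, Nat.cast_ofNat] at ht
  rwa [evalZ_one_rankK, map_mul (expand _ _), map_pow (expand _ _), map_ofNat, ← J_seven, rankK,
    map_mul, map_mul, evalZ_rankBi, evalZ_one_add_zpw, C_pow_four_mul, mul_assoc, ← smul_eq_C_mul,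
    ht] at h

theorem U_product_three {w : ℂˣ} (hw : w ^ 7 = 1) :
    U 7 3 ((1 + (w : ℂ)) • (qPoch ((w : ℂ) ^ 2 • X ^ 2) (X ^ 2) *
      qPoch (((w : ℂ) ^ 2)⁻¹ • X ^ 2) (X ^ 2) * qPoch (X ^ 2) (X ^ 2) * rankSeries w)) =
        (2 * (w : ℂ) ^ 4) • (X * (J 14 ^ 3 * (J 7)⁻¹)) := by
  have h := U_rankL hw
  have ht := evalZ_thetaQuot_eq_qPoch w 2 two_ne_zero
  simp only [Nat.cast_ofNat] at ht
  rwa [expand_evalZ_one_rankL, rankL, map_mul, map_mul, evalZ_rankBi, evalZ_one_add_zpw, mul_assoc,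
    ← smul_eq_C_mul, mul_left_comm X, C_pow_four_mul, ht] at h

end RankDissection

end

theorem mainTheorem4 (ζ : ℂ) (hζ : ζ = Complex.exp (2 * Real.pi * Complex.I / 7))
    (q : PowerSeries ℂ) (hq : q = PowerSeries.X)
    (R₁ R₃ R₄ : PowerSeries ℂ)
    (hR₁ : R₁ = RankDissection.U 7 1 (RankDissection.rankSeries ζ))
    (hR₃ : R₃ = RankDissection.U 7 3 (RankDissection.rankSeries ζ))
    (hR₄ : R₄ = RankDissection.U 7 4 (RankDissection.rankSeries ζ)) :
    -- the three sifted products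
    (RankDissection.U 7 4
        (RankDissection.qPoch (ζ • q) q * RankDissection.qPoch (ζ⁻¹ • q) q *
          RankDissection.qPoch q q * RankDissection.rankSeries ζ)
      = RankDissection.J 7 ^ 2 ∧
    RankDissection.U 7 4
        ((1 + ζ) • (RankDissection.qPoch (ζ ^ 2 • q) q *
          RankDissection.qPoch ((ζ ^ 2)⁻¹ • q) q *
          RankDissection.qPoch q q * RankDissection.rankSeries ζ))
      = (2 * ζ ^ 4) • RankDissection.J 7 ^ 2 ∧
    RankDissection.U 7 3
        ((1 + ζ) • (RankDissection.qPoch (ζ ^ 2 • q ^ 2) (q ^ 2) *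
          RankDissection.qPoch ((ζ ^ 2)⁻¹ • q ^ 2) (q ^ 2) *
          RankDissection.qPoch (q ^ 2) (q ^ 2) * RankDissection.rankSeries ζ))
      = (2 * ζ ^ 4) • (q * (RankDissection.J 14 ^ 3 * (RankDissection.J 7)⁻¹))) ∧
    -- the three linear equations for the components
    (-(ζ ^ 4 + ζ ^ 3) • (RankDissection.Jt 7 1 * R₁)
        + (ζ ^ 5 + ζ ^ 4 + ζ ^ 3 + ζ ^ 2) • (RankDissection.Jt 7 2 * R₃)
        + RankDissection.Jt 7 3 * R₄
      = RankDissection.J 7 ^ 2 ∧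
    (ζ ^ 5 + ζ ^ 4 + ζ ^ 3) • (RankDissection.Jt 7 1 * R₁)
        + ζ ^ 4 • (RankDissection.Jt 7 2 * R₃)
        + (ζ + 1) • (RankDissection.Jt 7 3 * R₄)
      = (2 * ζ ^ 4) • RankDissection.J 7 ^ 2 ∧
    ζ ^ 4 • (RankDissection.Jt 14 4 * R₁)
        + (ζ + 1) • (RankDissection.Jt 14 6 * R₃)
        + (ζ ^ 5 + ζ ^ 4 + ζ ^ 3) • (q * RankDissection.Jt 14 2 * R₄)
      = (2 * ζ ^ 4) • (q * (RankDissection.J 14 ^ 3 * (RankDissection.J 7)⁻¹))) ∧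
    -- the linear system determines its unknowns
    (∀ A₁ A₃ A₄ : PowerSeries ℂ,
      -(ζ ^ 4 + ζ ^ 3) • (RankDissection.Jt 7 1 * A₁)
          + (ζ ^ 5 + ζ ^ 4 + ζ ^ 3 + ζ ^ 2) • (RankDissection.Jt 7 2 * A₃)
          + RankDissection.Jt 7 3 * A₄
        = RankDissection.J 7 ^ 2 →
      (ζ ^ 5 + ζ ^ 4 + ζ ^ 3) • (RankDissection.Jt 7 1 * A₁)
          + ζ ^ 4 • (RankDissection.Jt 7 2 * A₃)
          + (ζ + 1) • (RankDissection.Jt 7 3 * A₄)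
        = (2 * ζ ^ 4) • RankDissection.J 7 ^ 2 →
      ζ ^ 4 • (RankDissection.Jt 14 4 * A₁)
          + (ζ + 1) • (RankDissection.Jt 14 6 * A₃)
          + (ζ ^ 5 + ζ ^ 4 + ζ ^ 3) • (q * RankDissection.Jt 14 2 * A₄)
        = (2 * ζ ^ 4) • (q * (RankDissection.J 14 ^ 3 * (RankDissection.J 7)⁻¹)) →
      A₁ = RankDissection.J 7 ^ 2 * (RankDissection.Jt 7 1)⁻¹ ∧
      A₃ = (ζ ^ 5 + ζ ^ 2 + 1) • (RankDissection.J 7 ^ 2 * (RankDissection.Jt 7 2)⁻¹) ∧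
      A₄ = -(ζ ^ 5 + ζ ^ 2) • (RankDissection.J 7 ^ 2 * (RankDissection.Jt 7 3)⁻¹)) ∧
    -- the product formulas
    (R₁ = RankDissection.J 7 ^ 2 * (RankDissection.Jt 7 1)⁻¹ ∧
    R₃ = (ζ ^ 5 + ζ ^ 2 + 1) • (RankDissection.J 7 ^ 2 * (RankDissection.Jt 7 2)⁻¹) ∧
    R₄ = -(ζ ^ 5 + ζ ^ 2) • (RankDissection.J 7 ^ 2 * (RankDissection.Jt 7 3)⁻¹)) := by
  open RankDissection PowerSeries in
  have hζ0 : ζ ≠ 0 := by rw [hζ]; exact Complex.exp_ne_zero _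
  have hroot : IsPrimitiveRoot ζ 7 := by
    rw [hζ]; exact_mod_cast Complex.isPrimitiveRoot_exp 7 (by norm_num)
  have hsum : 1 + ζ + ζ ^ 2 + ζ ^ 3 + ζ ^ 4 + ζ ^ 5 + ζ ^ 6 = 0 := by
    have h := hroot.geom_sum_eq_zero (by norm_num)
    simpa only [Finset.sum_range_succ, Finset.sum_range_zero, zero_add, pow_zero, pow_one] using h
  clear hζ
  obtain ⟨w, rfl⟩ : ∃ w : ℂˣ, (w : ℂ) = ζ := ⟨Units.mk0 ζ hζ0, rfl⟩
  have hw : w ^ 7 = 1 := Units.ext (by simpa using hroot.pow_eq_one)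
  have hw1 : w ≠ 1 := fun h => hroot.ne_one (by norm_num) (by rw [h]; rfl)
  obtain ⟨z, hz⟩ : ∃ z : PowerSeries ℂ, z = PowerSeries.C (w : ℂ) := ⟨_, rfl⟩
  have hz0 : 1 + z + z ^ 2 + z ^ 3 + z ^ 4 + z ^ 5 + z ^ 6 = 0 := by
    rw [hz, ← map_zero PowerSeries.C, ← hsum]
    simp only [map_add, map_pow, map_one]
  have L1 := linear_equation_one hw hw1
  have L2 := linear_equation_two hw hw1
  have L3 := linear_equation_three hw hw1
  rw [← hR₁, ← hR₃, ← hR₄] at L1 L2 L3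
  simp only [map_add, map_pow, map_one, ← hz] at L1 L2 L3
  subst hq
  have hsol := fun A₁ A₃ A₄ => @linear_system_unique w hsum z hz A₁ A₃ A₄
  refine ⟨⟨U_product_one hw, U_product_two hw, U_product_three hw⟩, ?_⟩
  simp only [smul_eq_C_mul, map_add, map_neg, map_mul, map_pow, map_one, map_ofNat, ← hz]
  -- the coefficients agree modulo `1 + ζ + ⋯ + ζ ^ 6 = 0`
  refine (fun h => ⟨h, hsol, hsol _ _ _ h.1 h.2.1 h.2.2⟩) (And.intro ?_ (And.intro ?_ ?_))
  · linear_combination L1 + Jt 7 2 * R₃ * hz0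
  · linear_combination L2 + (z ^ 7 - z ^ 5 + 1) * Jt 7 2 * R₃ * hz0 +
      (z ^ 3) * Jt 7 1 * R₁ * hz0
  · linear_combination L3 + (z ^ 7 - z ^ 5 + 1) * Jt 14 4 * R₁ * hz0 +
      (z ^ 3) * X * Jt 14 2 * R₄ * hz0
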